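/- **Setting.** Let $d_s,d,H\ge 1$, let the state space be $\mathbb R^{d_s}$, let $\mathcal A$ be a measurable action space, $s_0$ a fixed initial state, $\phi:\mathbb R^{d_s}\times\mathcal A\to\mathbb R^d$ measurable with $\|\phi\|_2\le 1$, $W^\star\in\mathbb R^{d_s\times d}$, $\sigma>0$, and $P^\star(\cdot\mid s,a)=\mathcal N(W^\star\phi(s,a),\sigma^2 I)$ (a kernelized nonlinear regulator). An adaptive algorithm chooses, at each iteration $t=0,1,\dots$, a policy $\pi_t$ as a (measurable) function of side information (drawn once, independently of the environment) and of the previous episodes, and runs it from $s_0$ for one episode $s_0^t,a_0^t,\dots,s_{H-1}^t,a_{H-1}^t,s_H^t$ in $P^\star$. For $\lambda>0$ and $\delta>0$ let $$\widehat W_t\in\arg\min_W\sum_{k<t}\sum_{h<H}\|W\phi(s_h^k,a_h^k)-s_{h+1}^k\|_2^2+\lambda\|W\|_F^2,\qquad \widehat P_t(\cdot\mid s,a)=\mathcal N(\widehat W_t\phi(s,a),\sigma^2I),$$ $$\Sigma_t=\sum_{k=0}^{t-1}\sum_{h=0}^{H-1}\phi(s_h^k,a_h^k)\phi(s_h^k,a_h^k)^\top+\lambda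 I,\qquad \sigma_t(s,a)=\frac{\beta_t}{\sigma}\|\phi(s,a)\|_{\Sigma_t^{-1}},$$ $$\beta_t^2=2\lambda\|W^\star\|_2^2+8\sigma^2\Big(d_s\ln 5+2\ln\frac{\max(t,1)^2}{\delta}+\ln 4+\ln\frac{\det\Sigma_t}{\det(\lambda I)}\Big).$$ There is a universal constant $C>0$ such that the following holds for every such regulator. 1. *(Calibration.)* For all $\lambda>0$, $\delta\in(0,1)$ and every adaptive algorithm, with probability at least $1-\delta$, for all $t\in\mathbb N$ and all $(s,a)$ simultaneously, $\|\widehat P_t(\cdot\mid s,a)-P^\star(\cdot\mid s,a)\|_1\le\min\{\sigma_t(s,a),2\}$. 2. *(Information gain.)* Let $\Pi$ be any class of policies, $\delta\in(0,1)$, $T\ge1$ and $0<\lambda\le\sigma^2/\|W^\star\|_2^2$ (no upper bound on $\lambda$ if $W^\star=0$). Then $$\mathcal I_T:=\sup_{\mathrm{Alg}}\mathbb E_{\mathrm{Alg}}\Big[\sum_{t<T}\sum_{h<H}\min\{\sigma_t^2(s_h^t,a_h^t),1\}\Big]\le C\,H\Big(d\ln\frac{T^2}{\delta}+d\,d_s+d^2L\Big)L,\qquad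 L=\ln\Big(1+\frac{TH}{\lambda}\Big),$$ where the supremum is over adaptive algorithms choosing policies in $\Pi$. For $\lambda=\sigma^2/\|W^\star\|_2^2$ one has $L=\ln(1+\|W^\star\|_2^2TH/\sigma^2)$, so that $\mathcal I_T=\widetilde O(Hd+Hdd_s+Hd^2)$. 3. *(Suboptimality.)* Let $\mathcal F$ be a finite set of measurable functions $\mathbb R^{d_s}\to[0,1]$ that contains the true cost $c$, let $\Pi$ be a policy class that contains the expert $\pi^e$, let $N,T\ge1$, $\lambda$ as in 2, and $\delta=1/(HT)$. Write $d^\pi_P$ for the average over $h=0,\dots,H-1$ of the laws of $(s_h,a_h)$ under $\pi$ and $P$, and $V^\pi=\mathbb E\big[\sum_{h<H}c(s_h)\big]$ for the expected total cost under $P^\star$. Given $N$ i.i.d. expert states $s^e_i\sim d^{\pi^e}_{P^\star}$, let the algorithm play an arbitrary $\pi_0\in\Pi$ and, for $t\ge1$, $$\pi_t\in\arg\min_{\pi\in\Pi}\max_{f\in\mathcal F}\Big\{\mathbb E_{(s,a)\sim d^\pi_{\widehat P_t}}[f(s)-b_t(s,a)]-\frac1N\sum_{i=1}^Nf(s^e_i)\Big\},\qquad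 b_t=H\min\{\sigma_t,2\}.$$ Then $$\mathbb E\Big[\min_{0\le t\le T-1}V^{\pi_t}-V^{\pi^e}\Big]\le C\,\big(1+\ln(TH)+L\big)\Big(\frac{H^3\sqrt{dd_s+d^2}}{\sqrt T}+H\sqrt{\frac{\ln|\mathcal F|}{N}}\Big),$$ that is, $\widetilde O\big(H^3\sqrt{dd_s+d^2}/\sqrt T+H\sqrt{\ln|\mathcal F|/N}\big)$. -/

import Mathlib

open MeasureTheory ProbabilityTheory
open scoped ENNReal

noncomputable section

namespace ImitationKNR

/-! ### Episodes, policies and value functions -/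

section Episodes

variable {E S A : Type*} [MeasurableSpace E] [MeasurableSpace S] [MeasurableSpace A]

/-- A transition `((s_h, a_h), s_{h+1})`. -/
abbrev Transition (S A : Type*) := (S × A) × S

/-- An episode of length `H`: the transitions at the steps `h = 0, …, H - 1`. -/
abbrev Episode (S A : Type*) (H : ℕ) := Fin H → Transition S A

/-- The episodes numbered `0, …, t - 1`. -/
abbrev History (S A : Type*) (H t : ℕ) := Fin t → Episode S A H

/-- The state reached at the end of the transitions seen so far (`s₀` if there are none). -/
def currentState (s₀ : S) : {h : ℕ} → Episode S A h → S
  | 0, _ => s₀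
  | h + 1, x => (x (Fin.last h)).2

lemma measurable_currentState (s₀ : S) (h : ℕ) :
    Measurable (fun x : Episode S A h => currentState s₀ x) := by
  cases h with
  | zero => exact measurable_const
  | succ h => exact (measurable_pi_apply (Fin.last h)).snd

lemma measurable_snoc {α : Type*} [MeasurableSpace α] (n : ℕ) :
    Measurable (fun p : (Fin n → α) × α => (Fin.snoc p.1 p.2 : Fin (n + 1) → α)) := by
  refine measurable_pi_lambda _ fun i => ?_
  refine Fin.lastCases ?_ (fun j => ?_) i
  · simpa using measurable_snd
  · simp only [Fin.snoc_castSucc]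
    exact (measurable_pi_apply j).comp measurable_fst

/-- One step: from the parameter `e` and the state `s`, draw `a ∼ κ (e, s)` and then
`s' ∼ P (s, a)`, and return `((s, a), s')`. -/
def stepKernel (κ : Kernel (E × S) A) (P : Kernel (S × A) S) :
    Kernel (E × S) (Transition S A) :=
  (Kernel.deterministic Prod.snd measurable_snd ×ₖ κ) ⊗ₖ P.comap Prod.snd measurable_snd

instance (κ : Kernel (E × S) A) (P : Kernel (S × A) S) [IsMarkovKernel κ] [IsMarkovKernel P] :
    IsMarkovKernel (stepKernel κ P) := by
  unfold stepKernel; infer_instance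

/-- The law of the first `h` transitions when the policy `κ (e, ·)` is run from `s₀` in the
environment with transition kernel `P`, as a kernel in the parameter `e`. -/
def rolloutKernel (κ : Kernel (E × S) A) (P : Kernel (S × A) S) (s₀ : S) :
    (h : ℕ) → Kernel E (Episode S A h)
  | 0 => Kernel.const E (Measure.dirac Fin.elim0)
  | h + 1 =>
    (rolloutKernel κ P s₀ h ⊗ₖ
      (stepKernel κ P).comap (fun p : E × Episode S A h => (p.1, currentState s₀ p.2))
        (measurable_fst.prodMk ((measurable_currentState s₀ h).comp measurable_snd))).map
      (fun p => Fin.snoc p.1 p.2)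

instance (κ : Kernel (E × S) A) (P : Kernel (S × A) S) (s₀ : S) (h : ℕ)
    [IsMarkovKernel κ] [IsMarkovKernel P] : IsMarkovKernel (rolloutKernel κ P s₀ h) := by
  induction h with
  | zero => unfold rolloutKernel; infer_instance
  | succ h ih => unfold rolloutKernel; exact Kernel.IsMarkovKernel.map _ (measurable_snoc h)

/-- The law of an episode of length `H` of a fixed policy `π` under `P`, started from `s₀`. -/
def rollout (π : Kernel S A) (P : Kernel (S × A) S) (s₀ : S) (H : ℕ) :
    Measure (Episode S A H) :=
  rolloutKernel (Kernel.prodMkLeft Unit π) P s₀ H ()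

/-- The average state-action distribution `d^π_P = (1/H) ∑_{h < H} Pr(s_h = ·, a_h = ·)`. -/
def occupancy (π : Kernel S A) (P : Kernel (S × A) S) (s₀ : S) (H : ℕ) : Measure (S × A) :=
  (H : ℝ≥0∞)⁻¹ • ∑ h : Fin H, (rollout π P s₀ H).map (fun τ => (τ h).1)

/-- The expected total cost `V^π_{P;f} = E [∑_{h < H} f(s_h)]`. -/
def value (π : Kernel S A) (P : Kernel (S × A) S) (s₀ : S) (H : ℕ) (f : S → ℝ) : ℝ :=
  ∫ τ, ∑ h : Fin H, f (τ h).1.1 ∂(rollout π P s₀ H)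

/-- An adaptive algorithm with side information in `E`: at iteration `t` it maps the side
information and the episodes `0, …, t - 1` (measurably) to a policy. -/
abbrev Algorithm (E S A : Type*) [MeasurableSpace E] [MeasurableSpace S] [MeasurableSpace A]
    (H : ℕ) :=
  (t : ℕ) → Kernel ((E × History S A H t) × S) A

/-- The policy `π_t` that the algorithm plays at iteration `t`. -/
def Algorithm.policy {H : ℕ} (alg : Algorithm E S A H) (t : ℕ) (e : E) (D : History S A H t) :
    Kernel S A :=
  Kernel.sectR (alg t) (e, D)

/-- The joint law of the side information `e ∼ ν` and of the first `T` episodes, when the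
policies chosen by the algorithm are run one after the other under `P`. -/
def interactionLaw {H : ℕ} (ν : Measure E) (alg : Algorithm E S A H) (P : Kernel (S × A) S)
    (s₀ : S) : (T : ℕ) → Measure (E × History S A H T)
  | 0 => ν.map (fun e => (e, Fin.elim0))
  | T + 1 =>
    (interactionLaw ν alg P s₀ T ⊗ₘ rolloutKernel (alg T) P s₀ H).map
      (fun p => (p.1.1, Fin.snoc p.1.2 p.2))

lemma isProbabilityMeasure_interactionLaw {H : ℕ} (ν : Measure E) [IsProbabilityMeasure ν]
    (alg : Algorithm E S A H) [∀ t, IsMarkovKernel (alg t)] (P : Kernel (S × A) S)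
    [IsMarkovKernel P] (s₀ : S) (T : ℕ) :
    IsProbabilityMeasure (interactionLaw ν alg P s₀ T) := by
  induction T with
  | zero =>
    exact Measure.isProbabilityMeasure_map (measurable_id.prodMk measurable_const).aemeasurable
  | succ T ih =>
    refine Measure.isProbabilityMeasure_map (Measurable.aemeasurable ?_)
    exact measurable_fst.fst.prodMk
      ((measurable_snoc T).comp (measurable_fst.snd.prodMk measurable_snd))

/-- The first `t` of `T` episodes. -/
def History.take {H T : ℕ} (D : History S A H T) (t : Fin T) : History S A H t :=
  fun k => D (Fin.castLE t.isLt.le k)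

/-- The law of `N` i.i.d. expert states drawn from the state marginal of `d^{π^e}`. -/
def expertLaw (πe : Kernel S A) (P : Kernel (S × A) S) (s₀ : S) (H N : ℕ) :
    Measure (Fin N → S) :=
  Measure.pi fun _ => (occupancy πe P s₀ H).map Prod.fst

end Episodes

/-- `‖P - Q‖₁`: the total mass of the total variation of the signed measure `P - Q`. -/
def l1Dist {S : Type*} [MeasurableSpace S] (P Q : Measure S) [IsFiniteMeasure P]
    [IsFiniteMeasure Q] : ℝ :=
  (P.toSignedMeasure - Q.toSignedMeasure).totalVariation.real Set.univ

/-! ### Kernelized nonlinear regulators -/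

/-- The state space `ℝ^{d_s}`. -/
abbrev State (ds : ℕ) := EuclideanSpace ℝ (Fin ds)

/-- The spectral norm `‖W‖₂`. -/
def spectralNorm₂ {m n : ℕ} (W : Matrix (Fin m) (Fin n) ℝ) : ℝ :=
  ‖(Matrix.toEuclideanLin W).toContinuousLinearMap‖

/-- A kernelized nonlinear regulator with `d`-dimensional features. -/
structure KNR (ds d : ℕ) (A : Type*) [MeasurableSpace A] where
  /-- the feature map `φ` -/
  φ : State ds × A → EuclideanSpace ℝ (Fin d)
  measurable_φ : Measurable φ
  norm_φ_le : ∀ z, ‖φ z‖ ≤ 1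
  /-- the unknown parameter `W⋆` -/
  W : Matrix (Fin ds) (Fin d) ℝ
  /-- the standard deviation of the noise -/
  σ : ℝ
  σ_pos : 0 < σ
  /-- the initial state -/
  s₀ : State ds

open scoped MatrixOrder in
lemma measurable_multivariateGaussian {n : ℕ} (S : Matrix (Fin n) (Fin n) ℝ) :
    Measurable (fun m : EuclideanSpace ℝ (Fin n) => multivariateGaussian m S) := by
  refine Measure.measurable_of_measurable_coe _ fun s hs => ?_
  have h : ∀ m : EuclideanSpace ℝ (Fin n), multivariateGaussian m S s
      = ∫⁻ x, s.indicator 1 (m + Matrix.toEuclideanCLM (𝕜 := ℝ) (CFC.sqrt S) x)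
          ∂(stdGaussian (EuclideanSpace ℝ (Fin n))) := by
    intro m
    have hm : Measurable (fun x : EuclideanSpace ℝ (Fin n) =>
        m + Matrix.toEuclideanCLM (𝕜 := ℝ) (CFC.sqrt S) x) := by fun_prop
    rw [multivariateGaussian, ← lintegral_indicator_one hs,
      lintegral_map (measurable_one.indicator hs) hm]
  simp_rw [h]
  refine Measurable.lintegral_prod_right' (f := fun p : EuclideanSpace ℝ (Fin n) ×
    EuclideanSpace ℝ (Fin n) => s.indicator (1 : EuclideanSpace ℝ (Fin n) → ℝ≥0∞)
      (p.1 + Matrix.toEuclideanCLM (𝕜 := ℝ) (CFC.sqrt S) p.2)) ?_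
  exact (measurable_one.indicator hs).comp (by fun_prop)

namespace KNR

variable {ds d : ℕ} {A : Type*} [MeasurableSpace A] (M : KNR ds d A)

/-- The transition kernel `(s, a) ↦ N(V φ(s, a), σ² I)` with parameter `V`. -/
def model (V : Matrix (Fin ds) (Fin d) ℝ) : Kernel (State ds × A) (State ds) where
  toFun z := multivariateGaussian (Matrix.toEuclideanLin V (M.φ z)) (M.σ ^ 2 • 1)
  measurable' := (measurable_multivariateGaussian _).comp
    ((Matrix.toEuclideanLin V).continuous_of_finiteDimensional.measurable.comp M.measurable_φ)

instance (V : Matrix (Fin ds) (Fin d) ℝ) : IsMarkovKernel (M.model V) :=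
  ⟨fun _ => by simp only [model, Kernel.coe_mk]; infer_instance⟩

/-- The true transition kernel `P⋆`. -/
def env : Kernel (State ds × A) (State ds) := M.model M.W

instance : IsMarkovKernel M.env := by unfold env; infer_instance

variable {H t : ℕ}

/-- The ridge regression objective
`∑ ‖V φ(s, a) - s'‖² + lam ‖V‖_F²` on the data collected in the episodes `0, …, t - 1`. -/
def ridgeLoss (lam : ℝ) (D : History (State ds) A H t) (V : Matrix (Fin ds) (Fin d) ℝ) : ℝ :=
  (∑ k : Fin t, ∑ h : Fin H, ‖Matrix.toEuclideanLin V (M.φ (D k h).1) - (D k h).2‖ ^ 2)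
    + lam * ∑ i, ∑ j, V i j ^ 2

/-- `West` is kernel ridge regression: it returns a minimizer of the ridge objective. -/
def IsRidgeRegression (lam : ℝ)
    (West : (t : ℕ) → History (State ds) A H t → Matrix (Fin ds) (Fin d) ℝ) : Prop :=
  ∀ t D V, M.ridgeLoss lam D (West t D) ≤ M.ridgeLoss lam D V

/-- `Σ_t = ∑_{k < t} ∑_{h < H} φ(s_h^k, a_h^k) φ(s_h^k, a_h^k)ᵀ + lam I`. -/
def covariance (lam : ℝ) (D : History (State ds) A H t) : Matrix (Fin d) (Fin d) ℝ :=
  (∑ k : Fin t, ∑ h : Fin H,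
    Matrix.vecMulVec (M.φ (D k h).1).ofLp (M.φ (D k h).1).ofLp) + lam • 1

/-- `β_t`; at `t = 0`, where there is no data, `t²` is read as `1`. -/
def beta (lam δ : ℝ) (D : History (State ds) A H t) : ℝ :=
  Real.sqrt (2 * lam * spectralNorm₂ M.W ^ 2 + 8 * M.σ ^ 2 *
    (ds * Real.log 5 + 2 * Real.log ((max t 1 : ℕ) ^ 2 / δ) + Real.log 4
      + Real.log ((M.covariance lam D).det / (lam • (1 : Matrix (Fin d) (Fin d) ℝ)).det)))

/-- The uncertainty `σ_t(s, a) = (β_t / σ) ‖φ(s, a)‖_{Σ_t⁻¹}`. -/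
def uncertainty (lam δ : ℝ) (D : History (State ds) A H t) (z : State ds × A) : ℝ :=
  M.beta lam δ D / M.σ *
    Real.sqrt ((M.φ z).ofLp ⬝ᵥ Matrix.mulVec (M.covariance lam D)⁻¹ (M.φ z).ofLp)

/-- The bonus `b_t(s, a) = H min{σ_t(s, a), 2}`. -/
def bonus (lam δ : ℝ) (D : History (State ds) A H t) (z : State ds × A) : ℝ :=
  H * min (M.uncertainty lam δ D z) 2

/-- The information gain: the supremum, over all adaptive algorithms that choose policies in
`Pol`, of `E [∑_{t < T} ∑_{h < H} min{σ_t²(s_h^t, a_h^t), 1}]`. The algorithms may use side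
information drawn from `ν`. -/
def infoGain {E : Type*} [MeasurableSpace E] (ν : Measure E) (Pol : Set (Kernel (State ds) A))
    (H : ℕ) (lam δ : ℝ) (T : ℕ) : ℝ≥0∞ :=
  ⨆ (alg : Algorithm E (State ds) A H) (_ : ∀ t e D, alg.policy t e D ∈ Pol),
    ∫⁻ x, ENNReal.ofReal (∑ t : Fin T, ∑ h : Fin H,
      min (M.uncertainty lam δ (x.2.take t) (x.2 t h).1 ^ 2) 1)
      ∂(interactionLaw ν alg M.env M.s₀ T)

/-- The objective `max_{f ∈ F} E_{(s,a) ∼ d^π_{P'}} [f(s) - b(s, a)] - (1/N) ∑_i f(s_i^e)`. -/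
def imitationLoss {N : ℕ} (F : Finset (State ds → ℝ)) (H : ℕ)
    (P' : Kernel (State ds × A) (State ds)) (b : State ds × A → ℝ) (e : Fin N → State ds)
    (π : Kernel (State ds) A) : ℝ :=
  ⨆ f : F, (∫ z, ((f : State ds → ℝ) z.1 - b z) ∂(occupancy π P' M.s₀ H)
    - (∑ i, (f : State ds → ℝ) (e i)) / N)

/-- `alg` is a run of the imitation algorithm with expert states as side information: the
initial policy is any member of `Pol`, and for `t ≥ 1` the policy `π_t` minimizes over `Pol` the
objective built from the ridge regression model and from the bonus after `t` episodes. -/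
structure IsMobILE {N : ℕ} (F : Finset (State ds → ℝ)) (Pol : Set (Kernel (State ds) A))
    (lam δ : ℝ) (West : (t : ℕ) → History (State ds) A H t → Matrix (Fin ds) (Fin d) ℝ)
    (alg : Algorithm (Fin N → State ds) (State ds) A H) : Prop where
  mem : ∀ t e D, alg.policy t e D ∈ Pol
  minimizes : ∀ t e D, 1 ≤ t → ∀ π ∈ Pol,
    M.imitationLoss F H (M.model (West t D)) (M.bonus lam δ D) e (alg.policy t e D)
      ≤ M.imitationLoss F H (M.model (West t D)) (M.bonus lam δ D) e π

end KNR

end ImitationKNR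

end

open ImitationKNR

/-!
The three parts rest on one self-normalized martingale. Write `Σ` for the regularized covariance and
`x` for the sum of the features weighted by the noise in a fixed unit direction. The noise of a
transition in that direction is a standard Gaussian variable given the past, and by the rank-one
formulas for `det` and `Σ⁻¹` (the matrix determinant lemma and Sherman-Morrison) the integral of
`det(Σ)^{-1/2} exp(xᵀ Σ⁻¹ x / 2)` over one further transition is its current value
(`lintegral_mixtureDensity_rankOne`). Hence this quantity has constant expectation along the
interaction, and Markov's inequality bounds `xᵀ Σ⁻¹ x` (`KNR.interactionLaw_noise_tail_le`).

*Calibration.* A union bound over a net of at most `5 ^ ds` directions (`exists_net`) and over the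
iterations bounds the noise in all directions at once. The first-order condition of ridge regression
turns this into a bound of `‖(Ŵ - W) φ‖` by `β ‖φ‖_{Σ⁻¹}` (`KNR.sq_norm_ridge_error_le`), and the
`L¹` distance of two Gaussian laws with covariance `σ² I` is at most the distance of their means
divided by `σ` (`l1Dist_multivariateGaussian_le`, by the Cameron-Martin density and the Hellinger
affinity).

*Information gain.* The bound holds along every sequence of episodes. By the elliptical potential
lemma the sum of `log (1 + ‖φ‖²_{Σ⁻¹})` is at most `H log (det Σ_T / det (λ I))`, where the factor
`H` comes from updating `Σ` only once per episode (`KNR.sum_log_one_add_invQuad_le`), and the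
determinant is at most `(λ + T H) ^ d`.

*Suboptimality.* On the event of calibration, the simulation inequality `integral_sum_cost_le` gives
optimism: with the bonus subtracted, the model underestimates every cost, and for the true
environment it does so by at most `1 + 2 H` times the expected bonus. So the loss of the expert is
at most the largest deviation of the empirical means over the cost class, and the regret of a single
iteration is bounded by deviations and by the bonus (`KNR.value_sub_value_expert_le`). Averaging over
the iterations, the deviations are handled by the maximal inequality `integral_maxDeviation_le` and
the bonuses by the Cauchy-Schwarz inequality and the information gain.
-/

namespace ImitationKNR

/-! ### Gaussian shifts and the total variation distance -/

section Gaussian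

variable {E : Type*} [NormedAddCommGroup E] [InnerProductSpace ℝ E] [FiniteDimensional ℝ E]
  [MeasurableSpace E] [BorelSpace E]

lemma map_inner_stdGaussian (u : E) :
    (stdGaussian E).map (fun x => inner ℝ u x) = gaussianReal 0 (‖u‖₊ ^ 2) := by
  have h := IsGaussian.map_eq_gaussianReal (μ := stdGaussian E) (innerSL ℝ u)
  rw [variance_dual_stdGaussian, integral_strongDual_stdGaussian, innerSL_apply_norm] at h
  convert! h using 2
  ext; simp

lemma integrable_exp_inner_stdGaussian (u : E) :
    Integrable (fun x => Real.exp (inner ℝ u x)) (stdGaussian E) := by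
  have h := integrable_exp_mul_gaussianReal (μ := 0) (v := ‖u‖₊ ^ 2) 1
  rw [← map_inner_stdGaussian, integrable_map_measure (by fun_prop) (by fun_prop)] at h
  simpa [Function.comp_def] using h

lemma integral_exp_inner_stdGaussian (u : E) :
    ∫ x, Real.exp (inner ℝ u x) ∂(stdGaussian E) = Real.exp (‖u‖ ^ 2 / 2) := by
  have h := mgf_gaussianReal (map_inner_stdGaussian u) 1
  simpa [mgf] using h

open Complex in
/-- The Cameron-Martin formula for the standard Gaussian measure. -/
lemma map_add_right_stdGaussian (u : E) :
    (stdGaussian E).map (fun x => x + u) = (stdGaussian E).withDensity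
      (fun x => ENNReal.ofReal (Real.exp (inner ℝ u x - ‖u‖ ^ 2 / 2))) := by
  have hfin : IsFiniteMeasure ((stdGaussian E).withDensity
      (fun x => ENNReal.ofReal (Real.exp (inner ℝ u x - ‖u‖ ^ 2 / 2)))) := by
    refine isFiniteMeasure_withDensity_ofReal (Integrable.hasFiniteIntegral ?_)
    simp_rw [Real.exp_sub]
    exact (integrable_exp_inner_stdGaussian u).div_const _
  refine Measure.ext_of_charFun ?_
  ext t
  rw [charFun_apply, integral_map (by fun_prop) (by fun_prop), charFun_apply,
    integral_withDensity_eq_integral_toReal_smul (by fun_prop) (by simp)]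
  simp_rw [ENNReal.toReal_ofReal (Real.exp_pos _).le, inner_add_left, ofReal_add, add_mul,
    Complex.exp_add]
  rw [integral_mul_const, ← charFun_apply, charFun_stdGaussian]
  have key : ∫ x : E, cexp (((inner ℝ u x : ℝ) : ℂ) + (inner ℝ x t : ℝ) * I) ∂(stdGaussian E)
      = cexp ((‖u‖ ^ 2 - ‖t‖ ^ 2) / 2 + (inner ℝ u t : ℝ) * I) := by
    rw [stdGaussian, integral_map (Measurable.aemeasurable (by fun_prop))
      (Measurable.aestronglyMeasurable (by fun_prop))]
    set b := stdOrthonormalBasis ℝ E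
    have h1 : ∀ x : Fin (Module.finrank ℝ E) → ℝ,
        cexp (((inner ℝ u (∑ i, x i • b i) : ℝ) : ℂ) + (inner ℝ (∑ i, x i • b i) t : ℝ) * I)
        = ∏ i, cexp (((inner ℝ u (b i) : ℝ) + (inner ℝ (b i) t : ℝ) * I) * x i) := by
      intro x
      rw [← Complex.exp_sum, inner_sum, sum_inner]
      congr 1
      push_cast
      rw [Finset.sum_mul, ← Finset.sum_add_distrib]
      refine Finset.sum_congr rfl fun i _ => ?_
      rw [real_inner_smul_left, real_inner_smul_right]
      push_cast
      ring
    simp_rw [h1]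
    rw [integral_fintype_prod_eq_prod
      (f := fun i (x : ℝ) => cexp (((inner ℝ u (b i) : ℝ) + (inner ℝ (b i) t : ℝ) * I) * x))]
    have h2 : ∀ z : ℂ, ∫ x : ℝ, cexp (z * x) ∂(gaussianReal 0 1) = cexp (z ^ 2 / 2) := by
      intro z
      have := complexMGF_id_gaussianReal (μ := 0) (v := 1) z
      simpa [complexMGF] using this
    simp_rw [h2]
    rw [← Complex.exp_sum]
    congr 1
    have e1 : (∑ i, (inner ℝ u (b i) : ℝ) * (inner ℝ (b i) t : ℝ) : ℝ) = inner ℝ u t :=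
      b.sum_inner_mul_inner u t
    have e2 : (∑ i, (inner ℝ u (b i) : ℝ) ^ 2 : ℝ) = ‖u‖ ^ 2 := b.sum_sq_inner_left u
    have e3 : (∑ i, (inner ℝ (b i) t : ℝ) ^ 2 : ℝ) = ‖t‖ ^ 2 := b.sum_sq_inner_right t
    rw [← e1, ← ofReal_pow, ← ofReal_pow, ← e2, ← e3]
    push_cast
    rw [Finset.sum_mul, ← Finset.sum_sub_distrib, Finset.sum_div, ← Finset.sum_add_distrib]
    refine Finset.sum_congr rfl fun i _ => ?_
    linear_combination (inner ℝ (b i) t : ℂ) ^ 2 / 2 * I_sq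
  have h3 : ∀ x : E, Real.exp (inner ℝ u x - ‖u‖ ^ 2 / 2) • cexp ((inner ℝ x t : ℝ) * I)
      = cexp (((inner ℝ u x : ℝ) : ℂ) + (inner ℝ x t : ℝ) * I) * cexp (-(‖u‖ ^ 2 / 2)) := by
    intro x
    rw [real_smul, ofReal_exp, ← Complex.exp_add, ← Complex.exp_add]
    congr 1
    push_cast
    ring
  simp_rw [h3]
  rw [integral_mul_const, key, ← Complex.exp_add, ← Complex.exp_add]
  congr 1
  ring

/-- The `L¹` distance of a shifted standard Gaussian density from `1`, bounded through the
Hellinger affinity `exp (-‖u‖² / 8)`. -/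
lemma integral_abs_exp_sub_one_le (u : E) :
    ∫ x, |Real.exp (inner ℝ u x - ‖u‖ ^ 2 / 2) - 1| ∂(stdGaussian E) ≤ ‖u‖ := by
  rcases eq_or_ne u 0 with rfl | hu
  · simp
  have hr : 0 < ‖u‖ := norm_pos_iff.2 hu
  set r := ‖u‖ with hrdef
  set B := Real.exp (-(r ^ 2 / 8)) with hB
  have hBpos : 0 < B := Real.exp_pos _
  set a := 2 * (1 + B) / r with ha
  have hapos : 0 < a := by positivity
  let s : E → ℝ := fun x => Real.exp (inner ℝ u x / 2) * Real.exp (-(r ^ 2 / 4))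
  let L : E → ℝ := fun x => Real.exp (inner ℝ u x) * Real.exp (-(r ^ 2 / 2))
  have hsint : Integrable s (stdGaussian E) := by
    have := (integrable_exp_inner_stdGaussian ((1 / 2 : ℝ) • u)).mul_const
      (Real.exp (-(r ^ 2 / 4)))
    refine this.congr (ae_of_all _ fun x => ?_)
    simp only [s, real_inner_smul_left]
    ring_nf
  have hsval : ∫ x, s x ∂(stdGaussian E) = B := by
    have h := integral_exp_inner_stdGaussian ((1 / 2 : ℝ) • u)
    simp only [s]
    rw [integral_mul_const]
    have : ∀ x, inner ℝ u x / 2 = inner ℝ ((1 / 2 : ℝ) • u) x := by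
      intro x; rw [real_inner_smul_left]; ring
    simp_rw [this]
    rw [h, ← Real.exp_add, norm_smul, hB]
    congr 1
    rw [← hrdef]
    norm_num
    ring
  have hLint : Integrable L (stdGaussian E) := (integrable_exp_inner_stdGaussian u).mul_const _
  have hLval : ∫ x, L x ∂(stdGaussian E) = 1 := by
    simp only [L]
    rw [integral_mul_const, integral_exp_inner_stdGaussian, ← Real.exp_add, ← hrdef]
    simp
  have hsL : ∀ x, s x ^ 2 = L x := by
    intro x
    simp only [s, L]
    rw [mul_pow, ← Real.exp_nat_mul, ← Real.exp_nat_mul]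
    congr 2 <;> · push_cast; ring
  have hLe : ∀ x, Real.exp (inner ℝ u x - r ^ 2 / 2) = L x := by
    intro x; simp only [L]; rw [← Real.exp_add]; ring_nf
  have hspos : ∀ x, 0 < s x := fun x => by positivity
  -- `|s² - 1| ≤ (a/2) (s - 1)² + (1/(2a)) (s + 1)²`; this `a` balances the two terms.
  have hpt : ∀ x, |Real.exp (inner ℝ u x - r ^ 2 / 2) - 1|
      ≤ (a / 2 + 1 / (2 * a)) * L x + (1 / a - a) * s x + (a / 2 + 1 / (2 * a)) := by
    intro x
    rw [hLe, ← hsL]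
    have h1 : a * (1 / a) = 1 := by field_simp
    set q := 1 / a with hq
    have h2 : 1 / (2 * a) = q / 2 := by rw [hq]; field_simp
    rw [h2]
    have hqpos : 0 < q := by positivity
    have h3 : 0 ≤ q * (a * |s x - 1| - (s x + 1)) ^ 2 := by positivity
    have h4 : |s x ^ 2 - 1| = |s x - 1| * (s x + 1) := by
      rw [show s x ^ 2 - 1 = (s x - 1) * (s x + 1) by ring, abs_mul,
        abs_of_pos (show 0 < s x + 1 by linarith [hspos x])]
    have h5 : |s x - 1| ^ 2 = (s x - 1) ^ 2 := sq_abs _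
    rw [h4]
    have h6 : q * (a * |s x - 1| - (s x + 1)) ^ 2
        = (a * q) * a * (s x - 1) ^ 2 - 2 * (a * q) * (|s x - 1| * (s x + 1))
          + q * (s x + 1) ^ 2 := by rw [← h5]; ring
    rw [h6, h1] at h3
    nlinarith
  have hI : Integrable (fun x => (a / 2 + 1 / (2 * a)) * L x + (1 / a - a) * s x
      + (a / 2 + 1 / (2 * a))) (stdGaussian E) :=
    ((hLint.const_mul _).add (hsint.const_mul _)).add (integrable_const _)
  calc ∫ x, |Real.exp (inner ℝ u x - r ^ 2 / 2) - 1| ∂(stdGaussian E)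
      ≤ ∫ x, ((a / 2 + 1 / (2 * a)) * L x + (1 / a - a) * s x + (a / 2 + 1 / (2 * a)))
          ∂(stdGaussian E) := by
        refine integral_mono ?_ hI hpt
        simp_rw [hLe]
        exact (hLint.sub (integrable_const 1)).abs
    _ = (a / 2 + 1 / (2 * a)) + (1 / a - a) * B + (a / 2 + 1 / (2 * a)) := by
        have h1 := integral_add (hLint.const_mul (a / 2 + 1 / (2 * a)))
          (hsint.const_mul (1 / a - a))
        have h2 := integral_add ((hLint.const_mul (a / 2 + 1 / (2 * a))).add
          (hsint.const_mul (1 / a - a))) (integrable_const (a / 2 + 1 / (2 * a)))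
        simp only [Pi.add_apply] at h1 h2
        rw [h2, h1, integral_const_mul, integral_const_mul, hLval, hsval]
        simp
    _ = a * (1 - B) + (1 + B) / a := by field_simp; ring
    _ = 2 * (1 - B ^ 2) / r + r / 2 := by rw [ha]; field_simp; ring
    _ ≤ r := by
        have hB2 : 1 - r ^ 2 / 4 ≤ B ^ 2 := by
          rw [hB, ← Real.exp_nat_mul]
          have := Real.add_one_le_exp (-(r ^ 2 / 4))
          have e : ((2 : ℕ) : ℝ) * -(r ^ 2 / 8) = -(r ^ 2 / 4) := by push_cast; ring
          rw [e]; linarith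
        have : 2 * (1 - B ^ 2) / r ≤ r / 2 := by
          rw [div_le_iff₀ hr]; nlinarith
        linarith

lemma measureReal_shift_sub_le (u : E) {j : Set E} (hj : MeasurableSet j) :
    (((stdGaussian E).map (fun x => x + u)).real j - (stdGaussian E).real j)
      + ((stdGaussian E).real jᶜ - ((stdGaussian E).map (fun x => x + u)).real jᶜ) ≤ ‖u‖ := by
  set L : E → ℝ := fun x => Real.exp (inner ℝ u x - ‖u‖ ^ 2 / 2) with hL
  have hLint : Integrable L (stdGaussian E) := by
    simp_rw [hL, Real.exp_sub]
    exact (integrable_exp_inner_stdGaussian u).div_const _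
  have hset : ∀ s : Set E, MeasurableSet s →
      ((stdGaussian E).map (fun x => x + u)).real s - (stdGaussian E).real s
        = ∫ x in s, (L x - 1) ∂(stdGaussian E) := by
    intro s hs
    rw [integral_sub hLint.integrableOn (integrable_const _).integrableOn,
      map_add_right_stdGaussian, measureReal_def, withDensity_apply _ hs,
      ← ofReal_integral_eq_lintegral_ofReal hLint.integrableOn
        (ae_of_all _ fun x => (Real.exp_pos _).le),
      ENNReal.toReal_ofReal (integral_nonneg fun x => (Real.exp_pos _).le)]
    simp [hL]
  have h1 := hset j hj
  have h2 := hset jᶜ hj.compl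
  have hI : Integrable (fun x => L x - 1) (stdGaussian E) := hLint.sub (integrable_const _)
  have h3 : ∫ x in j, (L x - 1) ∂(stdGaussian E) ≤ ∫ x in j, |L x - 1| ∂(stdGaussian E) :=
    integral_mono hI.integrableOn hI.abs.integrableOn fun x => le_abs_self _
  have h4 : - ∫ x in jᶜ, (L x - 1) ∂(stdGaussian E) ≤ ∫ x in jᶜ, |L x - 1| ∂(stdGaussian E) := by
    rw [← integral_neg]
    exact integral_mono hI.integrableOn.neg hI.abs.integrableOn fun x => neg_le_abs _
  have h5 := integral_add_compl hj hI.abs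
  have h6 := integral_abs_exp_sub_one_le u
  linarith

end Gaussian

section TotalVariation

variable {S : Type*} [MeasurableSpace S] (P Q : Measure S) [IsFiniteMeasure P] [IsFiniteMeasure Q]

lemma l1Dist_le_of_forall_measurableSet {B : ℝ}
    (h : ∀ j, MeasurableSet j → (P.real j - Q.real j) + (Q.real jᶜ - P.real jᶜ) ≤ B) :
    l1Dist P Q ≤ B := by
  set s := P.toSignedMeasure - Q.toSignedMeasure with hs
  obtain ⟨j, hj, hpos, hneg, hP, hN⟩ := s.toJordanDecomposition_spec
  have hsv : ∀ i, MeasurableSet i → s i = P.real i - Q.real i := by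
    intro i hi
    simp [hs, hi, Measure.toSignedMeasure_apply]
  refine le_trans (le_of_eq ?_) (h j hj)
  rw [l1Dist, ← hs, SignedMeasure.totalVariation, measureReal_add_apply, ← hsv j hj,
    show Q.real jᶜ - P.real jᶜ = -(s jᶜ) by rw [hsv _ hj.compl]; ring]
  congr 1
  · rw [hP, measureReal_def, SignedMeasure.toMeasureOfZeroLE_apply s hpos hj .univ]
    simp
  · rw [hN, measureReal_def, SignedMeasure.toMeasureOfLEZero_apply s hneg hj.compl .univ]
    simp

lemma l1Dist_le_two [IsProbabilityMeasure P] [IsProbabilityMeasure Q] : l1Dist P Q ≤ 2 := by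
  refine l1Dist_le_of_forall_measurableSet P Q fun j _ => ?_
  linarith [measureReal_le_one (μ := P) (s := j), measureReal_nonneg (μ := Q) (s := j),
    measureReal_le_one (μ := Q) (s := jᶜ), measureReal_nonneg (μ := P) (s := jᶜ)]

lemma abs_integral_sub_integral_le_l1Dist {f : S → ℝ} (hf : Measurable f) {K : ℝ}
    (hK : ∀ x, |f x| ≤ K) : |∫ x, f x ∂P - ∫ x, f x ∂Q| ≤ K * l1Dist P Q := by
  set s := P.toSignedMeasure - Q.toSignedMeasure with hs
  set J := s.toJordanDecomposition with hJ
  have hint : ∀ (ν : Measure S) [IsFiniteMeasure ν], Integrable f ν := fun ν _ =>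
    Integrable.of_bound hf.aestronglyMeasurable K (ae_of_all _ hK)
  have hPQ : P + J.negPart = Q + J.posPart := by
    ext i hi
    have h1 : s i = J.posPart.real i - J.negPart.real i :=
      s.apply_eq_posPart_real_sub_negPart_real hi
    have h2 : s i = P.real i - Q.real i := by simp [hs, hi, Measure.toSignedMeasure_apply]
    rw [← measure_ne_top (P + J.negPart) i |> ENNReal.ofReal_toReal,
      ← measure_ne_top (Q + J.posPart) i |> ENNReal.ofReal_toReal]
    congr 1
    change (P + J.negPart).real i = (Q + J.posPart).real i
    rw [measureReal_add_apply, measureReal_add_apply]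
    linarith
  have h3 : ∫ x, f x ∂P - ∫ x, f x ∂Q = ∫ x, f x ∂J.posPart - ∫ x, f x ∂J.negPart := by
    have := congrArg (fun ν : Measure S => ∫ x, f x ∂ν) hPQ
    rw [integral_add_measure (hint _) (hint _), integral_add_measure (hint _) (hint _)] at this
    linarith
  have hb : ∀ (ν : Measure S) [IsFiniteMeasure ν], |∫ x, f x ∂ν| ≤ K * ν.real Set.univ :=
    fun ν _ => (norm_integral_le_of_norm_le_const (f := f) (μ := ν) (C := K) (ae_of_all _ hK) :)
  have h4 : l1Dist P Q = J.posPart.real Set.univ + J.negPart.real Set.univ := by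
    rw [l1Dist, ← hs, SignedMeasure.totalVariation, measureReal_add_apply]
  rw [h3, h4, mul_add]
  exact (abs_sub _ _).trans (add_le_add (hb _) (hb _))

end TotalVariation

open scoped MatrixOrder in
lemma multivariateGaussian_smul_one {n : ℕ} (m : EuclideanSpace ℝ (Fin n)) {σ : ℝ} (hσ : 0 < σ) :
    multivariateGaussian m (σ ^ 2 • (1 : Matrix (Fin n) (Fin n) ℝ))
      = (stdGaussian (EuclideanSpace ℝ (Fin n))).map (fun x => m + σ • x) := by
  have hs : CFC.sqrt (σ ^ 2 • (1 : Matrix (Fin n) (Fin n) ℝ)) = σ • 1 := by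
    refine CFC.sqrt_unique ?_ ?_
    · simp [sq, smul_smul]
    · exact smul_nonneg hσ.le zero_le_one
  rw [multivariateGaussian, hs]
  simp

lemma l1Dist_multivariateGaussian_le {n : ℕ} (m₁ m₂ : EuclideanSpace ℝ (Fin n)) {σ : ℝ}
    (hσ : 0 < σ) :
    l1Dist (multivariateGaussian m₁ (σ ^ 2 • 1)) (multivariateGaussian m₂ (σ ^ 2 • 1))
      ≤ ‖m₁ - m₂‖ / σ := by
  have h1 : multivariateGaussian m₁ (σ ^ 2 • (1 : Matrix (Fin n) (Fin n) ℝ))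
      = ((stdGaussian (EuclideanSpace ℝ (Fin n))).map (fun x => x + σ⁻¹ • (m₁ - m₂))).map
        (fun x => m₂ + σ • x) := by
    rw [multivariateGaussian_smul_one _ hσ, Measure.map_map (by fun_prop) (by fun_prop)]
    congr 1
    ext1 x
    simp only [Function.comp]
    rw [smul_add, smul_inv_smul₀ hσ.ne']
    abel
  refine l1Dist_le_of_forall_measurableSet _ _ fun j hj => ?_
  have hm : Measurable (fun x : EuclideanSpace ℝ (Fin n) => m₂ + σ • x) := by fun_prop
  rw [h1, multivariateGaussian_smul_one m₂ hσ, map_measureReal_apply hm hj,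
    map_measureReal_apply hm hj, map_measureReal_apply hm hj.compl,
    map_measureReal_apply hm hj.compl, Set.preimage_compl]
  refine (measureReal_shift_sub_le _ (hm hj)).trans (le_of_eq ?_)
  rw [norm_smul, norm_inv, Real.norm_of_nonneg hσ.le]
  field_simp

end ImitationKNR

namespace ImitationKNR

/-! ### Rank-one updates of positive definite matrices -/

section RankOne

open Matrix

variable {n : ℕ}

/-- The quadratic form `x ↦ xᵀ A⁻¹ x`. -/
noncomputable def invQuad (A : Matrix (Fin n) (Fin n) ℝ) (x : Fin n → ℝ) : ℝ := x ⬝ᵥ A⁻¹ *ᵥ x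

lemma posSemidef_vecMulVec (x : Fin n → ℝ) : (vecMulVec x x).PosSemidef := by
  simpa using posSemidef_vecMulVec_self_star x

lemma invQuad_nonneg {A : Matrix (Fin n) (Fin n) ℝ} (hA : A.PosDef) (x : Fin n → ℝ) :
    0 ≤ invQuad A x := by
  simpa [invQuad] using hA.inv.posSemidef.dotProduct_mulVec_nonneg x

lemma dotProduct_inv_mulVec_comm {A : Matrix (Fin n) (Fin n) ℝ} (hA : A.PosDef)
    (x y : Fin n → ℝ) : x ⬝ᵥ A⁻¹ *ᵥ y = y ⬝ᵥ A⁻¹ *ᵥ x := by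
  have h : (A⁻¹)ᵀ = A⁻¹ := by simpa using hA.inv.isHermitian.eq
  conv_lhs => rw [← h]
  rw [mulVec_transpose, dotProduct_comm, ← dotProduct_mulVec]

lemma posDef_add_vecMulVec {A : Matrix (Fin n) (Fin n) ℝ} (hA : A.PosDef) (x : Fin n → ℝ) :
    (A + vecMulVec x x).PosDef :=
  hA.add_posSemidef (posSemidef_vecMulVec x)

lemma isUnit_det_of_posDef {A : Matrix (Fin n) (Fin n) ℝ} (hA : A.PosDef) : IsUnit A.det :=
  hA.det_pos.ne'.isUnit

/-- The matrix determinant lemma. -/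
lemma det_add_vecMulVec {A : Matrix (Fin n) (Fin n) ℝ} (hA : A.PosDef) (x : Fin n → ℝ) :
    (A + vecMulVec x x).det = A.det * (1 + invQuad A x) := by
  rw [vecMulVec_eq Unit, det_add_replicateCol_mul_replicateRow (isUnit_det_of_posDef hA)]
  congr 1
  rw [det_unique]
  rw [Matrix.add_apply, one_apply_eq, invQuad, dotProduct_mulVec]
  congr 1

lemma det_le_det_add_vecMulVec {A : Matrix (Fin n) (Fin n) ℝ} (hA : A.PosDef) (x : Fin n → ℝ) :
    A.det ≤ (A + vecMulVec x x).det := by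
  rw [det_add_vecMulVec hA]
  nlinarith [hA.det_pos, invQuad_nonneg hA x]

/-- The Sherman-Morrison formula, applied to a vector. -/
lemma inv_add_vecMulVec_mulVec {A : Matrix (Fin n) (Fin n) ℝ} (hA : A.PosDef)
    (x y : Fin n → ℝ) : (A + vecMulVec x x)⁻¹ *ᵥ y
      = A⁻¹ *ᵥ y - ((x ⬝ᵥ A⁻¹ *ᵥ y) / (1 + invQuad A x)) • A⁻¹ *ᵥ x := by
  have hu := isUnit_det_of_posDef (posDef_add_vecMulVec hA x)
  have hq : 1 + invQuad A x ≠ 0 := by linarith [invQuad_nonneg hA x]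
  have h : (A + vecMulVec x x) *ᵥ
      (A⁻¹ *ᵥ y - ((x ⬝ᵥ A⁻¹ *ᵥ y) / (1 + invQuad A x)) • A⁻¹ *ᵥ x) = y := by
    have hA1 : ∀ z, A *ᵥ A⁻¹ *ᵥ z = z := fun z => by
      rw [mulVec_mulVec, mul_nonsing_inv _ (isUnit_det_of_posDef hA), one_mulVec]
    rw [add_mulVec, mulVec_sub, mulVec_smul, hA1, hA1, vecMulVec_mulVec, dotProduct_sub,
      dotProduct_smul, show x ⬝ᵥ A⁻¹ *ᵥ x = invQuad A x from rfl]
    ext i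
    simp only [Pi.add_apply, Pi.sub_apply, Pi.smul_apply, smul_eq_mul, MulOpposite.smul_eq_mul_unop,
      MulOpposite.unop_op]
    field_simp
    ring
  conv_lhs => rw [← h]
  rw [mulVec_mulVec, nonsing_inv_mul _ hu, one_mulVec]

lemma invQuad_rankOne {A : Matrix (Fin n) (Fin n) ℝ} (hA : A.PosDef) (x y : Fin n → ℝ) (r : ℝ) :
    invQuad (A + vecMulVec x x) (y + r • x) = invQuad A y
      + (2 * r * (x ⬝ᵥ A⁻¹ *ᵥ y) + r ^ 2 * invQuad A x - (x ⬝ᵥ A⁻¹ *ᵥ y) ^ 2)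
        / (1 + invQuad A x) := by
  have hq : 1 + invQuad A x ≠ 0 := by linarith [invQuad_nonneg hA x]
  rw [invQuad, inv_add_vecMulVec_mulVec hA]
  simp only [mulVec_add, mulVec_smul, dotProduct_add, dotProduct_smul, add_dotProduct,
    smul_dotProduct, dotProduct_sub, smul_eq_mul]
  rw [dotProduct_inv_mulVec_comm hA y x, show x ⬝ᵥ A⁻¹ *ᵥ x = invQuad A x from rfl,
    show y ⬝ᵥ A⁻¹ *ᵥ y = invQuad A y from rfl]
  field_simp
  ring

/-- The Cauchy-Schwarz inequality for a positive definite matrix and its inverse. -/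
lemma sq_dotProduct_inv_mulVec_le {A : Matrix (Fin n) (Fin n) ℝ} (hA : A.PosDef)
    (x y : Fin n → ℝ) : (x ⬝ᵥ A⁻¹ *ᵥ y) ^ 2 ≤ invQuad A x * invQuad A y := by
  have h : ∀ t : ℝ, 0 ≤ invQuad A y * (t * t) + 2 * (x ⬝ᵥ A⁻¹ *ᵥ y) * t + invQuad A x := by
    intro t
    have := invQuad_nonneg hA (x + t • y)
    rw [invQuad] at this
    simp only [mulVec_add, mulVec_smul, dotProduct_add, dotProduct_smul, add_dotProduct,
      smul_dotProduct, smul_eq_mul] at this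
    rw [dotProduct_inv_mulVec_comm hA y x, show x ⬝ᵥ A⁻¹ *ᵥ x = invQuad A x from rfl,
      show y ⬝ᵥ A⁻¹ *ᵥ y = invQuad A y from rfl] at this
    nlinarith
  have := discrim_le_zero h
  rw [discrim] at this
  nlinarith

/-- A matrix above `lam • 1` satisfies `lam ‖A⁻¹ x‖² ≤ xᵀ A⁻¹ x`. -/
lemma mul_dotProduct_inv_mulVec_le {A : Matrix (Fin n) (Fin n) ℝ} (hA : A.PosDef) {lam : ℝ}
    (hle : ∀ z : Fin n → ℝ, lam * (z ⬝ᵥ z) ≤ z ⬝ᵥ A *ᵥ z) (x : Fin n → ℝ) :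
    lam * ((A⁻¹ *ᵥ x) ⬝ᵥ (A⁻¹ *ᵥ x)) ≤ invQuad A x := by
  refine (hle _).trans (le_of_eq ?_)
  rw [mulVec_mulVec, mul_nonsing_inv _ (isUnit_det_of_posDef hA), one_mulVec, dotProduct_comm]
  rfl

lemma posDef_add_sum_vecMulVec {ι : Type*} (s : Finset ι) (f : ι → Fin n → ℝ)
    {A : Matrix (Fin n) (Fin n) ℝ} (hA : A.PosDef) :
    (A + ∑ i ∈ s, vecMulVec (f i) (f i)).PosDef :=
  hA.add_posSemidef (posSemidef_sum s fun i _ => posSemidef_vecMulVec (f i))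

lemma det_le_det_add_sum_vecMulVec {ι : Type*} (s : Finset ι) (f : ι → Fin n → ℝ)
    {A : Matrix (Fin n) (Fin n) ℝ} (hA : A.PosDef) :
    A.det ≤ (A + ∑ i ∈ s, vecMulVec (f i) (f i)).det := by
  classical
  induction s using Finset.induction_on with
  | empty => simp
  | insert i s hi ih =>
    rw [Finset.sum_insert hi, add_comm (vecMulVec _ _), ← add_assoc]
    exact ih.trans (det_le_det_add_vecMulVec (posDef_add_sum_vecMulVec s f hA) _)

/-- Adding several rank-one terms increases the determinant at least as much as adding one. -/
lemma det_mul_one_add_invQuad_le {ι : Type*} [Fintype ι] (f : ι → Fin n → ℝ)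
    {A : Matrix (Fin n) (Fin n) ℝ} (hA : A.PosDef) (i : ι) :
    A.det * (1 + invQuad A (f i)) ≤ (A + ∑ i, vecMulVec (f i) (f i)).det := by
  classical
  rw [← Finset.add_sum_erase _ _ (Finset.mem_univ i), ← add_assoc, ← det_add_vecMulVec hA]
  exact det_le_det_add_sum_vecMulVec _ f (posDef_add_vecMulVec hA _)

lemma det_le_pow_of_forall_quadForm_le {A : Matrix (Fin n) (Fin n) ℝ} (hA : A.PosDef) {B : ℝ}
    (h : ∀ z : Fin n → ℝ, z ⬝ᵥ A *ᵥ z ≤ B * (z ⬝ᵥ z)) : A.det ≤ B ^ n := by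
  have hH := hA.isHermitian
  rw [hH.det_eq_prod_eigenvalues]
  have hle : ∀ i, hH.eigenvalues i ≤ B := by
    intro i
    set v := hH.eigenvectorBasis i
    have h1 := h v.ofLp
    have h2 : v.ofLp ⬝ᵥ v.ofLp = 1 := by
      have := hH.eigenvectorBasis.orthonormal.1 i
      have h3 : ‖v‖ ^ 2 = 1 := by rw [this]; norm_num
      rw [EuclideanSpace.real_norm_sq_eq] at h3
      rw [← h3, dotProduct]
      exact Finset.sum_congr rfl fun j _ => (sq _).symm
    rw [hH.mulVec_eigenvectorBasis, dotProduct_smul, h2] at h1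
    simpa using h1
  calc ∏ i, (hH.eigenvalues i : ℝ) ≤ ∏ _i : Fin n, B :=
        Finset.prod_le_prod (fun i _ => (hA.eigenvalues_pos i).le) fun i _ => hle i
    _ = B ^ n := by simp

end RankOne

/-! ### Measurability of matrix-valued functions -/

section Measurability

variable {α : Type*} [MeasurableSpace α] {n : ℕ} {A : α → Matrix (Fin n) (Fin n) ℝ}

lemma measurable_matrix_det (hA : ∀ i j, Measurable fun x => A x i j) :
    Measurable fun x => (A x).det := by
  simp_rw [Matrix.det_apply]
  fun_prop

lemma measurable_matrix_inv_apply (hA : ∀ i j, Measurable fun x => A x i j) (i j : Fin n) :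
    Measurable fun x => (A x)⁻¹ i j := by
  simp_rw [Matrix.inv_def, Matrix.smul_apply, Matrix.adjugate_apply, Ring.inverse_eq_inv',
    smul_eq_mul]
  refine (measurable_matrix_det hA).inv.mul (measurable_matrix_det fun k l => ?_)
  simp only [Matrix.updateRow_apply]
  split_ifs
  · exact measurable_const
  · exact hA k l

lemma measurable_invQuad (hA : ∀ i j, Measurable fun x => A x i j) {v : α → Fin n → ℝ}
    (hv : Measurable v) : Measurable fun x => invQuad (A x) (v x) := by
  simp only [invQuad, dotProduct, Matrix.mulVec]
  refine Finset.measurable_sum _ fun i _ => (measurable_pi_iff.1 hv i).mul ?_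
  exact Finset.measurable_sum _ fun j _ =>
    (measurable_matrix_inv_apply hA i j).mul (measurable_pi_iff.1 hv j)

end Measurability

end ImitationKNR

namespace ImitationKNR

/-! ### Integration against rollouts and interactions -/

section Rollouts

variable {E S A : Type*} [MeasurableSpace E] [MeasurableSpace S] [MeasurableSpace A]

lemma integrable_of_forall_abs_le {α : Type*} [MeasurableSpace α] {μ : Measure α}
    [IsFiniteMeasure μ] {f : α → ℝ} (hf : Measurable f) {K : ℝ} (hK : ∀ x, |f x| ≤ K) :
    Integrable f μ :=
  Integrable.of_bound hf.aestronglyMeasurable K (ae_of_all _ hK)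

lemma abs_integral_le_of_forall_abs_le {α : Type*} [MeasurableSpace α] {μ : Measure α}
    [IsProbabilityMeasure μ] {f : α → ℝ} {K : ℝ} (hK : ∀ x, |f x| ≤ K) : |∫ x, f x ∂μ| ≤ K := by
  have h := norm_integral_le_of_norm_le_const (f := f) (μ := μ) (C := K) (ae_of_all _ hK)
  simpa using h

section StepKernel

variable (κ : Kernel (E × S) A) (P : Kernel (S × A) S) [IsMarkovKernel κ] [IsMarkovKernel P]

lemma lintegral_stepKernel (p : E × S) {g : Transition S A → ℝ≥0∞} (hg : Measurable g) :
    ∫⁻ x, g x ∂(stepKernel κ P p) = ∫⁻ a, ∫⁻ s', g ((p.2, a), s') ∂P (p.2, a) ∂κ p := by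
  rw [stepKernel, Kernel.lintegral_compProd _ _ _ hg,
    Kernel.lintegral_deterministic_prod measurable_snd]
  · rfl
  · exact hg.lintegral_kernel_prod_right'

lemma integral_stepKernel (p : E × S) {g : Transition S A → ℝ} (hg : Measurable g) {K : ℝ}
    (hK : ∀ x, |g x| ≤ K) :
    ∫ x, g x ∂(stepKernel κ P p) = ∫ a, ∫ s', g ((p.2, a), s') ∂P (p.2, a) ∂κ p := by
  rw [stepKernel, integral_compProd (integrable_of_forall_abs_le hg hK), Kernel.prod_apply,
    Kernel.deterministic_apply, Measure.dirac_prod,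
    integral_map (by fun_prop)]
  · rfl
  · have h := hg.stronglyMeasurable.integral_kernel_prod_right' (κ := P)
    exact h.aestronglyMeasurable

variable (s₀ : S)

lemma lintegral_rolloutKernel_succ (h : ℕ) (e : E) {g : Episode S A (h + 1) → ℝ≥0∞}
    (hg : Measurable g) :
    ∫⁻ x, g x ∂(rolloutKernel κ P s₀ (h + 1) e)
      = ∫⁻ x, ∫⁻ p, g (Fin.snoc x p) ∂(stepKernel κ P (e, currentState s₀ x))
          ∂(rolloutKernel κ P s₀ h e) := by
  rw [rolloutKernel, Kernel.lintegral_map _ (measurable_snoc h) _ hg]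
  exact Kernel.lintegral_compProd _ _ _ (hg.comp (measurable_snoc h))

lemma integral_rolloutKernel_succ (h : ℕ) (e : E) {g : Episode S A (h + 1) → ℝ}
    (hg : Measurable g) {K : ℝ} (hK : ∀ x, |g x| ≤ K) :
    ∫ x, g x ∂(rolloutKernel κ P s₀ (h + 1) e)
      = ∫ x, ∫ p, g (Fin.snoc x p) ∂(stepKernel κ P (e, currentState s₀ x))
          ∂(rolloutKernel κ P s₀ h e) := by
  rw [rolloutKernel, Kernel.map_apply _ (measurable_snoc h),
    integral_map (measurable_snoc h).aemeasurable hg.aestronglyMeasurable]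
  exact integral_compProd
    (integrable_of_forall_abs_le (hg.comp (measurable_snoc h)) fun x => hK _)

/-- Fixing the parameter turns a parametrized rollout into the rollout of one policy. -/
lemma rolloutKernel_eq_rollout (h : ℕ) (e : E) :
    rolloutKernel κ P s₀ h e = rollout (Kernel.sectR κ e) P s₀ h := by
  induction h with
  | zero => rfl
  | succ h ih =>
    refine Measure.ext_of_lintegral _ fun g hg => ?_
    rw [rollout, lintegral_rolloutKernel_succ _ _ _ _ _ hg,
      lintegral_rolloutKernel_succ _ _ _ _ _ hg, ih]
    refine lintegral_congr fun x => ?_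
    have hgx : Measurable fun p => g (Fin.snoc x p) :=
      hg.comp ((measurable_snoc h).comp (measurable_const.prodMk measurable_id))
    rw [lintegral_stepKernel _ _ _ hgx, lintegral_stepKernel _ _ _ hgx]
    simp [Kernel.prodMkLeft_apply, Kernel.sectR_apply]

end StepKernel

instance (π : Kernel S A) (P : Kernel (S × A) S) (s₀ : S) (h : ℕ) [IsMarkovKernel π]
    [IsMarkovKernel P] : IsProbabilityMeasure (rollout π P s₀ h) := by
  unfold rollout; infer_instance

lemma integral_rollout_succ (π : Kernel S A) (P : Kernel (S × A) S) (s₀ : S) [IsMarkovKernel π]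
    [IsMarkovKernel P] (h : ℕ) {g : Episode S A (h + 1) → ℝ} (hg : Measurable g) {K : ℝ}
    (hK : ∀ x, |g x| ≤ K) :
    ∫ x, g x ∂(rollout π P s₀ (h + 1))
      = ∫ x, ∫ a, ∫ s', g (Fin.snoc x ((currentState s₀ x, a), s')) ∂P (currentState s₀ x, a)
          ∂π (currentState s₀ x) ∂(rollout π P s₀ h) := by
  rw [rollout, integral_rolloutKernel_succ _ _ _ _ _ hg hK]
  refine integral_congr_ae (ae_of_all _ fun x => ?_)
  exact integral_stepKernel _ _ _
    (hg.comp ((measurable_snoc h).comp (measurable_const.prodMk measurable_id))) fun x => hK _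

section Interaction

variable {H : ℕ} (ν : Measure E) [IsProbabilityMeasure ν] (alg : Algorithm E S A H)
  [∀ t, IsMarkovKernel (alg t)] (P : Kernel (S × A) S) [IsMarkovKernel P] (s₀ : S)

instance (T : ℕ) : IsProbabilityMeasure (interactionLaw ν alg P s₀ T) :=
  isProbabilityMeasure_interactionLaw ν alg P s₀ T

lemma measurable_appendEpisode (T : ℕ) :
    Measurable (fun p : (E × History S A H T) × Episode S A H =>
      ((p.1.1, Fin.snoc p.1.2 p.2) : E × History S A H (T + 1))) :=
  measurable_fst.fst.prodMk ((measurable_snoc T).comp (measurable_fst.snd.prodMk measurable_snd))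

lemma lintegral_interactionLaw_succ (T : ℕ) {g : E × History S A H (T + 1) → ℝ≥0∞}
    (hg : Measurable g) :
    ∫⁻ x, g x ∂(interactionLaw ν alg P s₀ (T + 1))
      = ∫⁻ x, ∫⁻ τ, g (x.1, Fin.snoc x.2 τ) ∂(rolloutKernel (alg T) P s₀ H x)
          ∂(interactionLaw ν alg P s₀ T) := by
  rw [interactionLaw, lintegral_map hg (measurable_appendEpisode T)]
  exact Measure.lintegral_compProd (hg.comp (measurable_appendEpisode T))

lemma integral_interactionLaw_succ (T : ℕ) {g : E × History S A H (T + 1) → ℝ}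
    (hg : Measurable g) {K : ℝ} (hK : ∀ x, |g x| ≤ K) :
    ∫ x, g x ∂(interactionLaw ν alg P s₀ (T + 1))
      = ∫ x, ∫ τ, g (x.1, Fin.snoc x.2 τ) ∂(rolloutKernel (alg T) P s₀ H x)
          ∂(interactionLaw ν alg P s₀ T) := by
  rw [interactionLaw, integral_map (measurable_appendEpisode T).aemeasurable
    hg.aestronglyMeasurable]
  exact Measure.integral_compProd
    (integrable_of_forall_abs_le (hg.comp (measurable_appendEpisode T)) fun x => hK _)

/-- The side information together with the first `t` of `T` episodes. -/
def pastOf {t T : ℕ} (h : t ≤ T) (x : E × History S A H T) : E × History S A H t :=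
  (x.1, fun k => x.2 (Fin.castLE h k))

lemma measurable_pastOf {t T : ℕ} (h : t ≤ T) :
    Measurable (pastOf h : E × History S A H T → E × History S A H t) :=
  measurable_fst.prodMk (measurable_pi_lambda _ fun _ =>
    (measurable_pi_apply _).comp measurable_snd)

/-- The law of the past does not depend on the length of the interaction. -/
lemma map_pastOf_interactionLaw {t T : ℕ} (h : t ≤ T) :
    (interactionLaw ν alg P s₀ T).map (pastOf h) = interactionLaw ν alg P s₀ t := by
  induction T, h using Nat.le_induction with
  | base =>
    rw [show (pastOf le_rfl : E × History S A H t → _) = id from rfl, Measure.map_id]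
  | succ T h ih =>
    refine Measure.ext_of_lintegral _ fun g hg => ?_
    rw [lintegral_map hg (measurable_pastOf _), ← ih, lintegral_map hg (measurable_pastOf _)]
    refine (lintegral_interactionLaw_succ _ _ _ _ _ (hg.comp (measurable_pastOf _))).trans ?_
    refine lintegral_congr fun x => ?_
    have : ∀ τ : Episode S A H, pastOf (h.trans (Nat.le_succ T))
        ((x.1, Fin.snoc x.2 τ) : E × History S A H (T + 1)) = pastOf h x := by
      intro τ
      refine Prod.ext rfl (funext fun k => ?_)
      exact Fin.snoc_castSucc (α := fun _ => Episode S A H) τ x.2 (Fin.castLE h k)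
    simp only [Function.comp_apply, this]
    simp

lemma map_fst_interactionLaw (T : ℕ) :
    (interactionLaw ν alg P s₀ T).map Prod.fst = ν := by
  have h := map_pastOf_interactionLaw ν alg P s₀ (Nat.zero_le T)
  have h2 : (Prod.fst : E × History S A H T → E) = Prod.fst ∘ pastOf (Nat.zero_le T) := rfl
  rw [h2, ← Measure.map_map measurable_fst (measurable_pastOf _), h, interactionLaw]
  refine (Measure.map_map measurable_fst (measurable_id.prodMk measurable_const)).trans ?_
  exact Measure.map_id

end Interaction

end Rollouts

/-! ### The simulation inequality -/

section Simulation

variable {S A : Type*} [MeasurableSpace S] [MeasurableSpace A]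

/-- The expected cost of the policy `π` over the next `n` steps, as a function of the state. -/
noncomputable def costToGo (π : Kernel S A) (P : Kernel (S × A) S) (g : S × A → ℝ) :
    ℕ → S → ℝ
  | 0, _ => 0
  | n + 1, s => ∫ a, (g (s, a) + ∫ s', costToGo π P g n s' ∂P (s, a)) ∂π s

variable (π : Kernel S A) (P : Kernel (S × A) S) [IsMarkovKernel π] [IsMarkovKernel P]

omit [IsMarkovKernel P] in
lemma measurable_costToGo {g : S × A → ℝ} (hg : Measurable g) (n : ℕ) :
    Measurable (costToGo π P g n) := by
  induction n with
  | zero => exact measurable_const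
  | succ n ih =>
    have h : Measurable fun z : S × A => g z + ∫ s', costToGo π P g n s' ∂P z :=
      hg.add (ih.stronglyMeasurable.integral_kernel (κ := P)).measurable
    exact h.stronglyMeasurable.integral_kernel_prod_right'.measurable

lemma abs_costToGo_le {g : S × A → ℝ} {K : ℝ} (hK : ∀ z, |g z| ≤ K) (n : ℕ) (s : S) :
    |costToGo π P g n s| ≤ n * K := by
  induction n generalizing s with
  | zero => simp [costToGo]
  | succ n ih =>
    refine abs_integral_le_of_forall_abs_le fun a => (abs_add_le _ _).trans ?_
    have := abs_integral_le_of_forall_abs_le (μ := P (s, a)) ih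
    push_cast
    linarith [hK (s, a)]

variable (s₀ : S)

lemma measurable_sum_cost_add {g : S × A → ℝ} (hg : Measurable g) {u : S → ℝ} (hu : Measurable u)
    (h : ℕ) : Measurable fun x : Episode S A h => ∑ i, g (x i).1 + u (currentState s₀ x) :=
  (Finset.measurable_sum _ fun i _ => hg.comp (measurable_pi_apply i).fst).add
    (hu.comp (measurable_currentState s₀ h))

omit [MeasurableSpace S] [MeasurableSpace A] in
lemma abs_sum_cost_le {g : S × A → ℝ} {K : ℝ} (hK : ∀ z, |g z| ≤ K) {h : ℕ}
    (x : Episode S A h) : |∑ i, g (x i).1| ≤ h * K := by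
  refine (Finset.abs_sum_le_sum_abs _ _).trans ?_
  refine (Finset.sum_le_sum fun i _ => hK _).trans ?_
  simp

/-- If `u` decreases along the rollout after the cost `g` is paid, then the expected total cost is
at most the initial value of `u`. -/
lemma integral_sum_cost_add_le {g : S × A → ℝ} (hg : Measurable g) {K : ℝ} (hK : ∀ z, |g z| ≤ K)
    {u : ℕ → S → ℝ} (hu : ∀ i, Measurable (u i)) {K' : ℝ} (hK' : ∀ i s, |u i s| ≤ K') {H : ℕ}
    (hle : ∀ i < H, ∀ s, ∫ a, (g (s, a) + ∫ s', u (i + 1) s' ∂P (s, a)) ∂π s ≤ u i s)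
    {h : ℕ} (hh : h ≤ H) :
    ∫ x, (∑ i, g (x i).1 + u h (currentState s₀ x)) ∂(rollout π P s₀ h) ≤ u 0 s₀ := by
  have hb : ∀ (h i : ℕ) (x : Episode S A h),
      |∑ i, g (x i).1 + u i (currentState s₀ x)| ≤ h * K + K' := fun h i x =>
    (abs_add_le _ _).trans (add_le_add (abs_sum_cost_le hK x) (hK' _ _))
  induction h with
  | zero => simp [currentState]
  | succ h ih =>
    refine le_trans ?_ (ih (by omega))
    rw [integral_rollout_succ π P s₀ h (measurable_sum_cost_add s₀ hg (hu _) _) (hb _ _)]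
    have hpt : ∀ x : Episode S A h, ∫ a, ∫ s',
        (∑ i, g ((Fin.snoc x ((currentState s₀ x, a), s') : Episode S A (h + 1)) i).1
          + u (h + 1) (currentState s₀ (Fin.snoc x ((currentState s₀ x, a), s') :
            Episode S A (h + 1)))) ∂P (currentState s₀ x, a) ∂π (currentState s₀ x)
        = ∑ i, g (x i).1 + ∫ a, (g (currentState s₀ x, a)
            + ∫ s', u (h + 1) s' ∂P (currentState s₀ x, a)) ∂π (currentState s₀ x) := by
      intro x
      have hm : Measurable fun z : S × A => g z + ∫ s', u (h + 1) s' ∂P z :=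
        hg.add ((hu (h + 1)).stronglyMeasurable.integral_kernel (κ := P)).measurable
      have hb2 : ∀ z : S × A, |g z + ∫ s', u (h + 1) s' ∂P z| ≤ K + K' := fun z =>
        (abs_add_le _ _).trans (add_le_add (hK z) (abs_integral_le_of_forall_abs_le (hK' _)))
      have e1 : ∀ a, ∫ s', (∑ i, g ((Fin.snoc x ((currentState s₀ x, a), s') :
            Episode S A (h + 1)) i).1 + u (h + 1) (currentState s₀
            (Fin.snoc x ((currentState s₀ x, a), s') : Episode S A (h + 1))))
            ∂P (currentState s₀ x, a)
          = ∑ i, g (x i).1 + (g (currentState s₀ x, a)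
            + ∫ s', u (h + 1) s' ∂P (currentState s₀ x, a)) := by
        intro a
        simp only [Fin.sum_univ_castSucc, Fin.snoc_castSucc, Fin.snoc_last, currentState]
        rw [integral_add (integrable_const _) (integrable_of_forall_abs_le (hu _) (hK' _))]
        simp [add_assoc]
      simp_rw [e1]
      have h2 : Integrable (fun a => g (currentState s₀ x, a)
          + ∫ s', u (h + 1) s' ∂P (currentState s₀ x, a)) (π (currentState s₀ x)) :=
        integrable_of_forall_abs_le (hm.comp (measurable_const.prodMk measurable_id))
          fun a => hb2 _
      rw [integral_add (integrable_const _) h2]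
      simp
    simp_rw [hpt]
    have hw : Measurable fun s => ∫ a, (g (s, a) + ∫ s', u (h + 1) s' ∂P (s, a)) ∂π s := by
      have hm : Measurable fun z : S × A => g z + ∫ s', u (h + 1) s' ∂P z :=
        hg.add ((hu (h + 1)).stronglyMeasurable.integral_kernel (κ := P)).measurable
      exact hm.stronglyMeasurable.integral_kernel_prod_right'.measurable
    refine integral_mono (integrable_of_forall_abs_le (measurable_sum_cost_add s₀ hg hw h)
      (K := h * K + (K + K')) fun x => ?_)
      (integrable_of_forall_abs_le (measurable_sum_cost_add s₀ hg (hu h) h) (hb h h))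
      fun x => ?_
    · refine (abs_add_le _ _).trans (add_le_add (abs_sum_cost_le hK x) ?_)
      exact abs_integral_le_of_forall_abs_le fun a => (abs_add_le _ _).trans
        (add_le_add (hK _) (abs_integral_le_of_forall_abs_le (hK' _)))
    · exact add_le_add le_rfl (hle h (by omega) _)

lemma abs_costToGo_sub_le {g : S × A → ℝ} {K : ℝ} (hK : ∀ z, |g z| ≤ K) (H i : ℕ) (s : S) :
    |costToGo π P g (H - i) s| ≤ H * K := by
  refine (abs_costToGo_le π P hK _ s).trans ?_
  have hK0 : 0 ≤ K := by
    by_contra hneg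
    have := abs_costToGo_le π P hK 1 s
    push_cast at this
    linarith [abs_nonneg (costToGo π P g 1 s)]
  have : ((H - i : ℕ) : ℝ) ≤ H := by exact_mod_cast Nat.sub_le H i
  gcongr

omit [IsMarkovKernel π] [IsMarkovKernel P] in
lemma costToGo_sub {g : S × A → ℝ} {H i : ℕ} (hi : i < H) (s : S) :
    costToGo π P g (H - i) s
      = ∫ a, (g (s, a) + ∫ s', costToGo π P g (H - (i + 1)) s' ∂P (s, a)) ∂π s := by
  rw [show H - i = (H - (i + 1)) + 1 by omega, costToGo]

/-- If, measured against the costs-to-go under `P`, one step under `Q` with cost `g'` is never more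
expensive than one step under `P` with cost `g`, then the expected total cost of `g'` under `Q` is
at most that of `g` under `P`. -/
lemma integral_sum_cost_le (Q : Kernel (S × A) S) [IsMarkovKernel Q] {g g' : S × A → ℝ}
    (hg : Measurable g) (hg' : Measurable g') {K K' : ℝ} (hK : ∀ z, |g z| ≤ K)
    (hK' : ∀ z, |g' z| ≤ K') {H : ℕ}
    (hle : ∀ n < H, ∀ z, g' z + ∫ s', costToGo π P g n s' ∂Q z
      ≤ g z + ∫ s', costToGo π P g n s' ∂P z) :
    ∫ x, ∑ i, g' (x i).1 ∂(rollout π Q s₀ H) ≤ ∫ x, ∑ i, g (x i).1 ∂(rollout π P s₀ H) := by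
  have h1 := integral_sum_cost_add_le π Q s₀ hg' hK' (u := fun i => costToGo π P g (H - i))
    (fun i => measurable_costToGo π P hg _) (abs_costToGo_sub_le π P hK H) (H := H) (by
      intro i hi s
      rw [costToGo_sub π P hi]
      have hint : ∀ (f : S × A → ℝ) (R : Kernel (S × A) S) [IsMarkovKernel R] (L : ℝ),
          Measurable f → (∀ z, |f z| ≤ L) → Integrable (fun a => f (s, a)
            + ∫ s', costToGo π P g (H - (i + 1)) s' ∂(R (s, a))) (π s) := by
        intro f R _ L hf hL
        have hm : Measurable fun z : S × A => f z
            + ∫ s', costToGo π P g (H - (i + 1)) s' ∂(R z) :=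
          hf.add ((measurable_costToGo π P hg _).stronglyMeasurable.integral_kernel
            (κ := R)).measurable
        exact integrable_of_forall_abs_le (hm.comp (measurable_const.prodMk measurable_id))
          (K := L + H * K) fun a => (abs_add_le _ _).trans (add_le_add (hL _)
            (abs_integral_le_of_forall_abs_le (abs_costToGo_sub_le π P hK H _)))
      exact integral_mono (hint g' Q K' hg' hK') (hint g P K hg hK)
        fun a => hle _ (by omega) (s, a)) le_rfl
  have h2 := integral_sum_cost_add_le π P s₀ hg.neg (K := K) (by simpa using hK)
    (u := fun i s => -costToGo π P g (H - i) s)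
    (fun i => (measurable_costToGo π P hg _).neg) (K' := H * K)
    (by simpa using abs_costToGo_sub_le π P hK H) (H := H) (by
      intro i hi s
      rw [costToGo_sub π P hi, ← integral_neg]
      refine le_of_eq (integral_congr_ae (ae_of_all _ fun a => ?_))
      simp only [Pi.neg_apply, integral_neg]
      ring) le_rfl
  simp only [Nat.sub_self, costToGo, Nat.sub_zero, add_zero, neg_zero, Pi.neg_apply,
    Finset.sum_neg_distrib, integral_neg] at h1 h2
  linarith

end Simulation

end ImitationKNR

namespace ImitationKNR

/-! ### The self-normalized martingale -/

section Mixture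

open Matrix

variable {n : ℕ}

/-- The Gaussian mixture martingale of self-normalized processes, `det(A)^{-1/2} e^{xᵀ A⁻¹ x / 2}`,
in terms of the regularized covariance `A` and of the noise-weighted sum `x` of the features. -/
noncomputable def mixtureDensity (A : Matrix (Fin n) (Fin n) ℝ) (x : Fin n → ℝ) : ℝ :=
  Real.exp (invQuad A x / 2) / √A.det

lemma mixtureDensity_nonneg (A : Matrix (Fin n) (Fin n) ℝ) (x : Fin n → ℝ) :
    0 ≤ mixtureDensity A x := by
  unfold mixtureDensity; positivity

/-- One step of the martingale: after the rank-one update, the integrand against the standard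
Gaussian density is, up to the current value, the Gaussian density with mean `xᵀ A⁻¹ y` and
variance `1 + xᵀ A⁻¹ x`. -/
lemma lintegral_mixtureDensity_rankOne {A : Matrix (Fin n) (Fin n) ℝ} (hA : A.PosDef)
    (x y : Fin n → ℝ) :
    ∫⁻ r, ENNReal.ofReal (mixtureDensity (A + vecMulVec x x) (y + r • x)) ∂(gaussianReal 0 1)
      = ENNReal.ofReal (mixtureDensity A y) := by
  set a := invQuad A x with ha
  set b := x ⬝ᵥ A⁻¹ *ᵥ y with hb
  have ha0 : 0 ≤ a := invQuad_nonneg hA x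
  set v : NNReal := 1 + a.toNNReal with hv
  have hvr : (v : ℝ) = 1 + a := by simp [hv, ha0]
  have hv0 : v ≠ 0 := by positivity
  have hq : (0 : ℝ) < 1 + a := by linarith
  have hdet := hA.det_pos
  have hpt : ∀ r, gaussianPDF 0 1 r
      * ENNReal.ofReal (mixtureDensity (A + vecMulVec x x) (y + r • x))
      = ENNReal.ofReal (mixtureDensity A y) * gaussianPDF b v r := by
    intro r
    rw [gaussianPDF, gaussianPDF, ← ENNReal.ofReal_mul (gaussianPDFReal_nonneg _ _ _),
      ← ENNReal.ofReal_mul (mixtureDensity_nonneg _ _)]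
    congr 1
    rw [gaussianPDFReal, gaussianPDFReal, mixtureDensity, mixtureDensity,
      invQuad_rankOne hA, det_add_vecMulVec hA, ← ha, ← hb, hvr, Real.sqrt_mul hdet.le,
      Real.sqrt_mul (by positivity)]
    have he : Real.exp (-(r - 0) ^ 2 / (2 * ((1 : NNReal) : ℝ)))
        * Real.exp ((invQuad A y + (2 * r * b + r ^ 2 * a - b ^ 2) / (1 + a)) / 2)
        = Real.exp (invQuad A y / 2) * Real.exp (-(r - b) ^ 2 / (2 * (1 + a))) := by
      rw [← Real.exp_add, ← Real.exp_add]
      congr 1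
      field_simp
      push_cast
      ring
    have h1 : √(1 + a) ≠ 0 := (Real.sqrt_pos.2 hq).ne'
    have h2 : √A.det ≠ 0 := (Real.sqrt_pos.2 hdet).ne'
    calc _ = (√(2 * Real.pi))⁻¹ / (√A.det * √(1 + a))
          * (Real.exp (-(r - 0) ^ 2 / (2 * ((1 : NNReal) : ℝ)))
          * Real.exp ((invQuad A y + (2 * r * b + r ^ 2 * a - b ^ 2) / (1 + a)) / 2)) := by
          simp only [NNReal.coe_one, mul_one]; ring
      _ = _ := by
        rw [he]
        field_simp
        rw [Real.sqrt_mul (by positivity)]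
  have hmeas : Measurable fun r : ℝ =>
      ENNReal.ofReal (mixtureDensity (A + vecMulVec x x) (y + r • x)) := by
    unfold mixtureDensity
    have := measurable_invQuad (α := ℝ) (A := fun _ => A + vecMulVec x x)
      (fun i j => measurable_const) (v := fun r => y + r • x) (by fun_prop)
    fun_prop
  rw [gaussianReal_of_var_ne_zero _ one_ne_zero,
    lintegral_withDensity_eq_lintegral_mul _ (measurable_gaussianPDF _ _) hmeas]
  simp only [Pi.mul_apply, hpt]
  rw [lintegral_const_mul _ (measurable_gaussianPDF _ _), lintegral_gaussianPDF_eq_one _ hv0,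
    mul_one]

end Mixture

namespace KNR

open Matrix

variable {ds d : ℕ} {A : Type*} [MeasurableSpace A] (M : KNR ds d A)

lemma env_apply (z : State ds × A) :
    M.env z = (stdGaussian (State ds)).map (fun x => toEuclideanLin M.W (M.φ z) + M.σ • x) := by
  rw [← multivariateGaussian_smul_one _ M.σ_pos]
  rfl

/-- The normalized noise of a transition in the direction `v`. -/
noncomputable def noise (v : State ds) (p : Transition (State ds) A) : ℝ :=
  inner ℝ v (p.2 - toEuclideanLin M.W (M.φ p.1)) / M.σ

lemma measurable_mean (V : Matrix (Fin ds) (Fin d) ℝ) :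
    Measurable fun z => toEuclideanLin V (M.φ z) :=
  (toEuclideanLin V).continuous_of_finiteDimensional.measurable.comp M.measurable_φ

lemma measurable_noise (v : State ds) : Measurable (M.noise v) := by
  have h : Measurable fun p : Transition (State ds) A => toEuclideanLin M.W (M.φ p.1) :=
    (M.measurable_mean M.W).comp measurable_fst
  exact (measurable_const.inner (measurable_snd.sub h)).div_const _

lemma map_noise_env {v : State ds} (hv : ‖v‖ = 1) (z : State ds × A) :
    (M.env z).map (fun s' => M.noise v (z, s')) = gaussianReal 0 1 := by
  have h := map_inner_stdGaussian v
  have hm : Measurable fun s' => M.noise v (z, s') :=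
    (M.measurable_noise v).comp (measurable_const.prodMk measurable_id)
  rw [env_apply, Measure.map_map hm (by fun_prop)]
  have hv' : ‖v‖₊ ^ 2 = 1 := by ext; simp [hv]
  rw [hv'] at h
  rw [← h]
  congr 1
  ext1 x
  simp only [Function.comp, noise, add_sub_cancel_left, real_inner_smul_right]
  rw [mul_div_cancel_left₀ _ M.σ_pos.ne']

/-- The feature vector of a transition, as a plain vector. -/
def feature (p : Transition (State ds) A) : Fin d → ℝ := (M.φ p.1).ofLp

lemma measurable_feature : Measurable M.feature :=
  (WithLp.measurable_ofLp 2 _).comp (M.measurable_φ.comp measurable_fst)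

lemma dotProduct_feature_le (p : Transition (State ds) A) : M.feature p ⬝ᵥ M.feature p ≤ 1 := by
  have h := M.norm_φ_le p.1
  have h2 : ‖M.φ p.1‖ ^ 2 = M.feature p ⬝ᵥ M.feature p := by
    rw [EuclideanSpace.real_norm_sq_eq, dotProduct]
    exact Finset.sum_congr rfl fun j _ => sq _
  rw [← h2]
  exact pow_le_one₀ (norm_nonneg _) h

/-- The noise-weighted sum of the features of an episode. -/
noncomputable def noiseSum (v : State ds) {h : ℕ} (x : Episode (State ds) A h) : Fin d → ℝ :=
  ∑ i, M.noise v (x i) • M.feature (x i)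

/-- The sum of the rank-one matrices of the features of an episode. -/
def featureSum {h : ℕ} (x : Episode (State ds) A h) : Matrix (Fin d) (Fin d) ℝ :=
  ∑ i, vecMulVec (M.feature (x i)) (M.feature (x i))

lemma measurable_featureSum_apply (h : ℕ) (i j : Fin d) :
    Measurable fun x : Episode (State ds) A h => M.featureSum x i j := by
  simp only [featureSum, Matrix.sum_apply, vecMulVec_apply]
  refine Finset.measurable_sum _ fun k _ => ?_
  have hf : ∀ i, Measurable fun x : Episode (State ds) A h => M.feature (x k) i := fun i =>
    (measurable_pi_iff.1 M.measurable_feature i).comp (measurable_pi_apply k)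
  exact (hf i).mul (hf j)

lemma measurable_noiseSum (v : State ds) (h : ℕ) :
    Measurable fun x : Episode (State ds) A h => M.noiseSum v x := by
  unfold noiseSum
  refine Finset.measurable_sum _ fun k _ => ?_
  exact ((M.measurable_noise v).comp (measurable_pi_apply k)).smul
    (M.measurable_feature.comp (measurable_pi_apply k))

lemma posDef_add_featureSum {B : Matrix (Fin d) (Fin d) ℝ} (hB : B.PosDef) {h : ℕ}
    (x : Episode (State ds) A h) : (B + M.featureSum x).PosDef :=
  posDef_add_sum_vecMulVec _ _ hB

lemma measurable_mixtureDensity {α : Type*} [MeasurableSpace α]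
    {B : α → Matrix (Fin d) (Fin d) ℝ} (hB : ∀ i j, Measurable fun x => B x i j)
    {y : α → Fin d → ℝ} (hy : Measurable y) :
    Measurable fun x => ENNReal.ofReal (mixtureDensity (B x) (y x)) := by
  unfold mixtureDensity
  have h1 := measurable_invQuad hB hy
  have h2 := measurable_matrix_det hB
  fun_prop

section

variable {E : Type*} [MeasurableSpace E]

lemma lintegral_mixtureDensity_rollout (κ : Kernel (E × State ds) A) [IsMarkovKernel κ]
    {v : State ds} (hv : ‖v‖ = 1) {B : Matrix (Fin d) (Fin d) ℝ} (hB : B.PosDef)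
    (y : Fin d → ℝ) (h : ℕ) (e : E) :
    ∫⁻ x, ENNReal.ofReal (mixtureDensity (B + M.featureSum x) (y + M.noiseSum v x))
      ∂(rolloutKernel κ M.env M.s₀ h e) = ENNReal.ofReal (mixtureDensity B y) := by
  induction h with
  | zero => simp [featureSum, noiseSum]
  | succ h ih =>
    have hm : Measurable fun x : Episode (State ds) A (h + 1) =>
        ENNReal.ofReal (mixtureDensity (B + M.featureSum x) (y + M.noiseSum v x)) :=
      measurable_mixtureDensity
        (fun i j => (M.measurable_featureSum_apply _ i j).const_add _)
        ((M.measurable_noiseSum v _).const_add y)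
    rw [lintegral_rolloutKernel_succ _ _ _ _ _ hm, ← ih]
    refine lintegral_congr fun x => ?_
    rw [lintegral_stepKernel]
    swap
    · exact hm.comp ((measurable_snoc h).comp (measurable_const.prodMk measurable_id))
    rw [← mul_one (ENNReal.ofReal _), ← measure_univ (μ := κ (e, currentState M.s₀ x)),
      ← lintegral_const]
    refine lintegral_congr fun a => ?_
    set z : State ds × A := (currentState M.s₀ x, a)
    have hpt : ∀ s', ENNReal.ofReal (mixtureDensity
        (B + M.featureSum (Fin.snoc x (z, s') : Episode (State ds) A (h + 1)))
        (y + M.noiseSum v (Fin.snoc x (z, s') : Episode (State ds) A (h + 1))))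
        = (fun r : ℝ => ENNReal.ofReal (mixtureDensity ((B + M.featureSum x)
            + vecMulVec (M.φ z).ofLp (M.φ z).ofLp) ((y + M.noiseSum v x) + r • (M.φ z).ofLp)))
          (M.noise v (z, s')) := by
      intro s'
      simp only [featureSum, noiseSum, Fin.sum_univ_castSucc, Fin.snoc_castSucc, Fin.snoc_last,
        add_assoc]
      rfl
    have hm1 : Measurable fun s' => M.noise v (z, s') :=
      (M.measurable_noise v).comp (measurable_const.prodMk measurable_id)
    have hm2 : Measurable fun r : ℝ => ENNReal.ofReal (mixtureDensity ((B + M.featureSum x)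
        + vecMulVec (M.φ z).ofLp (M.φ z).ofLp) ((y + M.noiseSum v x) + r • (M.φ z).ofLp)) :=
      measurable_mixtureDensity
        (B := fun _ => (B + M.featureSum x) + vecMulVec (M.φ z).ofLp (M.φ z).ofLp)
        (y := fun r => (y + M.noiseSum v x) + r • (M.φ z).ofLp) (fun i j => measurable_const)
        (measurable_const.add (measurable_id.smul_const _))
    have h1 := lintegral_mixtureDensity_rankOne (M.posDef_add_featureSum hB x) (M.φ z).ofLp
      (y + M.noiseSum v x)
    rw [← M.map_noise_env hv z, lintegral_map hm2 hm1] at h1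
    exact (lintegral_congr hpt).trans h1

variable {H : ℕ}

/-- The noise-weighted sum of all the features seen so far. -/
noncomputable def totalNoise (v : State ds) {t : ℕ} (D : History (State ds) A H t) : Fin d → ℝ :=
  ∑ k, M.noiseSum v (D k)

lemma covariance_eq (lam : ℝ) {t : ℕ} (D : History (State ds) A H t) :
    M.covariance lam D = lam • 1 + ∑ k, M.featureSum (D k) := by
  rw [covariance, add_comm]; rfl

lemma covariance_snoc (lam : ℝ) {t : ℕ} (D : History (State ds) A H t)
    (x : Episode (State ds) A H) :
    M.covariance lam (Fin.snoc D x : History (State ds) A H (t + 1))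
      = M.covariance lam D + M.featureSum x := by
  simp only [covariance_eq, Fin.sum_univ_castSucc, Fin.snoc_castSucc, Fin.snoc_last, add_assoc]

lemma totalNoise_snoc (v : State ds) {t : ℕ} (D : History (State ds) A H t)
    (x : Episode (State ds) A H) :
    M.totalNoise v (Fin.snoc D x : History (State ds) A H (t + 1))
      = M.totalNoise v D + M.noiseSum v x := by
  simp only [totalNoise, Fin.sum_univ_castSucc, Fin.snoc_castSucc, Fin.snoc_last]

lemma posDef_smul_one {lam : ℝ} (hlam : 0 < lam) :
    (lam • (1 : Matrix (Fin d) (Fin d) ℝ)).PosDef :=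
  PosDef.one.smul hlam

lemma posDef_covariance {lam : ℝ} (hlam : 0 < lam) {t : ℕ} (D : History (State ds) A H t) :
    (M.covariance lam D).PosDef := by
  rw [covariance_eq]
  exact (posDef_smul_one hlam).add_posSemidef
    (posSemidef_sum _ fun k _ => posSemidef_sum _ fun i _ => posSemidef_vecMulVec _)

lemma measurable_covariance_apply (lam : ℝ) (t : ℕ) (i j : Fin d) :
    Measurable fun D : History (State ds) A H t => M.covariance lam D i j := by
  simp only [covariance_eq, Matrix.add_apply, Matrix.sum_apply]
  exact (Finset.measurable_sum _ fun k _ =>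
    (M.measurable_featureSum_apply H i j).comp (measurable_pi_apply k)).const_add _

lemma measurable_totalNoise (v : State ds) (t : ℕ) :
    Measurable fun D : History (State ds) A H t => M.totalNoise v D :=
  Finset.measurable_sum _ fun k _ => (M.measurable_noiseSum v H).comp (measurable_pi_apply k)

variable (ν : Measure E) [IsProbabilityMeasure ν] (alg : Algorithm E (State ds) A H)
  [∀ t, IsMarkovKernel (alg t)]

lemma lintegral_mixtureDensity_interactionLaw {v : State ds} (hv : ‖v‖ = 1) {lam : ℝ}
    (hlam : 0 < lam) (t : ℕ) :
    ∫⁻ x, ENNReal.ofReal (mixtureDensity (M.covariance lam x.2) (M.totalNoise v x.2))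
      ∂(interactionLaw ν alg M.env M.s₀ t)
      = ENNReal.ofReal (mixtureDensity (lam • (1 : Matrix (Fin d) (Fin d) ℝ)) 0) := by
  have hm : ∀ t, Measurable fun x : E × History (State ds) A H t => ENNReal.ofReal
      (mixtureDensity (M.covariance lam x.2) (M.totalNoise v x.2)) := fun t =>
    (measurable_mixtureDensity (M.measurable_covariance_apply lam t)
      (M.measurable_totalNoise v t)).comp measurable_snd
  induction t with
  | zero =>
    refine (lintegral_map (hm 0) (measurable_id.prodMk measurable_const)).trans ?_
    simp [covariance_eq, totalNoise]
  | succ t ih =>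
    rw [lintegral_interactionLaw_succ _ _ _ _ _ (hm (t + 1)), ← ih]
    refine lintegral_congr fun x => ?_
    simp only [covariance_snoc, totalNoise_snoc]
    exact M.lintegral_mixtureDensity_rollout (alg t) hv (M.posDef_covariance hlam x.2) _ H x

/-- The self-normalized tail bound in a fixed direction, for a fixed number of episodes. -/
lemma interactionLaw_noise_tail_le {v : State ds} (hv : ‖v‖ = 1) {lam : ℝ}
    (hlam : 0 < lam) (t : ℕ) {p : ℝ} (hp : 0 < p) :
    interactionLaw ν alg M.env M.s₀ t {x |
      Real.log ((M.covariance lam x.2).det / (lam • (1 : Matrix (Fin d) (Fin d) ℝ)).det)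
        + 2 * Real.log (1 / p) < invQuad (M.covariance lam x.2) (M.totalNoise v x.2)}
      ≤ ENNReal.ofReal p := by
  set D₀ := (lam • (1 : Matrix (Fin d) (Fin d) ℝ)).det with hD₀
  have hD₀pos : 0 < D₀ := (posDef_smul_one hlam).det_pos
  have h1 := M.lintegral_mixtureDensity_interactionLaw ν alg hv hlam t
  have hm : Measurable fun x : E × History (State ds) A H t => ENNReal.ofReal
      (mixtureDensity (M.covariance lam x.2) (M.totalNoise v x.2)) :=
    (measurable_mixtureDensity (M.measurable_covariance_apply lam t)
      (M.measurable_totalNoise v t)).comp measurable_snd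
  have h2 := meas_ge_le_lintegral_div (μ := interactionLaw ν alg M.env M.s₀ t) hm.aemeasurable
    (ε := ENNReal.ofReal (1 / (p * √D₀))) (by
      rw [Ne, ENNReal.ofReal_eq_zero, not_le]; positivity) ENNReal.ofReal_ne_top
  rw [h1] at h2
  refine (measure_mono ?_).trans (h2.trans (le_of_eq ?_))
  · intro x hx
    simp only [Set.mem_ofPred_eq] at hx ⊢
    refine ENNReal.ofReal_le_ofReal ?_
    have hdet := (M.posDef_covariance hlam x.2).det_pos
    have h3 : Real.exp ((Real.log ((M.covariance lam x.2).det / D₀) + 2 * Real.log (1 / p)) / 2)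
        ≤ Real.exp (invQuad (M.covariance lam x.2) (M.totalNoise v x.2) / 2) :=
      Real.exp_le_exp.2 (by linarith)
    have h4 : Real.exp ((Real.log ((M.covariance lam x.2).det / D₀) + 2 * Real.log (1 / p)) / 2)
        = √(M.covariance lam x.2).det / √D₀ * (1 / p) := by
      rw [add_div, Real.exp_add, mul_div_cancel_left₀ _ two_ne_zero, Real.exp_log (by positivity),
        ← Real.sqrt_div' _ hD₀pos.le, Real.exp_half, Real.exp_log (by positivity)]
    rw [h4] at h3
    rw [mixtureDensity, le_div_iff₀ (Real.sqrt_pos.2 hdet)]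
    refine le_trans (le_of_eq ?_) h3
    field_simp
  · rw [← ENNReal.ofReal_div_of_pos (by positivity)]
    congr 1
    rw [mixtureDensity, invQuad, ← hD₀]
    simp only [mulVec_zero, dotProduct_zero, zero_div, Real.exp_zero]
    have : √D₀ ≠ 0 := (Real.sqrt_pos.2 hD₀pos).ne'
    field_simp

end

end KNR

end ImitationKNR

namespace ImitationKNR

/-! ### Calibration of the ridge regression model -/

/-- A finite set of at most `5 ^ n` unit vectors that nearly aligns with every direction: it is half
of a maximal `1`-separated subset of the sphere of radius `2`, where points at distance less than `1`
have an angle with cosine more than `7 / 8`. -/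
lemma exists_net (n : ℕ) : ∃ N : Finset (EuclideanSpace ℝ (Fin n)), N.card ≤ 5 ^ n ∧
    (∀ v ∈ N, ‖v‖ = 1) ∧ ∀ g : EuclideanSpace ℝ (Fin n), g ≠ 0 →
      ∃ v ∈ N, 7 / 8 * ‖g‖ ≤ inner ℝ v g := by
  classical
  let Sep : Finset (EuclideanSpace ℝ (Fin n)) → Prop := fun s =>
    (∀ c ∈ s, ‖c‖ = 2) ∧ ∀ c ∈ s, ∀ c' ∈ s, c ≠ c' → 1 ≤ ‖c - c'‖
  have hcard : ∀ s, Sep s → s.card ≤ 5 ^ n := by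
    intro s hs
    have h := Besicovitch.card_le_of_separated s (fun c hc => (hs.1 c hc).le) hs.2
    simpa using h
  let Q : ℕ → Prop := fun k => ∃ s, Sep s ∧ s.card = k
  have hQ0 : Q 0 := ⟨∅, ⟨by simp, by simp⟩, rfl⟩
  obtain ⟨s, hs, hsk⟩ := Nat.findGreatest_spec (P := Q) (Nat.zero_le (5 ^ n)) hQ0
  have hmax : ∀ u : EuclideanSpace ℝ (Fin n), ‖u‖ = 2 → ∃ c ∈ s, ‖u - c‖ < 1 := by
    intro u hu
    by_contra! hcon
    have hus : u ∉ s := fun h => by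
      have := hcon u h
      rw [sub_self, norm_zero] at this
      linarith
    have hsep : Sep (insert u s) := by
      refine ⟨fun c hc => ?_, fun c hc c' hc' hne => ?_⟩
      · rcases Finset.mem_insert.1 hc with rfl | hc
        exacts [hu, hs.1 c hc]
      · rcases Finset.mem_insert.1 hc with rfl | hc1 <;> rcases Finset.mem_insert.1 hc' with rfl | hc2
        · exact absurd rfl hne
        · exact hcon _ hc2
        · rw [norm_sub_rev]; exact hcon _ hc1
        · exact hs.2 c hc1 c' hc2 hne
    have h1 : (insert u s).card ≤ Nat.findGreatest Q (5 ^ n) :=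
      Nat.le_findGreatest (hcard _ hsep) ⟨_, hsep, rfl⟩
    rw [Finset.card_insert_of_notMem hus] at h1
    omega
  refine ⟨s.image fun c => (1 / 2 : ℝ) • c, Finset.card_image_le.trans (hcard s hs), ?_, ?_⟩
  · intro v hv
    obtain ⟨c, hc, rfl⟩ := Finset.mem_image.1 hv
    rw [norm_smul, hs.1 c hc]
    norm_num
  · intro g hg
    have hg0 : 0 < ‖g‖ := norm_pos_iff.2 hg
    obtain ⟨c, hc, hlt⟩ := hmax ((2 / ‖g‖) • g) (by
      rw [norm_smul, Real.norm_of_nonneg (by positivity)]; field_simp)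
    refine ⟨_, Finset.mem_image_of_mem _ hc, ?_⟩
    have h1 := norm_sub_sq_real ((2 / ‖g‖) • g) c
    have h2 : ‖(2 / ‖g‖) • g‖ = 2 := by
      rw [norm_smul, Real.norm_of_nonneg (by positivity)]; field_simp
    rw [h2, hs.1 c hc, real_inner_smul_left, real_inner_comm] at h1
    have h3 : ‖(2 / ‖g‖) • g - c‖ ^ 2 < 1 := by
      have := norm_nonneg ((2 / ‖g‖) • g - c)
      nlinarith
    rw [real_inner_smul_left]
    rw [h1] at h3
    have h4 : 7 / 4 < 1 / ‖g‖ * inner ℝ c g := by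
      have : 2 / ‖g‖ * inner ℝ c g = 2 * (1 / ‖g‖ * inner ℝ c g) := by ring
      linarith
    have h5 : 1 / ‖g‖ * inner ℝ c g * ‖g‖ = inner ℝ c g := by field_simp
    nlinarith

namespace KNR

open Matrix

variable {ds d H t : ℕ} {A : Type*} [MeasurableSpace A] (M : KNR ds d A)

lemma sum_mul_mul_eq_inner (V : Matrix (Fin ds) (Fin d) ℝ) (v : State ds) (y : Fin d → ℝ) :
    ∑ i, ∑ j, V i j * (v i * y j) = inner ℝ v (toEuclideanLin V (WithLp.toLp 2 y)) := by
  simp only [PiLp.inner_apply, toLpLin_apply, mulVec, dotProduct]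
  refine Finset.sum_congr rfl fun i _ => ?_
  simp only [RCLike.inner_apply, conj_trivial, Finset.sum_mul]
  exact Finset.sum_congr rfl fun j _ => by ring

lemma toEuclideanLin_vecMulVec (v : State ds) (y : Fin d → ℝ) (x : EuclideanSpace ℝ (Fin d)) :
    toEuclideanLin (vecMulVec v.ofLp y) x = (y ⬝ᵥ x.ofLp) • v := by
  ext i
  simp [toLpLin_apply, vecMulVec_mulVec]

/-- The first-order condition of ridge regression, tested against the rank-one matrix `v yᵀ`. -/
lemma ridge_normal_equation {lam : ℝ} {D : History (State ds) A H t}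
    {V₀ : Matrix (Fin ds) (Fin d) ℝ} (hmin : ∀ V, M.ridgeLoss lam D V₀ ≤ M.ridgeLoss lam D V)
    (v : State ds) (y : Fin d → ℝ) :
    (∑ k, ∑ h, inner ℝ v (toEuclideanLin V₀ (M.φ (D k h).1) - (D k h).2)
        * (y ⬝ᵥ M.feature (D k h)))
      + lam * inner ℝ v (toEuclideanLin V₀ (WithLp.toLp 2 y)) = 0 := by
  set b := (∑ k, ∑ h, inner ℝ v (toEuclideanLin V₀ (M.φ (D k h).1) - (D k h).2)
        * (y ⬝ᵥ M.feature (D k h)))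
      + lam * inner ℝ v (toEuclideanLin V₀ (WithLp.toLp 2 y)) with hb
  set c := (∑ k, ∑ h, (y ⬝ᵥ M.feature (D k h)) ^ 2 * ‖v‖ ^ 2)
    + lam * ∑ i, ∑ j, (v i * y j) ^ 2 with hc
  have hexp : ∀ ε : ℝ, M.ridgeLoss lam D (V₀ + ε • vecMulVec v.ofLp y)
      = M.ridgeLoss lam D V₀ + 2 * ε * b + ε ^ 2 * c := by
    intro ε
    have h1 : ∀ k h, ‖toEuclideanLin (V₀ + ε • vecMulVec v.ofLp y) (M.φ (D k h).1) - (D k h).2‖ ^ 2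
        = ‖toEuclideanLin V₀ (M.φ (D k h).1) - (D k h).2‖ ^ 2
          + 2 * ε * (inner ℝ v (toEuclideanLin V₀ (M.φ (D k h).1) - (D k h).2)
            * (y ⬝ᵥ M.feature (D k h))) + ε ^ 2 * ((y ⬝ᵥ M.feature (D k h)) ^ 2 * ‖v‖ ^ 2) := by
      intro k h
      rw [map_add, map_smul, LinearMap.add_apply, LinearMap.smul_apply, toEuclideanLin_vecMulVec,
        add_sub_right_comm, norm_add_sq_real, real_inner_smul_right, real_inner_smul_right,
        real_inner_comm, norm_smul, norm_smul, mul_pow, mul_pow, Real.norm_eq_abs, sq_abs,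
        Real.norm_eq_abs, sq_abs]
      simp only [feature]
      ring
    have h2 : ∀ i j, (V₀ + ε • vecMulVec v.ofLp y) i j ^ 2
        = V₀ i j ^ 2 + 2 * ε * (V₀ i j * (v i * y j)) + ε ^ 2 * (v i * y j) ^ 2 := by
      intro i j
      simp only [Matrix.add_apply, Matrix.smul_apply, vecMulVec_apply, smul_eq_mul]
      ring
    simp only [ridgeLoss, h1, h2, Finset.sum_add_distrib, ← Finset.mul_sum, hb, hc,
      sum_mul_mul_eq_inner]
    ring
  have hnonneg : ∀ ε : ℝ, 0 ≤ c * (ε * ε) + 2 * b * ε + 0 := by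
    intro ε
    have := hmin (V₀ + ε • vecMulVec v.ofLp y)
    rw [hexp] at this
    nlinarith
  have h := discrim_le_zero hnonneg
  rw [discrim] at h
  nlinarith [sq_nonneg b]

lemma dotProduct_covariance_mulVec (lam : ℝ) (D : History (State ds) A H t) (x y : Fin d → ℝ) :
    x ⬝ᵥ M.covariance lam D *ᵥ y
      = lam * (x ⬝ᵥ y) + ∑ k, ∑ h, (x ⬝ᵥ M.feature (D k h)) * (M.feature (D k h) ⬝ᵥ y) := by
  rw [covariance_eq, add_mulVec, dotProduct_add, smul_mulVec, one_mulVec, dotProduct_smul,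
    smul_eq_mul]
  congr 1
  simp only [featureSum, sum_mulVec, dotProduct_sum, vecMulVec_mulVec]
  refine Finset.sum_congr rfl fun k _ => Finset.sum_congr rfl fun h _ => ?_
  simp [mul_comm]

lemma le_dotProduct_covariance_mulVec (lam : ℝ) (D : History (State ds) A H t) (x : Fin d → ℝ) :
    lam * (x ⬝ᵥ x) ≤ x ⬝ᵥ M.covariance lam D *ᵥ x := by
  rw [dotProduct_covariance_mulVec]
  refine le_add_of_nonneg_right (Finset.sum_nonneg fun k _ => Finset.sum_nonneg fun h _ => ?_)
  rw [dotProduct_comm]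
  exact mul_self_nonneg _

/-- The error of ridge regression, in terms of the noise and of the regularization bias. -/
lemma inner_ridge_error {lam : ℝ} (hlam : 0 < lam) {D : History (State ds) A H t}
    {V₀ : Matrix (Fin ds) (Fin d) ℝ} (hmin : ∀ V, M.ridgeLoss lam D V₀ ≤ M.ridgeLoss lam D V)
    (v : State ds) (x : EuclideanSpace ℝ (Fin d)) :
    inner ℝ v (toEuclideanLin (V₀ - M.W) x
        + lam • toEuclideanLin M.W (WithLp.toLp 2 ((M.covariance lam D)⁻¹ *ᵥ x.ofLp)))
      = M.σ * (M.totalNoise v D ⬝ᵥ (M.covariance lam D)⁻¹ *ᵥ x.ofLp) := by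
  set y := (M.covariance lam D)⁻¹ *ᵥ x.ofLp with hy
  have hcov : M.covariance lam D *ᵥ y = x.ofLp := by
    rw [hy, mulVec_mulVec, mul_nonsing_inv _ (isUnit_det_of_posDef (M.posDef_covariance hlam D)),
      one_mulVec]
  have hx : toEuclideanLin (V₀ - M.W) x = lam • toEuclideanLin (V₀ - M.W) (WithLp.toLp 2 y)
      + ∑ k, ∑ h, (y ⬝ᵥ M.feature (D k h)) • toEuclideanLin (V₀ - M.W) (M.φ (D k h).1) := by
    have hxe : x = lam • WithLp.toLp 2 y + ∑ k, ∑ h, (y ⬝ᵥ M.feature (D k h)) • M.φ (D k h).1 := by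
      ext i
      have h1 : x i = (M.covariance lam D *ᵥ y) i := by rw [hcov]
      rw [h1, covariance_eq, add_mulVec, smul_mulVec, one_mulVec]
      simp only [featureSum, sum_mulVec, vecMulVec_mulVec, Pi.add_apply, Pi.smul_apply,
        Finset.sum_apply, PiLp.add_apply, PiLp.smul_apply, WithLp.ofLp_sum, smul_eq_mul,
        MulOpposite.smul_eq_mul_unop, MulOpposite.unop_op]
      congr 1
      refine Finset.sum_congr rfl fun k _ => Finset.sum_congr rfl fun h _ => ?_
      rw [dotProduct_comm, mul_comm]
      rfl
    conv_lhs => rw [hxe]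
    simp only [map_add, map_smul, map_sum]
  have hne := M.ridge_normal_equation hmin v y
  have hnoise : M.σ * (M.totalNoise v D ⬝ᵥ y)
      = ∑ k, ∑ h, inner ℝ v ((D k h).2 - toEuclideanLin M.W (M.φ (D k h).1))
          * (y ⬝ᵥ M.feature (D k h)) := by
    simp only [totalNoise, noiseSum, sum_dotProduct, smul_dotProduct, Finset.mul_sum, smul_eq_mul]
    refine Finset.sum_congr rfl fun k _ => Finset.sum_congr rfl fun h _ => ?_
    rw [noise, dotProduct_comm y]
    have := M.σ_pos.ne'
    field_simp
  rw [hnoise, hx]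
  simp only [inner_add_right, real_inner_smul_right, inner_sum, map_sub, LinearMap.sub_apply,
    inner_sub_right] at hne ⊢
  simp only [sub_mul, mul_sub, Finset.sum_sub_distrib] at hne ⊢
  have e1 : ∀ (g : Fin t → Fin H → ℝ), ∑ k, ∑ h, (y ⬝ᵥ M.feature (D k h)) * g k h
      = ∑ k, ∑ h, g k h * (y ⬝ᵥ M.feature (D k h)) := fun g =>
    Finset.sum_congr rfl fun k _ => Finset.sum_congr rfl fun h _ => mul_comm _ _
  rw [e1, e1]
  linarith

lemma norm_toEuclideanLin_le (V : Matrix (Fin ds) (Fin d) ℝ) (x : EuclideanSpace ℝ (Fin d)) :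
    ‖toEuclideanLin V x‖ ≤ spectralNorm₂ V * ‖x‖ :=
  (toEuclideanLin V).toContinuousLinearMap.le_opNorm x

/-- The confidence term inside `β_t`. -/
noncomputable def confidence (lam δ : ℝ) (D : History (State ds) A H t) : ℝ :=
  ds * Real.log 5 + 2 * Real.log ((max t 1 : ℕ) ^ 2 / δ) + Real.log 4
    + Real.log ((M.covariance lam D).det / (lam • (1 : Matrix (Fin d) (Fin d) ℝ)).det)

lemma beta_eq (lam δ : ℝ) (D : History (State ds) A H t) :
    M.beta lam δ D
      = √(2 * lam * spectralNorm₂ M.W ^ 2 + 8 * M.σ ^ 2 * M.confidence lam δ D) := rfl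

lemma uncertainty_eq (lam δ : ℝ) (D : History (State ds) A H t) (z : State ds × A) :
    M.uncertainty lam δ D z
      = M.beta lam δ D / M.σ * √(invQuad (M.covariance lam D) (M.φ z).ofLp) := rfl

lemma log_det_ratio_nonneg {lam : ℝ} (hlam : 0 < lam) (D : History (State ds) A H t) :
    0 ≤ Real.log ((M.covariance lam D).det / (lam • (1 : Matrix (Fin d) (Fin d) ℝ)).det) := by
  have h0 : 0 < (lam • (1 : Matrix (Fin d) (Fin d) ℝ)).det := (posDef_smul_one hlam).det_pos
  refine Real.log_nonneg ((one_le_div h0).2 ?_)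
  have h := det_le_det_add_sum_vecMulVec (Finset.univ : Finset (Fin t × Fin H))
    (fun p => M.feature (D p.1 p.2)) (posDef_smul_one hlam)
  rw [Fintype.sum_prod_type] at h
  rw [covariance_eq]
  exact h

lemma log_max_sq_div_nonneg (t : ℕ) {δ : ℝ} (hδ : 0 < δ) (hδ1 : δ ≤ 1) :
    0 ≤ Real.log ((max t 1 : ℕ) ^ 2 / δ) := by
  refine Real.log_nonneg ((one_le_div hδ).2 (hδ1.trans (one_le_pow₀ ?_)))
  exact_mod_cast le_max_right t 1

/-- The event that in every direction of the net `N` the noise after `t` episodes is small. -/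
def NoiseBounded (N : Finset (State ds)) (lam δ : ℝ) (D : History (State ds) A H t) : Prop :=
  ∀ v ∈ N, invQuad (M.covariance lam D) (M.totalNoise v D)
    ≤ Real.log ((M.covariance lam D).det / (lam • (1 : Matrix (Fin d) (Fin d) ℝ)).det)
      + 2 * Real.log (1 / (δ / (2 * (max t 1 : ℕ) ^ 2) / 5 ^ ds))

lemma sq_norm_ridge_error_le {N : Finset (State ds)}
    (hN : ∀ g : State ds, g ≠ 0 → ∃ v ∈ N, 7 / 8 * ‖g‖ ≤ inner ℝ v g)
    {lam δ : ℝ} (hlam : 0 < lam) (hδ : 0 < δ) (hδ1 : δ ≤ 1) {D : History (State ds) A H t}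
    (hgood : M.NoiseBounded N lam δ D) {V₀ : Matrix (Fin ds) (Fin d) ℝ}
    (hmin : ∀ V, M.ridgeLoss lam D V₀ ≤ M.ridgeLoss lam D V) (x : EuclideanSpace ℝ (Fin d)) :
    ‖toEuclideanLin (V₀ - M.W) x‖ ^ 2
      ≤ M.beta lam δ D ^ 2 * invQuad (M.covariance lam D) x.ofLp := by
  have hP := M.posDef_covariance hlam D
  set q := invQuad (M.covariance lam D) x.ofLp with hq
  have hq0 : 0 ≤ q := invQuad_nonneg hP _
  set y := (M.covariance lam D)⁻¹ *ᵥ x.ofLp with hy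
  set ld := Real.log ((M.covariance lam D).det / (lam • (1 : Matrix (Fin d) (Fin d) ℝ)).det)
    with hld
  have hld0 : 0 ≤ ld := M.log_det_ratio_nonneg hlam D
  set lt := Real.log ((max t 1 : ℕ) ^ 2 / δ) with hlt
  have hlt0 : 0 ≤ lt := log_max_sq_div_nonneg t hδ hδ1
  have hσ := M.σ_pos
  have h5 : 0 ≤ Real.log 5 := Real.log_nonneg (by norm_num)
  have h2 : 0 ≤ Real.log 2 := Real.log_nonneg (by norm_num)
  have h4 : Real.log 4 = 2 * Real.log 2 := by
    rw [show (4 : ℝ) = 2 ^ 2 by norm_num, Real.log_pow]; norm_num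
  have hmax : (0 : ℝ) < (max t 1 : ℕ) := by exact_mod_cast lt_of_lt_of_le one_pos (le_max_right t 1)
  have hlog : Real.log (1 / (δ / (2 * (max t 1 : ℕ) ^ 2) / 5 ^ ds))
      = ds * Real.log 5 + lt + Real.log 2 := by
    rw [show 1 / (δ / (2 * ((max t 1 : ℕ) : ℝ) ^ 2) / 5 ^ ds)
      = 5 ^ ds * ((max t 1 : ℕ) ^ 2 / δ) * 2 by field_simp, Real.log_mul (by positivity) two_ne_zero,
      Real.log_mul (by positivity) (by positivity), Real.log_pow]
  -- the part of the error caused by the noise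
  set g := toEuclideanLin (V₀ - M.W) x + lam • toEuclideanLin M.W (WithLp.toLp 2 y) with hg
  have hgle : 49 / 64 * ‖g‖ ^ 2 ≤ M.σ ^ 2 * (ld + 2 * (ds * Real.log 5 + lt + Real.log 2)) * q := by
    rcases eq_or_ne g 0 with h0 | h0
    · rw [h0]; simp; positivity
    obtain ⟨v, hv, hvg⟩ := hN g h0
    have h1 := M.inner_ridge_error hlam hmin v x
    have h3 := sq_dotProduct_inv_mulVec_le hP (M.totalNoise v D) x.ofLp
    have h6 := hgood v hv
    rw [hlog, ← hld] at h6
    rw [← hy, ← hg] at h1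
    calc 49 / 64 * ‖g‖ ^ 2 = (7 / 8 * ‖g‖) ^ 2 := by ring
      _ ≤ (inner ℝ v g) ^ 2 := by gcongr
      _ = M.σ ^ 2 * (M.totalNoise v D ⬝ᵥ y) ^ 2 := by rw [h1]; ring
      _ ≤ M.σ ^ 2 * (invQuad (M.covariance lam D) (M.totalNoise v D) * q) := by gcongr
      _ ≤ M.σ ^ 2 * ((ld + 2 * (ds * Real.log 5 + lt + Real.log 2)) * q) := by gcongr
      _ = _ := by ring
  -- the part caused by the regularization
  have hbias : ‖lam • toEuclideanLin M.W (WithLp.toLp 2 y)‖ ^ 2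
      ≤ lam * spectralNorm₂ M.W ^ 2 * q := by
    have h1 := mul_dotProduct_inv_mulVec_le hP (M.le_dotProduct_covariance_mulVec lam D) x.ofLp
    rw [← hy, ← hq] at h1
    have h3 : ‖(WithLp.toLp 2 y : EuclideanSpace ℝ (Fin d))‖ ^ 2 = y ⬝ᵥ y := by
      rw [EuclideanSpace.real_norm_sq_eq, dotProduct]
      exact Finset.sum_congr rfl fun j _ => sq _
    calc ‖lam • toEuclideanLin M.W (WithLp.toLp 2 y)‖ ^ 2
        = lam ^ 2 * ‖toEuclideanLin M.W (WithLp.toLp 2 y)‖ ^ 2 := by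
          rw [norm_smul, mul_pow, Real.norm_eq_abs, sq_abs]
      _ ≤ lam ^ 2 * (spectralNorm₂ M.W * ‖(WithLp.toLp 2 y : EuclideanSpace ℝ (Fin d))‖) ^ 2 := by
          gcongr
          exact norm_toEuclideanLin_le _ _
      _ = lam * spectralNorm₂ M.W ^ 2 * (lam * (y ⬝ᵥ y)) := by rw [mul_pow, h3]; ring
      _ ≤ _ := by gcongr
  have htri : ‖toEuclideanLin (V₀ - M.W) x‖ ^ 2
      ≤ 2 * ‖g‖ ^ 2 + 2 * ‖lam • toEuclideanLin M.W (WithLp.toLp 2 y)‖ ^ 2 := by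
    have h1 : toEuclideanLin (V₀ - M.W) x = g - lam • toEuclideanLin M.W (WithLp.toLp 2 y) := by
      rw [hg]; abel
    have h3 := norm_sub_le g (lam • toEuclideanLin M.W (WithLp.toLp 2 y))
    rw [← h1] at h3
    have := sq_nonneg (‖g‖ - ‖lam • toEuclideanLin M.W (WithLp.toLp 2 y)‖)
    have h6 := pow_le_pow_left₀ (norm_nonneg _) h3 2
    nlinarith
  have hconf : M.confidence lam δ D = ds * Real.log 5 + 2 * lt + Real.log 4 + ld := rfl
  have hds : (0 : ℝ) ≤ ds * Real.log 5 := by positivity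
  have hσq : 0 ≤ M.σ ^ 2 * q := by positivity
  have hl : 0 ≤ lam * spectralNorm₂ M.W ^ 2 := by positivity
  rw [beta_eq, hconf, h4, Real.sq_sqrt (by positivity)]
  have key : M.σ ^ 2 * (ld + 2 * (ds * Real.log 5 + lt + Real.log 2)) * q
      ≤ 49 / 64 * (4 * M.σ ^ 2 * (ds * Real.log 5 + 2 * lt + 2 * Real.log 2 + ld) * q) := by
    have : (ld + 2 * (ds * Real.log 5 + lt + Real.log 2))
        ≤ 49 / 64 * (4 * (ds * Real.log 5 + 2 * lt + 2 * Real.log 2 + ld)) := by linarith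
    calc _ = M.σ ^ 2 * q * (ld + 2 * (ds * Real.log 5 + lt + Real.log 2)) := by ring
      _ ≤ M.σ ^ 2 * q * (49 / 64 * (4 * (ds * Real.log 5 + 2 * lt + 2 * Real.log 2 + ld))) := by
          gcongr
      _ = _ := by ring
  nlinarith

/-- On the event that the noise is bounded, the ridge regression model is calibrated. -/
lemma l1Dist_model_env_le {N : Finset (State ds)}
    (hN : ∀ g : State ds, g ≠ 0 → ∃ v ∈ N, 7 / 8 * ‖g‖ ≤ inner ℝ v g)
    {lam δ : ℝ} (hlam : 0 < lam) (hδ : 0 < δ) (hδ1 : δ ≤ 1) {D : History (State ds) A H t}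
    (hgood : M.NoiseBounded N lam δ D) {V₀ : Matrix (Fin ds) (Fin d) ℝ}
    (hmin : ∀ V, M.ridgeLoss lam D V₀ ≤ M.ridgeLoss lam D V) (z : State ds × A) :
    l1Dist (M.model V₀ z) (M.env z) ≤ min (M.uncertainty lam δ D z) 2 := by
  refine le_min ?_ (l1Dist_le_two _ _)
  refine (l1Dist_multivariateGaussian_le (toEuclideanLin V₀ (M.φ z)) (toEuclideanLin M.W (M.φ z))
    M.σ_pos).trans ?_
  rw [uncertainty_eq, div_mul_eq_mul_div, ← LinearMap.sub_apply, ← map_sub]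
  have hσ := M.σ_pos
  gcongr
  refine abs_le_of_sq_le_sq' ?_ ?_ |>.2
  · rw [mul_pow, Real.sq_sqrt (invQuad_nonneg (M.posDef_covariance hlam D) _)]
    exact M.sq_norm_ridge_error_le hN hlam hδ hδ1 hgood hmin _
  · exact mul_nonneg (Real.sqrt_nonneg _) (Real.sqrt_nonneg _)

lemma measurableSet_noiseBounded (N : Finset (State ds)) (lam δ : ℝ) :
    MeasurableSet {D : History (State ds) A H t | M.NoiseBounded N lam δ D} := by
  simp only [NoiseBounded, Set.ofPred_forall]
  refine N.measurableSet_biInter fun v _ => measurableSet_le ?_ ?_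
  · exact measurable_invQuad (M.measurable_covariance_apply lam t) (M.measurable_totalNoise v t)
  · exact ((measurable_matrix_det (M.measurable_covariance_apply lam t)).div_const _).log.add_const
      _

/-- The weights with which the confidence level is split among the iterations. Without data there
is no noise, so that the iteration `0` needs no share. -/
noncomputable def shareWeight (t : ℕ) : ℝ := if t = 0 then 0 else 1 / (2 * t ^ 2)

lemma shareWeight_nonneg (t : ℕ) : 0 ≤ shareWeight t := by
  unfold shareWeight; split_ifs <;> positivity

lemma sum_shareWeight_le (n : ℕ) : ∑ t ∈ Finset.range n, shareWeight t ≤ 1 := by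
  have h : ∀ n : ℕ, ∑ t ∈ Finset.range (n + 1), shareWeight t ≤ 1 - 1 / (n + 1) := by
    intro n
    induction n with
    | zero => simp [shareWeight]
    | succ n ih =>
      rw [Finset.sum_range_succ]
      have : shareWeight (n + 1) ≤ 1 / (n + 1) - 1 / (n + 1 + 1) := by
        simp only [shareWeight, Nat.succ_ne_zero, if_false]
        push_cast
        rw [div_sub_div _ _ (by positivity) (by positivity),
          div_le_div_iff₀ (by positivity) (by positivity)]
        nlinarith [(Nat.cast_nonneg n : (0 : ℝ) ≤ n)]
      push_cast
      linarith
  refine (Finset.sum_le_sum_of_subset_of_nonneg (Finset.range_mono (Nat.le_succ n))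
    fun t _ _ => shareWeight_nonneg t).trans ((h n).trans ?_)
  have : (0 : ℝ) ≤ 1 / (n + 1) := by positivity
  linarith

section

variable {E : Type*} [MeasurableSpace E] (ν : Measure E) [IsProbabilityMeasure ν]
  (alg : Algorithm E (State ds) A H) [∀ t, IsMarkovKernel (alg t)]

lemma interactionLaw_not_noiseBounded_le {N : Finset (State ds)} (hNcard : N.card ≤ 5 ^ ds)
    (hN1 : ∀ v ∈ N, ‖v‖ = 1) {lam δ : ℝ} (hlam : 0 < lam) (hδ : 0 < δ) (hδ1 : δ ≤ 1) (t : ℕ) :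
    interactionLaw ν alg M.env M.s₀ t {x | ¬ M.NoiseBounded N lam δ x.2}
      ≤ ENNReal.ofReal (δ * shareWeight t) := by
  rcases Nat.eq_zero_or_pos t with rfl | ht
  · have : {x : E × History (State ds) A H 0 | ¬ M.NoiseBounded N lam δ x.2} = ∅ := by
      refine Set.eq_empty_of_forall_notMem fun x hx => hx fun v _ => ?_
      have h1 : M.totalNoise v x.2 = 0 := by simp [totalNoise]
      rw [h1, invQuad, zero_dotProduct]
      refine add_nonneg (M.log_det_ratio_nonneg hlam _) (mul_nonneg zero_le_two
        (Real.log_nonneg ((one_le_div (by positivity)).2 ?_)))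
      have h5 : (1 : ℝ) ≤ 5 ^ ds := one_le_pow₀ (by norm_num)
      rw [div_div, div_le_one (by positivity)]
      norm_num
      linarith
    simp [this]
  set p : ℝ := δ / (2 * (max t 1 : ℕ) ^ 2) / 5 ^ ds with hp
  have hmax : (0 : ℝ) < (max t 1 : ℕ) := by exact_mod_cast lt_of_lt_of_le one_pos (le_max_right t 1)
  have hp0 : 0 < p := by positivity
  have hsub : {x : E × History (State ds) A H t | ¬ M.NoiseBounded N lam δ x.2} ⊆ ⋃ v ∈ N, {x |
      Real.log ((M.covariance lam x.2).det / (lam • (1 : Matrix (Fin d) (Fin d) ℝ)).det)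
        + 2 * Real.log (1 / p) < invQuad (M.covariance lam x.2) (M.totalNoise v x.2)} := by
    intro x hx
    simp only [Set.mem_ofPred_eq, NoiseBounded, not_forall, not_le] at hx
    obtain ⟨v, hv, hlt⟩ := hx
    exact Set.mem_biUnion hv hlt
  calc _ ≤ _ := measure_mono hsub
    _ ≤ ∑ v ∈ N, _ := measure_biUnion_finset_le N _
    _ ≤ ∑ _v ∈ N, ENNReal.ofReal p := Finset.sum_le_sum fun v hv =>
        M.interactionLaw_noise_tail_le ν alg (hN1 v hv) hlam t hp0
    _ = ENNReal.ofReal (N.card * p) := by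
        rw [Finset.sum_const, nsmul_eq_mul, ENNReal.ofReal_mul (by positivity),
          ENNReal.ofReal_natCast]
    _ ≤ ENNReal.ofReal (δ * shareWeight t) := by
        refine ENNReal.ofReal_le_ofReal ?_
        have h1 : (N.card : ℝ) ≤ 5 ^ ds := by exact_mod_cast hNcard
        rw [shareWeight, if_neg ht.ne']
        calc (N.card : ℝ) * p ≤ 5 ^ ds * p := by gcongr
          _ = _ := by rw [hp, max_eq_left ht]; field_simp

/-- Calibration, uniformly over all iterations of an infinite interaction. -/
theorem measure_not_calibrated_le {lam δ : ℝ} (hlam : 0 < lam) (hδ : 0 < δ) (hδ1 : δ ≤ 1)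
    {West : (t : ℕ) → History (State ds) A H t → Matrix (Fin ds) (Fin d) ℝ}
    (hW : M.IsRidgeRegression lam West) {Ω : Type*} [MeasurableSpace Ω] (μ : Measure Ω)
    (e : Ω → E) (τ : ℕ → Ω → Episode (State ds) A H)
    (hlaw : ∀ T : ℕ, μ.map (fun ω => (e ω, fun k : Fin T => τ k ω))
      = interactionLaw ν alg M.env M.s₀ T) :
    μ {ω | ¬ ∀ (t : ℕ) (z : State ds × A),
        l1Dist (M.model (West t fun k => τ k ω) z) (M.env z)
          ≤ min (M.uncertainty lam δ (fun k : Fin t => τ k ω) z) 2} ≤ ENNReal.ofReal δ := by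
  obtain ⟨N, hNcard, hN1, hN⟩ := exists_net ds
  have hsub : {ω | ¬ ∀ (t : ℕ) (z : State ds × A),
        l1Dist (M.model (West t fun k => τ k ω) z) (M.env z)
          ≤ min (M.uncertainty lam δ (fun k : Fin t => τ k ω) z) 2}
      ⊆ ⋃ t : ℕ, (fun ω => (e ω, fun k : Fin t => τ k ω)) ⁻¹'
        {x | ¬ M.NoiseBounded N lam δ x.2} := by
    intro ω hω
    by_contra hcon
    simp only [Set.mem_iUnion, Set.mem_preimage, Set.mem_ofPred_eq, not_exists, not_not] at hcon
    exact hω fun t z => M.l1Dist_model_env_le hN hlam hδ hδ1 (hcon t) (hW t _) z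
  refine (measure_mono hsub).trans ((measure_iUnion_le _).trans ?_)
  refine ENNReal.tsum_le_of_sum_range_le fun n => ?_
  calc _ ≤ ∑ t ∈ Finset.range n, ENNReal.ofReal (δ * shareWeight t) := by
        refine Finset.sum_le_sum fun t _ => ?_
        refine le_trans (le_of_eq ?_)
          (M.interactionLaw_not_noiseBounded_le ν alg hNcard hN1 hlam hδ hδ1 t)
        have hae : AEMeasurable (fun ω => (e ω, fun k : Fin t => τ k ω)) μ := by
          refine aemeasurable_of_map_neZero ?_
          rw [hlaw]
          infer_instance
        rw [← hlaw, Measure.map_apply_of_aemeasurable hae]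
        exact ((M.measurableSet_noiseBounded N lam δ).preimage measurable_snd).compl
    _ = ENNReal.ofReal (δ * ∑ t ∈ Finset.range n, shareWeight t) := by
        rw [Finset.mul_sum, ENNReal.ofReal_sum_of_nonneg fun t _ =>
          mul_nonneg hδ.le (shareWeight_nonneg t)]
    _ ≤ ENNReal.ofReal δ := by
        refine ENNReal.ofReal_le_ofReal ?_
        nlinarith [sum_shareWeight_le n]

/-- With probability at least `1 - δ` the noise is bounded in each of the first `T` iterations. -/
lemma interactionLaw_exists_not_noiseBounded_le {N : Finset (State ds)} (hNcard : N.card ≤ 5 ^ ds)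
    (hN1 : ∀ v ∈ N, ‖v‖ = 1) {lam δ : ℝ} (hlam : 0 < lam) (hδ : 0 < δ) (hδ1 : δ ≤ 1) (T : ℕ) :
    interactionLaw ν alg M.env M.s₀ T
      {x | ∃ t : Fin T, ¬ M.NoiseBounded N lam δ (x.2.take t)} ≤ ENNReal.ofReal δ := by
  have hsub : {x : E × History (State ds) A H T |
      ∃ t : Fin T, ¬ M.NoiseBounded N lam δ (x.2.take t)} ⊆ ⋃ t ∈ (Finset.univ : Finset (Fin T)),
      pastOf t.isLt.le ⁻¹' {x | ¬ M.NoiseBounded N lam δ x.2} := by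
    rintro x ⟨t, ht⟩
    exact Set.mem_biUnion (Finset.mem_univ t) ht
  refine (measure_mono hsub).trans ((measure_biUnion_finset_le _ _).trans ?_)
  calc _ ≤ ∑ t : Fin T, ENNReal.ofReal (δ * shareWeight t) := by
        refine Finset.sum_le_sum fun t _ => ?_
        refine le_trans (le_of_eq ?_)
          (M.interactionLaw_not_noiseBounded_le ν alg hNcard hN1 hlam hδ hδ1 t)
        rw [← map_pastOf_interactionLaw ν alg M.env M.s₀ t.isLt.le,
          Measure.map_apply (measurable_pastOf _)]
        exact ((M.measurableSet_noiseBounded N lam δ).preimage measurable_snd).compl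
    _ = ENNReal.ofReal (δ * ∑ t ∈ Finset.range T, shareWeight t) := by
        rw [Finset.mul_sum, ENNReal.ofReal_sum_of_nonneg fun t _ =>
          mul_nonneg hδ.le (shareWeight_nonneg t), ← Fin.sum_univ_eq_sum_range
            (fun t => ENNReal.ofReal (δ * shareWeight t))]
    _ ≤ ENNReal.ofReal δ := by
        refine ENNReal.ofReal_le_ofReal ?_
        nlinarith [sum_shareWeight_le T]

end

end KNR

end ImitationKNR

namespace ImitationKNR

/-! ### The information gain -/

namespace KNR

open Matrix

variable {ds d H : ℕ} {A : Type*} [MeasurableSpace A] (M : KNR ds d A)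

lemma covariance_eq_init (lam : ℝ) {T : ℕ} (D : History (State ds) A H (T + 1)) :
    M.covariance lam D
      = M.covariance lam (Fin.init D : History (State ds) A H T) + M.featureSum (D (Fin.last T)) := by
  conv_lhs => rw [← Fin.snoc_init_self D]
  exact M.covariance_snoc lam _ _

lemma uncertainty_nonneg (lam δ : ℝ) {t : ℕ} (D : History (State ds) A H t) (z : State ds × A) :
    0 ≤ M.uncertainty lam δ D z :=
  mul_nonneg (div_nonneg (Real.sqrt_nonneg _) M.σ_pos.le) (Real.sqrt_nonneg _)

/-- The elliptical potential lemma, with a covariance that is updated once per episode: each of the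
`H` terms of an episode is bounded by the whole increase of the logarithm of the determinant. -/
lemma sum_log_one_add_invQuad_le {lam : ℝ} (hlam : 0 < lam) {T : ℕ}
    (D : History (State ds) A H T) :
    ∑ t : Fin T, ∑ h : Fin H,
        Real.log (1 + invQuad (M.covariance lam (D.take t)) (M.feature (D t h)))
      ≤ H * Real.log ((M.covariance lam D).det / (lam • (1 : Matrix (Fin d) (Fin d) ℝ)).det) := by
  have hD₀ : 0 < (lam • (1 : Matrix (Fin d) (Fin d) ℝ)).det := (posDef_smul_one hlam).det_pos
  induction T with
  | zero => simp [covariance_eq]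
  | succ T ih =>
    set D' : History (State ds) A H T := Fin.init D with hD'
    rw [Fin.sum_univ_castSucc]
    have h1 := ih D'
    have hP := M.posDef_covariance hlam D'
    have hP2 := M.posDef_covariance hlam D
    have hlast : ∀ h : Fin H, Real.log
        (1 + invQuad (M.covariance lam (D.take (Fin.last T))) (M.feature (D (Fin.last T) h)))
        ≤ Real.log (M.covariance lam D).det - Real.log (M.covariance lam D').det := by
      intro h
      have h2 := det_mul_one_add_invQuad_le (fun h => M.feature (D (Fin.last T) h)) hP h
      have h3 : (M.covariance lam D).det
          = (M.covariance lam D' + ∑ h, vecMulVec (M.feature (D (Fin.last T) h))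
              (M.feature (D (Fin.last T) h))).det := by
        rw [covariance_eq_init]; rfl
      rw [← h3] at h2
      have hq : 0 < 1 + invQuad (M.covariance lam D') (M.feature (D (Fin.last T) h)) := by
        linarith [invQuad_nonneg hP (M.feature (D (Fin.last T) h))]
      have h4 := Real.log_le_log (mul_pos hP.det_pos hq) h2
      rw [Real.log_mul hP.det_pos.ne' hq.ne'] at h4
      change Real.log (1 + invQuad (M.covariance lam D') (M.feature (D (Fin.last T) h))) ≤ _
      linarith
    have h5 := Finset.sum_le_sum fun h (_ : h ∈ Finset.univ) => hlast h
    rw [Finset.sum_const, Finset.card_univ, Fintype.card_fin, nsmul_eq_mul] at h5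
    rw [Real.log_div hP.det_pos.ne' hD₀.ne'] at h1
    rw [Real.log_div hP2.det_pos.ne' hD₀.ne']
    have h6 : ∑ t : Fin T, ∑ h : Fin H, Real.log (1 + invQuad (M.covariance lam
        (D.take t.castSucc)) (M.feature (D t.castSucc h)))
        ≤ H * (Real.log (M.covariance lam D').det
          - Real.log (lam • (1 : Matrix (Fin d) (Fin d) ℝ)).det) := h1
    nlinarith

lemma log_det_ratio_le {lam : ℝ} (hlam : 0 < lam) {t T : ℕ} (htT : t ≤ T)
    (D : History (State ds) A H t) :
    Real.log ((M.covariance lam D).det / (lam • (1 : Matrix (Fin d) (Fin d) ℝ)).det)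
      ≤ d * Real.log (1 + T * H / lam) := by
  have hP := M.posDef_covariance hlam D
  have htT' : (t : ℝ) ≤ T := by exact_mod_cast htT
  have h1 : (M.covariance lam D).det ≤ (lam + T * H) ^ d := by
    refine det_le_pow_of_forall_quadForm_le hP fun z => ?_
    rw [dotProduct_covariance_mulVec, add_mul]
    have hz : 0 ≤ z ⬝ᵥ z := Finset.sum_nonneg fun i _ => mul_self_nonneg _
    have h2 : ∀ k h, (z ⬝ᵥ M.feature (D k h)) * (M.feature (D k h) ⬝ᵥ z) ≤ z ⬝ᵥ z := by
      intro k h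
      have h3 := Finset.sum_mul_sq_le_sq_mul_sq Finset.univ z (M.feature (D k h))
      have h4 := M.dotProduct_feature_le (D k h)
      rw [dotProduct_comm (M.feature (D k h)) z]
      simp only [dotProduct, ← sq] at h4 hz ⊢
      nlinarith
    have h5 : ∑ k, ∑ h, (z ⬝ᵥ M.feature (D k h)) * (M.feature (D k h) ⬝ᵥ z)
        ≤ t * (H * (z ⬝ᵥ z)) := by
      refine (Finset.sum_le_sum fun k _ => Finset.sum_le_sum fun h _ => h2 k h).trans ?_
      simp
    have h6 : (t : ℝ) * (H * (z ⬝ᵥ z)) ≤ T * (H * (z ⬝ᵥ z)) := by gcongr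
    linarith
  have h2 : (lam • (1 : Matrix (Fin d) (Fin d) ℝ)).det = lam ^ d := by simp
  have hTH : (0 : ℝ) ≤ T * H := by positivity
  rw [h2, ← Real.log_pow]
  refine Real.log_le_log (div_pos hP.det_pos (by positivity)) ?_
  rw [show (1 + T * H / lam) ^ d = (lam + T * H) ^ d / lam ^ d by
    rw [← div_pow]; congr 1; field_simp]
  gcongr

lemma min_one_le_two_mul_log {q : ℝ} (hq : 0 ≤ q) : min q 1 ≤ 2 * Real.log (1 + q) := by
  have h1 := Real.one_sub_inv_le_log_of_pos (show 0 < 1 + q by linarith)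
  have h2 : min q 1 / 2 ≤ 1 - (1 + q)⁻¹ := by
    rw [show 1 - (1 + q)⁻¹ = q / (1 + q) by field_simp; ring,
      div_le_div_iff₀ two_pos (by linarith)]
    rcases le_total q 1 with h | h
    · rw [min_eq_left h]; nlinarith
    · rw [min_eq_right h]; nlinarith
  linarith

/-- The bound of the information gain, which holds for every sequence of episodes. -/
lemma sum_min_sq_uncertainty_le (hds : 0 < ds) {lam δ : ℝ} (hlam : 0 < lam)
    (hW : lam * spectralNorm₂ M.W ^ 2 ≤ M.σ ^ 2) (hδ : 0 < δ) (hδ1 : δ ≤ 1) {T : ℕ}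
    (D : History (State ds) A H T) :
    ∑ t : Fin T, ∑ h : Fin H, min (M.uncertainty lam δ (D.take t) (D t h).1 ^ 2) 1
      ≤ 68 * (H * (ds + Real.log (T ^ 2 / δ) + d * Real.log (1 + T * H / lam))
          * (d * Real.log (1 + T * H / lam))) := by
  rcases Nat.eq_zero_or_pos T with rfl | hT
  · simp
  set L := Real.log (1 + T * H / lam) with hL
  set lt := Real.log (T ^ 2 / δ) with hlt
  have hTH : (0 : ℝ) ≤ T * H / lam := by positivity
  have hL0 : 0 ≤ L := Real.log_nonneg (by linarith)
  have hT1 : (1 : ℝ) ≤ T := by exact_mod_cast hT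
  have hlt0 : 0 ≤ lt :=
    Real.log_nonneg ((one_le_div hδ).2 (hδ1.trans (one_le_pow₀ hT1)))
  have hds1 : (1 : ℝ) ≤ ds := by exact_mod_cast hds
  have hσ := M.σ_pos
  set B : ℝ := 34 * (ds + lt + d * L) with hB
  have hdL : 0 ≤ d * L := by positivity
  have hB1 : 1 ≤ B := by rw [hB]; nlinarith
  have hlog5 : Real.log 5 ≤ 2 := by
    rw [Real.log_le_iff_le_exp (by norm_num)]
    have := Real.exp_one_gt_d9
    rw [show (2 : ℝ) = 1 + 1 by norm_num, Real.exp_add]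
    nlinarith
  have hlog4 : Real.log 4 ≤ 2 :=
    (Real.log_le_log (by norm_num) (by norm_num)).trans hlog5
  have hbeta : ∀ t : Fin T, (M.beta lam δ (D.take t) / M.σ) ^ 2 ≤ B := by
    intro t
    have hlt' : Real.log ((max (t : ℕ) 1 : ℕ) ^ 2 / δ) ≤ lt := by
      have h1 : ((max (t : ℕ) 1 : ℕ) : ℝ) ≤ T := by exact_mod_cast max_le t.isLt.le hT
      have h0 : (0 : ℝ) < (max (t : ℕ) 1 : ℕ) := by
        exact_mod_cast lt_of_lt_of_le one_pos (le_max_right _ 1)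
      exact Real.log_le_log (by positivity) (by gcongr)
    have hld := M.log_det_ratio_le hlam t.isLt.le (D.take t)
    have hconf : M.confidence lam δ (D.take t) ≤ 2 * ds + 2 * lt + 2 + d * L := by
      rw [confidence]
      have : ds * Real.log 5 ≤ ds * 2 := by gcongr
      linarith
    have hconf0 : 0 ≤ M.confidence lam δ (D.take t) := by
      rw [confidence]
      have h5 : 0 ≤ Real.log 5 := Real.log_nonneg (by norm_num)
      have h4 : 0 ≤ Real.log 4 := Real.log_nonneg (by norm_num)
      have h1 := log_max_sq_div_nonneg t hδ hδ1
      have h2 := M.log_det_ratio_nonneg hlam (D.take t)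
      positivity
    rw [div_pow, div_le_iff₀ (by positivity), beta_eq, Real.sq_sqrt (by positivity)]
    calc 2 * lam * spectralNorm₂ M.W ^ 2 + 8 * M.σ ^ 2 * M.confidence lam δ (D.take t)
        ≤ 2 * M.σ ^ 2 + 8 * M.σ ^ 2 * (2 * ds + 2 * lt + 2 + d * L) := by
          have : 8 * M.σ ^ 2 * M.confidence lam δ (D.take t)
            ≤ 8 * M.σ ^ 2 * (2 * ds + 2 * lt + 2 + d * L) := by gcongr
          linarith
      _ = (18 + 16 * ds + 16 * lt + 8 * (d * L)) * M.σ ^ 2 := by ring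
      _ ≤ B * M.σ ^ 2 := by gcongr; rw [hB]; linarith
  have hterm : ∀ (t : Fin T) (h : Fin H), min (M.uncertainty lam δ (D.take t) (D t h).1 ^ 2) 1
      ≤ 2 * B * Real.log (1 + invQuad (M.covariance lam (D.take t)) (M.feature (D t h))) := by
    intro t h
    have hq := invQuad_nonneg (M.posDef_covariance hlam (D.take t)) (M.feature (D t h))
    set q := invQuad (M.covariance lam (D.take t)) (M.feature (D t h)) with hqdef
    have h1 : M.uncertainty lam δ (D.take t) (D t h).1 ^ 2
        = (M.beta lam δ (D.take t) / M.σ) ^ 2 * q := by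
      rw [uncertainty_eq, mul_pow]
      exact congrArg _ (Real.sq_sqrt hq)
    rw [h1]
    calc min ((M.beta lam δ (D.take t) / M.σ) ^ 2 * q) 1 ≤ min (B * q) (B * 1) :=
          min_le_min (mul_le_mul_of_nonneg_right (hbeta t) hq) (by linarith)
      _ = B * min q 1 := (mul_min_of_nonneg _ _ (by linarith)).symm
      _ ≤ B * (2 * Real.log (1 + q)) := by
          gcongr
          exact min_one_le_two_mul_log hq
      _ = _ := by ring
  have hpot := M.sum_log_one_add_invQuad_le hlam D
  have hld := M.log_det_ratio_le hlam le_rfl D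
  calc _ ≤ ∑ t : Fin T, ∑ h : Fin H, 2 * B * Real.log
          (1 + invQuad (M.covariance lam (D.take t)) (M.feature (D t h))) :=
        Finset.sum_le_sum fun t _ => Finset.sum_le_sum fun h _ => hterm t h
    _ = 2 * B * ∑ t : Fin T, ∑ h : Fin H, Real.log
          (1 + invQuad (M.covariance lam (D.take t)) (M.feature (D t h))) := by
        simp only [Finset.mul_sum]
    _ ≤ 2 * B * (H * (d * L)) := by
        gcongr
        exact hpot.trans (by gcongr)
    _ = _ := by rw [hB]; ring

lemma isMarkovKernel_of_forall_policy {E : Type*} [MeasurableSpace E]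
    {Pol : Set (Kernel (State ds) A)} (hPol : ∀ π ∈ Pol, IsMarkovKernel π)
    {alg : Algorithm E (State ds) A H} (hmem : ∀ t e D, alg.policy t e D ∈ Pol) (t : ℕ) :
    IsMarkovKernel (alg t) := by
  refine ⟨fun x => ?_⟩
  have h := (hPol _ (hmem t x.1.1 x.1.2)).isProbabilityMeasure x.2
  rwa [Algorithm.policy, Kernel.sectR_apply] at h

theorem infoGain_le (hds : 0 < ds) {E : Type*} [MeasurableSpace E] (ν : Measure E)
    [IsProbabilityMeasure ν] {Pol : Set (Kernel (State ds) A)}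
    (hPol : ∀ π ∈ Pol, IsMarkovKernel π) {lam δ : ℝ} (hlam : 0 < lam)
    (hW : lam * spectralNorm₂ M.W ^ 2 ≤ M.σ ^ 2) (hδ : 0 < δ) (hδ1 : δ ≤ 1) (T : ℕ) :
    M.infoGain ν Pol H lam δ T ≤ ENNReal.ofReal
      (68 * (H * (ds + Real.log (T ^ 2 / δ) + d * Real.log (1 + T * H / lam))
          * (d * Real.log (1 + T * H / lam)))) := by
  unfold infoGain
  refine iSup_le fun alg => iSup_le fun hmem => ?_
  have hM : ∀ t, IsMarkovKernel (alg t) := isMarkovKernel_of_forall_policy hPol hmem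
  have hprob := isProbabilityMeasure_interactionLaw ν alg M.env M.s₀ T
  calc _ ≤ ∫⁻ _, ENNReal.ofReal
        (68 * (H * (ds + Real.log (T ^ 2 / δ) + d * Real.log (1 + T * H / lam))
          * (d * Real.log (1 + T * H / lam)))) ∂(interactionLaw ν alg M.env M.s₀ T) :=
        lintegral_mono fun x => ENNReal.ofReal_le_ofReal
          (M.sum_min_sq_uncertainty_le hds hlam hW hδ hδ1 x.2)
    _ = _ := by rw [lintegral_const, measure_univ, mul_one]

end KNR

end ImitationKNR

namespace ImitationKNR

/-! ### Concentration of the expert states -/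

section Concentration

variable {S : Type*} [MeasurableSpace S]

lemma integral_exp_centered_le (ρ : Measure S) [IsProbabilityMeasure ρ] {f : S → ℝ}
    (hf : Measurable f) (h01 : ∀ s, f s ∈ Set.Icc (0 : ℝ) 1) (r : ℝ) :
    ∫ x, Real.exp (r * (∫ y, f y ∂ρ - f x)) ∂ρ ≤ Real.exp (r ^ 2 / 8) := by
  have h := (hasSubgaussianMGF_of_mem_Icc hf.aemeasurable (ae_of_all ρ h01)).mgf_le (-r)
  simp only [mgf] at h
  convert h using 1
  · refine integral_congr_ae (ae_of_all _ fun x => ?_)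
    simp only
    congr 1
    ring
  · congr 1
    norm_num
    ring

/-- Hoeffding's moment generating function bound for an empirical mean. -/
lemma integral_exp_empirical_le (ρ : Measure S) [IsProbabilityMeasure ρ] {f : S → ℝ}
    (hf : Measurable f) (h01 : ∀ s, f s ∈ Set.Icc (0 : ℝ) 1) {N : ℕ} (hN : 0 < N) (r : ℝ) :
    ∫ e : Fin N → S, Real.exp (r * (∫ y, f y ∂ρ - (∑ i, f (e i)) / N)) ∂(Measure.pi fun _ => ρ)
      ≤ Real.exp (r ^ 2 / (8 * N)) := by
  have hN' : (N : ℝ) ≠ 0 := by positivity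
  have h1 : ∀ e : Fin N → S, Real.exp (r * (∫ y, f y ∂ρ - (∑ i, f (e i)) / N))
      = ∏ i, Real.exp (r / N * (∫ y, f y ∂ρ - f (e i))) := by
    intro e
    rw [← Real.exp_sum, ← Finset.mul_sum, Finset.sum_sub_distrib]
    congr 1
    simp
    field_simp
  simp_rw [h1]
  rw [integral_fintype_prod_eq_prod (fun _ (x : S) => Real.exp (r / N * (∫ y, f y ∂ρ - f x)))]
  calc _ ≤ ∏ _i : Fin N, Real.exp ((r / N) ^ 2 / 8) :=
        Finset.prod_le_prod (fun i _ => integral_nonneg fun x => (Real.exp_pos _).le)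
          fun i _ => integral_exp_centered_le ρ hf h01 _
    _ = Real.exp (r ^ 2 / (8 * N)) := by
        rw [Finset.prod_const, ← Real.exp_nat_mul]
        congr 1
        simp
        field_simp

variable {F : Finset (S → ℝ)} {N : ℕ}

/-- The largest gap between a mean and an empirical mean over a finite class of functions. -/
noncomputable def maxDeviation (ρ : Measure S) (F : Finset (S → ℝ)) (e : Fin N → S) : ℝ :=
  ⨆ f : F, (∫ y, (f : S → ℝ) y ∂ρ - (∑ i, (f : S → ℝ) (e i)) / N)

lemma integral_mem_Icc (ρ : Measure S) [IsProbabilityMeasure ρ] {f : S → ℝ}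
    (hf : Measurable f) (h01 : ∀ s, f s ∈ Set.Icc (0 : ℝ) 1) :
    ∫ y, f y ∂ρ ∈ Set.Icc (0 : ℝ) 1 := by
  have hi : Integrable f ρ := integrable_of_forall_abs_le hf (K := 1) fun s =>
    abs_le.2 ⟨by linarith [(h01 s).1], (h01 s).2⟩
  refine ⟨integral_nonneg fun s => (h01 s).1, ?_⟩
  have := integral_mono hi (integrable_const (1 : ℝ)) fun s => (h01 s).2
  simpa using this

omit [MeasurableSpace S] in
lemma empirical_mem_Icc {f : S → ℝ} (h01 : ∀ s, f s ∈ Set.Icc (0 : ℝ) 1) (hN : 0 < N)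
    (e : Fin N → S) : (∑ i, f (e i)) / N ∈ Set.Icc (0 : ℝ) 1 := by
  have hN' : (0 : ℝ) < N := by exact_mod_cast hN
  refine ⟨div_nonneg (Finset.sum_nonneg fun i _ => (h01 _).1) hN'.le, (div_le_one hN').2 ?_⟩
  have := Finset.sum_le_sum fun i (_ : i ∈ (Finset.univ : Finset (Fin N))) => (h01 (e i)).2
  simpa using this

lemma abs_deviation_le (ρ : Measure S) [IsProbabilityMeasure ρ] {f : S → ℝ}
    (hf : Measurable f) (h01 : ∀ s, f s ∈ Set.Icc (0 : ℝ) 1) (hN : 0 < N) (e : Fin N → S) :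
    |∫ y, f y ∂ρ - (∑ i, f (e i)) / N| ≤ 1 := by
  have h1 := integral_mem_Icc ρ hf h01
  have h2 := empirical_mem_Icc h01 hN e
  rw [abs_le]
  constructor <;> linarith [h1.1, h1.2, h2.1, h2.2]

lemma measurable_deviation (ρ : Measure S) {f : S → ℝ} (hf : Measurable f) :
    Measurable fun e : Fin N → S => ∫ y, f y ∂ρ - (∑ i, f (e i)) / N :=
  ((Finset.measurable_sum _ fun i _ => hf.comp (measurable_pi_apply i)).div_const _).const_sub _

lemma measurable_maxDeviation (ρ : Measure S) (hF : ∀ f ∈ F, Measurable f) :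
    Measurable (maxDeviation ρ F : (Fin N → S) → ℝ) :=
  Measurable.iSup fun f => measurable_deviation ρ (hF f f.2)

lemma le_maxDeviation (ρ : Measure S) {f : S → ℝ} (hf : f ∈ F) (e : Fin N → S) :
    ∫ y, f y ∂ρ - (∑ i, f (e i)) / N ≤ maxDeviation ρ F e :=
  le_ciSup (f := fun f : F => ∫ y, (f : S → ℝ) y ∂ρ - (∑ i, (f : S → ℝ) (e i)) / N)
    (Set.finite_range _).bddAbove ⟨f, hf⟩

lemma abs_maxDeviation_le (ρ : Measure S) [IsProbabilityMeasure ρ] (hne : F.Nonempty)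
    (hF : ∀ f ∈ F, Measurable f ∧ ∀ s, f s ∈ Set.Icc (0 : ℝ) 1) (hN : 0 < N) (e : Fin N → S) :
    |maxDeviation ρ F e| ≤ 1 := by
  obtain ⟨f, hf⟩ := hne
  have : Nonempty F := ⟨⟨f, hf⟩⟩
  refine abs_le.2 ⟨?_, ciSup_le fun g =>
    (abs_le.1 (abs_deviation_le ρ (hF g g.2).1 (hF g g.2).2 hN e)).2⟩
  exact (abs_le.1 (abs_deviation_le ρ (hF f hf).1 (hF f hf).2 hN e)).1.trans
    (le_maxDeviation ρ hf e)

/-- The maximal inequality for bounded functions; for a single function the bound is `0`. -/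
lemma integral_maxDeviation_le (ρ : Measure S) [IsProbabilityMeasure ρ] (hne : F.Nonempty)
    (hF : ∀ f ∈ F, Measurable f ∧ ∀ s, f s ∈ Set.Icc (0 : ℝ) 1) (hN : 0 < N) :
    ∫ e : Fin N → S, maxDeviation ρ F e ∂(Measure.pi fun _ => ρ) ≤ √(Real.log F.card / N) := by
  set μ : Measure (Fin N → S) := Measure.pi fun _ => ρ
  set X := ∫ e, maxDeviation ρ F e ∂μ with hX
  have hN' : (0 : ℝ) < N := by exact_mod_cast hN
  have hcard : (0 : ℝ) < F.card := by exact_mod_cast hne.card_pos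
  have : Nonempty F := ⟨⟨_, hne.choose_spec⟩⟩
  rcases le_or_gt X 0 with h0 | h0
  · exact h0.trans (Real.sqrt_nonneg _)
  have hXint : Integrable (maxDeviation ρ F) μ := integrable_of_forall_abs_le
    (measurable_maxDeviation ρ fun f hf => (hF f hf).1) (abs_maxDeviation_le ρ hne hF hN)
  have hkey : ∀ r : ℝ, 0 < r → r * X ≤ Real.log F.card + r ^ 2 / (8 * N) := by
    intro r hr
    set K := Real.log F.card + r ^ 2 / (8 * N) with hK
    have hint : ∀ f ∈ F, Integrable (fun e : Fin N → S =>
        Real.exp (r * (∫ y, f y ∂ρ - (∑ i, f (e i)) / N))) μ := fun f hf =>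
      integrable_of_forall_abs_le ((measurable_deviation ρ (hF f hf).1).const_mul r).exp
        (K := Real.exp (r * 1)) fun e => by
          rw [abs_of_pos (Real.exp_pos _)]
          refine Real.exp_le_exp.2 (mul_le_mul_of_nonneg_left ?_ hr.le)
          exact (abs_le.1 (abs_deviation_le ρ (hF f hf).1 (hF f hf).2 hN e)).2
    have hpt : ∀ e : Fin N → S, 1 + (r * maxDeviation ρ F e - K)
        ≤ Real.exp (-K) * ∑ f ∈ F, Real.exp (r * (∫ y, f y ∂ρ - (∑ i, f (e i)) / N)) := by
      intro e
      obtain ⟨g, hg⟩ := exists_eq_ciSup_of_finite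
        (f := fun f : F => ∫ y, (f : S → ℝ) y ∂ρ - (∑ i, (f : S → ℝ) (e i)) / N)
      have h1 : Real.exp (r * maxDeviation ρ F e)
          ≤ ∑ f ∈ F, Real.exp (r * (∫ y, f y ∂ρ - (∑ i, f (e i)) / N)) := by
        rw [maxDeviation, ← hg]
        exact Finset.single_le_sum (f := fun f : S → ℝ =>
          Real.exp (r * (∫ y, f y ∂ρ - (∑ i, f (e i)) / N)))
          (fun f _ => (Real.exp_pos _).le) g.2
      have h2 := Real.add_one_le_exp (r * maxDeviation ρ F e - K)
      rw [sub_eq_neg_add, Real.exp_add] at h2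
      have := mul_le_mul_of_nonneg_left h1 (Real.exp_pos (-K)).le
      linarith
    have h3 := integral_mono (μ := μ)
      ((integrable_const (1 : ℝ)).add ((hXint.const_mul r).sub (integrable_const K)))
      ((integrable_finsetSum F hint).const_mul (Real.exp (-K))) hpt
    have h4 : ∫ e, (1 + (r * maxDeviation ρ F e - K)) ∂μ = 1 + (r * X - K) := by
      have e1 := integral_add (μ := μ) (integrable_const (1 : ℝ))
        ((hXint.const_mul r).sub (integrable_const K))
      have e2 := integral_sub (μ := μ) (hXint.const_mul r) (integrable_const K)
      simp only [Pi.sub_apply] at e1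
      rw [e1, e2, integral_const_mul]
      simp [hX]
    have h5 : ∫ e, Real.exp (-K) * ∑ f ∈ F,
        Real.exp (r * (∫ y, f y ∂ρ - (∑ i, f (e i)) / N)) ∂μ ≤ 1 := by
      rw [integral_const_mul, integral_finsetSum _ hint]
      calc _ ≤ Real.exp (-K) * ∑ _f ∈ F, Real.exp (r ^ 2 / (8 * N)) := by
            gcongr with f hf
            exact integral_exp_empirical_le ρ (hF f hf).1 (hF f hf).2 hN r
        _ = 1 := by
            rw [Finset.sum_const, nsmul_eq_mul, hK, neg_add, Real.exp_add, Real.exp_neg,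
              Real.exp_neg, Real.exp_log hcard]
            field_simp
    have h6 : 1 + (r * X - K) ≤ 1 := h4 ▸ h3.trans h5
    linarith
  -- this `r` minimizes the bound up to a constant factor, and is positive even if `log 1 = 0`
  have h := hkey (4 * N * X) (by positivity)
  have h1 : (4 * N * X) ^ 2 / (8 * N) = 2 * N * X ^ 2 := by field_simp; ring
  rw [h1] at h
  refine Real.le_sqrt_of_sq_le ?_
  rw [le_div_iff₀ hN']
  nlinarith [sq_nonneg X]

lemma integral_empirical (ρ : Measure S) [IsProbabilityMeasure ρ] {f : S → ℝ}
    (hf : Measurable f) (h01 : ∀ s, f s ∈ Set.Icc (0 : ℝ) 1) (hN : 0 < N) :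
    ∫ e : Fin N → S, (∑ i, f (e i)) / (N : ℝ) ∂(Measure.pi fun _ => ρ) = ∫ s, f s ∂ρ := by
  have hN' : (N : ℝ) ≠ 0 := by positivity
  have hi : ∀ i : Fin N, ∫ e : Fin N → S, f (e i) ∂(Measure.pi fun _ => ρ) = ∫ s, f s ∂ρ :=
    fun i => integral_comp_eval (μ := fun _ : Fin N => ρ) (i := i) hf.aestronglyMeasurable
  rw [integral_div, integral_finsetSum (f := fun i (e : Fin N → S) => f (e i)) _
    fun i _ => integrable_of_forall_abs_le (hf.comp (measurable_pi_apply i)) (K := 1)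
      fun e => abs_le.2 ⟨by linarith [(h01 (e i)).1], (h01 (e i)).2⟩]
  simp only [hi, Finset.sum_const, Finset.card_univ, Fintype.card_fin, nsmul_eq_mul]
  field_simp

end Concentration

end ImitationKNR

namespace ImitationKNR

/-! ### Optimism and the regret of imitation -/

section Occupancy

variable {S A : Type*} [MeasurableSpace S] [MeasurableSpace A]

/-- The expected total of a state-action cost along an episode. -/
noncomputable def totalCost (π : Kernel S A) (P : Kernel (S × A) S) (s₀ : S) (H : ℕ)
    (g : S × A → ℝ) : ℝ :=
  ∫ τ, ∑ h, g (τ h).1 ∂(rollout π P s₀ H)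

variable (π : Kernel S A) (P : Kernel (S × A) S) [IsMarkovKernel π] [IsMarkovKernel P] (s₀ : S)
  {H : ℕ}

lemma measurable_sum_cost {g : S × A → ℝ} (hg : Measurable g) (H : ℕ) :
    Measurable fun τ : Episode S A H => ∑ h, g (τ h).1 :=
  Finset.measurable_sum _ fun i _ => hg.comp (measurable_pi_apply i).fst

lemma integrable_sum_cost {g : S × A → ℝ} (hg : Measurable g) {K : ℝ} (hK : ∀ z, |g z| ≤ K) :
    Integrable (fun τ => ∑ h, g (τ h).1) (rollout π P s₀ H) :=
  integrable_of_forall_abs_le (measurable_sum_cost hg H) (abs_sum_cost_le hK)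

lemma isProbabilityMeasure_occupancy (hH : 0 < H) :
    IsProbabilityMeasure (occupancy π P s₀ H) := by
  refine ⟨?_⟩
  have h : ∀ h : Fin H, (rollout π P s₀ H).map (fun τ => (τ h).1) Set.univ = 1 := fun h => by
    rw [Measure.map_apply (measurable_pi_apply h).fst .univ]
    simp
  rw [occupancy, Measure.smul_apply, Measure.finsetSum_apply]
  simp only [h, Finset.sum_const, Finset.card_univ, Fintype.card_fin, smul_eq_mul, nsmul_eq_mul,
    mul_one]
  exact ENNReal.inv_mul_cancel (by exact_mod_cast hH.ne') (ENNReal.natCast_ne_top H)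

lemma integral_occupancy {g : S × A → ℝ} (hg : Measurable g) {K : ℝ}
    (hK : ∀ z, |g z| ≤ K) :
    ∫ z, g z ∂(occupancy π P s₀ H) = totalCost π P s₀ H g / H := by
  have hm : ∀ h : Fin H, Measurable fun τ : Episode S A H => (τ h).1 := fun h =>
    (measurable_pi_apply h).fst
  have hp : ∀ h : Fin H, IsProbabilityMeasure ((rollout π P s₀ H).map fun τ => (τ h).1) :=
    fun h => Measure.isProbabilityMeasure_map (hm h).aemeasurable
  rw [occupancy, integral_smul_measure, integral_finsetSum_measure
    fun h _ => integrable_of_forall_abs_le hg hK, totalCost,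
    integral_finsetSum (f := fun h (τ : Episode S A H) => g (τ h).1) _ fun h _ =>
      integrable_of_forall_abs_le (hg.comp (hm h)) fun τ => hK _]
  simp_rw [integral_map (hm _).aemeasurable hg.aestronglyMeasurable]
  simp [div_eq_inv_mul]

lemma totalCost_sub {f g : S × A → ℝ} (hf : Measurable f) (hg : Measurable g) {K K' : ℝ}
    (hK : ∀ z, |f z| ≤ K) (hK' : ∀ z, |g z| ≤ K') (r : ℝ) :
    totalCost π P s₀ H (fun z => f z - r * g z)
      = totalCost π P s₀ H f - r * totalCost π P s₀ H g := by
  simp only [totalCost, Finset.sum_sub_distrib, ← Finset.mul_sum]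
  rw [integral_sub (integrable_sum_cost π P s₀ hf hK)
    ((integrable_sum_cost π P s₀ hg hK').const_mul r), integral_const_mul]

omit [IsMarkovKernel π] [IsMarkovKernel P] in
lemma value_eq_totalCost (f : S → ℝ) :
    value π P s₀ H f = totalCost π P s₀ H (fun z => f z.1) := rfl

lemma value_mem_Icc {f : S → ℝ} (h01 : ∀ s, f s ∈ Set.Icc (0 : ℝ) 1) :
    value π P s₀ H f ∈ Set.Icc (0 : ℝ) H := by
  refine ⟨integral_nonneg fun _ => Finset.sum_nonneg fun _ _ => (h01 _).1, ?_⟩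
  have hb := abs_integral_le_of_forall_abs_le (μ := rollout π P s₀ H)
    (f := fun τ => ∑ h : Fin H, f (τ h).1.1) (K := H * 1)
    fun τ => abs_sum_cost_le (g := fun z : S × A => f z.1) (fun z => abs_le.2
      ⟨by linarith [(h01 z.1).1], (h01 z.1).2⟩) τ
  rw [mul_one] at hb
  exact (abs_le.1 hb).2

end Occupancy

namespace KNR

open Matrix

variable {ds d H : ℕ} {A : Type*} [MeasurableSpace A] (M : KNR ds d A)

lemma measurable_uncertainty (lam δ : ℝ) (t : ℕ) :
    Measurable fun p : History (State ds) A H t × (State ds × A) =>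
      M.uncertainty lam δ p.1 p.2 := by
  have h1 : ∀ i j, Measurable fun p : History (State ds) A H t × (State ds × A) =>
      M.covariance lam p.1 i j := fun i j =>
    (M.measurable_covariance_apply lam t i j).comp measurable_fst
  have h2 : Measurable fun p : History (State ds) A H t × (State ds × A) => (M.φ p.2).ofLp :=
    (WithLp.measurable_ofLp 2 _).comp (M.measurable_φ.comp measurable_snd)
  have h3 := measurable_matrix_det h1
  simp only [uncertainty_eq, beta_eq, confidence]
  have h4 := measurable_invQuad h1 h2
  fun_prop

lemma measurable_bonus (lam δ : ℝ) (t : ℕ) :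
    Measurable fun p : History (State ds) A H t × (State ds × A) => M.bonus lam δ p.1 p.2 :=
  ((M.measurable_uncertainty lam δ t).min measurable_const).const_mul _

lemma measurable_bonus_apply (lam δ : ℝ) {t : ℕ} (D : History (State ds) A H t) :
    Measurable (M.bonus lam δ D) := by
  have h := (M.measurable_bonus (H := H) lam δ t).comp (measurable_prodMk_left (x := D))
  exact h

lemma bonus_nonneg (lam δ : ℝ) {t : ℕ} (D : History (State ds) A H t) (z : State ds × A) :
    0 ≤ M.bonus lam δ D z :=
  mul_nonneg (Nat.cast_nonneg H) (le_min (M.uncertainty_nonneg lam δ D z) zero_le_two)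

lemma bonus_le (lam δ : ℝ) {t : ℕ} (D : History (State ds) A H t) (z : State ds × A) :
    M.bonus lam δ D z ≤ 2 * H := by
  rw [bonus, mul_comm]
  exact mul_le_mul_of_nonneg_right (min_le_right _ _) (Nat.cast_nonneg H)

lemma abs_bonus_le (lam δ : ℝ) {t : ℕ} (D : History (State ds) A H t) (z : State ds × A) :
    |M.bonus lam δ D z| ≤ 2 * H := by
  rw [abs_of_nonneg (M.bonus_nonneg lam δ D z)]
  exact M.bonus_le lam δ D z

lemma abs_sub_bonus_le (hH : 0 < H) (lam δ : ℝ) {t : ℕ} (D : History (State ds) A H t)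
    {f : State ds → ℝ} (h01 : ∀ s, f s ∈ Set.Icc (0 : ℝ) 1) (z : State ds × A) :
    |f z.1 - M.bonus lam δ D z| ≤ 2 * H := by
  have h1 : (1 : ℝ) ≤ H := by exact_mod_cast hH
  have h2 := M.bonus_nonneg lam δ D z
  have h3 := M.bonus_le lam δ D z
  rw [abs_le]
  constructor <;> linarith [(h01 z.1).1, (h01 z.1).2]

/-- The event that the model `V₀` is calibrated after the episodes `D`. -/
def IsCalibrated (lam δ : ℝ) {t : ℕ} (D : History (State ds) A H t)
    (V₀ : Matrix (Fin ds) (Fin d) ℝ) : Prop :=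
  ∀ z, l1Dist (M.model V₀ z) (M.env z) ≤ min (M.uncertainty lam δ D z) 2

section

variable {lam δ : ℝ} {t : ℕ} {D : History (State ds) A H t} {V₀ : Matrix (Fin ds) (Fin d) ℝ}
  {f : State ds → ℝ} (π : Kernel (State ds) A) [IsMarkovKernel π]

lemma abs_integral_model_sub_le (hcal : M.IsCalibrated lam δ D V₀) {u : State ds → ℝ}
    (hu : Measurable u) {K : ℝ} (hK0 : 0 ≤ K) (hK : ∀ s, |u s| ≤ K) (z : State ds × A) :
    |∫ s, u s ∂(M.model V₀ z) - ∫ s, u s ∂(M.env z)|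
      ≤ K * min (M.uncertainty lam δ D z) 2 :=
  (abs_integral_sub_integral_le_l1Dist _ _ hu hK).trans (mul_le_mul_of_nonneg_left (hcal z) hK0)

/-- Optimism: subtracting the bonus, the model never overestimates the true cost of a policy. -/
lemma totalCost_model_sub_bonus_le (hcal : M.IsCalibrated lam δ D V₀) (hf : Measurable f)
    (h01 : ∀ s, f s ∈ Set.Icc (0 : ℝ) 1) (hH : 0 < H) :
    totalCost π (M.model V₀) M.s₀ H (fun z => f z.1 - M.bonus lam δ D z)
      ≤ value π M.env M.s₀ H f := by
  have hf1 : ∀ z : State ds × A, |f z.1| ≤ 1 := fun z =>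
    abs_le.2 ⟨by linarith [(h01 z.1).1], (h01 z.1).2⟩
  have hfm : Measurable fun z : State ds × A => f z.1 := hf.comp measurable_fst
  refine integral_sum_cost_le π M.env M.s₀ (M.model V₀) (g := fun z => f z.1)
    hfm (hfm.sub (M.measurable_bonus_apply lam δ D))
    hf1 (M.abs_sub_bonus_le hH lam δ D h01) fun n hn z => ?_
  have hn' : (n : ℝ) ≤ H := by exact_mod_cast hn.le
  have h := M.abs_integral_model_sub_le hcal
    (measurable_costToGo π M.env hfm n) (K := H) (Nat.cast_nonneg H)
    (fun s => (abs_costToGo_le π M.env hf1 n s).trans (by simpa using hn')) z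
  have h2 := (abs_le.1 h).2
  change f z.1 - H * min (M.uncertainty lam δ D z) 2 + _ ≤ f z.1 + _
  linarith

/-- The model underestimates the true cost of a policy by at most a multiple of the expected
bonus along the episodes of the policy in the true environment. -/
lemma value_le_totalCost_model_add (hcal : M.IsCalibrated lam δ D V₀) (hf : Measurable f)
    (h01 : ∀ s, f s ∈ Set.Icc (0 : ℝ) 1) (hH : 0 < H) :
    value π M.env M.s₀ H f
      ≤ totalCost π (M.model V₀) M.s₀ H (fun z => f z.1 - M.bonus lam δ D z)
        + (1 + 2 * H) * totalCost π M.env M.s₀ H (M.bonus lam δ D) := by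
  have hf1 : ∀ z : State ds × A, |f z.1| ≤ 1 := fun z =>
    abs_le.2 ⟨by linarith [(h01 z.1).1], (h01 z.1).2⟩
  have hfm : Measurable fun z : State ds × A => f z.1 := hf.comp measurable_fst
  have hbm := M.measurable_bonus_apply lam δ D
  have hfb : Measurable fun z => f z.1 - M.bonus lam δ D z := hfm.sub hbm
  have hH0 : (0 : ℝ) ≤ H := Nat.cast_nonneg H
  have key : totalCost π M.env M.s₀ H (fun z => f z.1 - (1 + 2 * H) * M.bonus lam δ D z)
      ≤ totalCost π (M.model V₀) M.s₀ H (fun z => f z.1 - M.bonus lam δ D z) := by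
    refine integral_sum_cost_le π (M.model V₀) M.s₀ M.env hfb
      (hfm.sub (hbm.const_mul _)) (M.abs_sub_bonus_le hH lam δ D h01)
      (K' := 1 + (1 + 2 * H) * (2 * H)) (fun z => ?_) fun n hn z => ?_
    · refine (abs_sub _ _).trans (add_le_add (hf1 z) ?_)
      rw [abs_mul, abs_of_nonneg (by positivity)]
      exact mul_le_mul_of_nonneg_left (M.abs_bonus_le lam δ D z) (by positivity)
    · have hn' : (n : ℝ) ≤ H := by exact_mod_cast hn.le
      have h := M.abs_integral_model_sub_le hcal
        (measurable_costToGo π (M.model V₀) hfb n) (K := H * (2 * H)) (by positivity)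
        (fun s => (abs_costToGo_le π (M.model V₀) (M.abs_sub_bonus_le hH lam δ D h01) n s).trans
          (by gcongr)) z
      have h2 := (abs_le.1 h).1
      have h3 : H * (2 * H) * min (M.uncertainty lam δ D z) 2 = 2 * H * M.bonus lam δ D z := by
        rw [bonus]; ring
      rw [h3] at h2
      change f z.1 - (1 + 2 * H) * M.bonus lam δ D z + _ ≤ f z.1 - M.bonus lam δ D z + _
      linarith
  rw [totalCost_sub π M.env M.s₀ hfm hbm hf1 (M.abs_bonus_le lam δ D)] at key
  rw [value_eq_totalCost]
  linarith

variable {F : Finset (State ds → ℝ)} {N : ℕ} {πe : Kernel (State ds) A} [IsMarkovKernel πe]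

/-- The state marginal of the expert's average state-action distribution. -/
noncomputable def expertStateLaw (πe : Kernel (State ds) A) (H : ℕ) : Measure (State ds) :=
  (occupancy πe M.env M.s₀ H).map Prod.fst

lemma isProbabilityMeasure_expertStateLaw (hH : 0 < H) :
    IsProbabilityMeasure (M.expertStateLaw πe H) := by
  have := isProbabilityMeasure_occupancy πe M.env M.s₀ hH
  exact Measure.isProbabilityMeasure_map measurable_fst.aemeasurable

lemma integral_expertStateLaw (hf : Measurable f)
    (h01 : ∀ s, f s ∈ Set.Icc (0 : ℝ) 1) :
    ∫ s, f s ∂(M.expertStateLaw πe H) = value πe M.env M.s₀ H f / H := by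
  rw [expertStateLaw, integral_map measurable_fst.aemeasurable hf.aestronglyMeasurable]
  exact integral_occupancy πe M.env M.s₀ (g := fun z => f z.1) (hf.comp measurable_fst)
    (K := 1) fun z => abs_le.2 ⟨by linarith [(h01 z.1).1], (h01 z.1).2⟩

lemma imitationLoss_expert_le (hcal : M.IsCalibrated lam δ D V₀) (hne : F.Nonempty)
    (hF : ∀ f ∈ F, Measurable f ∧ ∀ s, f s ∈ Set.Icc (0 : ℝ) 1) (hH : 0 < H)
    (e : Fin N → State ds) :
    M.imitationLoss F H (M.model V₀) (M.bonus lam δ D) e πe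
      ≤ maxDeviation (M.expertStateLaw πe H) F e := by
  have : Nonempty F := ⟨⟨_, hne.choose_spec⟩⟩
  have hH' : (0 : ℝ) < H := by exact_mod_cast hH
  refine ciSup_mono (Set.finite_range _).bddAbove fun f => sub_le_sub_right ?_ _
  have hf := (hF f f.2).1
  have h01 := (hF f f.2).2
  rw [M.integral_expertStateLaw hf h01, integral_occupancy πe (M.model V₀) M.s₀
    (g := fun z => (f : State ds → ℝ) z.1 - M.bonus lam δ D z)
    ((hf.comp measurable_fst).sub (M.measurable_bonus_apply lam δ D))
    (M.abs_sub_bonus_le hH lam δ D h01)]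
  gcongr
  exact M.totalCost_model_sub_bonus_le πe hcal hf h01 hH

/-- The suboptimality of a policy whose imitation loss is at most that of the expert. -/
lemma value_sub_value_expert_le (hcal : M.IsCalibrated lam δ D V₀)
    (hF : ∀ f ∈ F, Measurable f ∧ ∀ s, f s ∈ Set.Icc (0 : ℝ) 1) (hf : f ∈ F) (hH : 0 < H)
    (e : Fin N → State ds)
    (hmin : M.imitationLoss F H (M.model V₀) (M.bonus lam δ D) e π
      ≤ M.imitationLoss F H (M.model V₀) (M.bonus lam δ D) e πe) :
    value π M.env M.s₀ H f - value πe M.env M.s₀ H f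
      ≤ H * (maxDeviation (M.expertStateLaw πe H) F e
          + ((∑ i, f (e i)) / N - ∫ s, f s ∂(M.expertStateLaw πe H)))
        + (1 + 2 * H) * totalCost π M.env M.s₀ H (M.bonus lam δ D) := by
  have hH' : (0 : ℝ) < H := by exact_mod_cast hH
  have hfm := (hF f hf).1
  have h01 := (hF f hf).2
  have h1 := M.imitationLoss_expert_le (πe := πe) hcal ⟨f, hf⟩ hF hH e
  have h2 : ∫ z, (f z.1 - M.bonus lam δ D z) ∂(occupancy π (M.model V₀) M.s₀ H)
      - (∑ i, f (e i)) / N ≤ M.imitationLoss F H (M.model V₀) (M.bonus lam δ D) e π :=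
    le_ciSup (f := fun f : F => ∫ z, ((f : State ds → ℝ) z.1 - M.bonus lam δ D z)
      ∂(occupancy π (M.model V₀) M.s₀ H) - (∑ i, (f : State ds → ℝ) (e i)) / N)
      (Set.finite_range _).bddAbove ⟨f, hf⟩
  rw [integral_occupancy π (M.model V₀) M.s₀ (g := fun z => f z.1 - M.bonus lam δ D z)
    ((hfm.comp measurable_fst).sub (M.measurable_bonus_apply lam δ D))
    (M.abs_sub_bonus_le hH lam δ D h01)] at h2
  have h3 := M.value_le_totalCost_model_add π hcal hfm h01 hH
  have h4 := M.integral_expertStateLaw (H := H) (πe := πe) hfm h01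
  set Q := totalCost π (M.model V₀) M.s₀ H (fun z => f z.1 - M.bonus lam δ D z)
  set X := maxDeviation (M.expertStateLaw πe H) F e
  have h5 : Q / H ≤ X + (∑ i, f (e i)) / N := by linarith
  have h6 : Q ≤ H * (X + (∑ i, f (e i)) / N) := by
    rw [div_le_iff₀ hH'] at h5; linarith
  have h7 : H * ∫ s, f s ∂(M.expertStateLaw πe H) = value πe M.env M.s₀ H f := by
    rw [h4]; field_simp
  rw [mul_add, mul_sub, h7]
  linarith

end

end KNR

end ImitationKNR

namespace ImitationKNR

/-! ### The expected suboptimality -/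

section InteractionCost

variable {E S A : Type*} [MeasurableSpace E] [MeasurableSpace S] [MeasurableSpace A] {H : ℕ}
  (ν : Measure E) [IsProbabilityMeasure ν] (alg : Algorithm E S A H)
  [∀ t, IsMarkovKernel (alg t)] (P : Kernel (S × A) S) [IsMarkovKernel P] (s₀ : S)

instance (t : ℕ) (e : E) (D : History S A H t) : IsMarkovKernel (alg.policy t e D) := by
  unfold Algorithm.policy; infer_instance

lemma totalCost_policy (t : ℕ) (x : E × History S A H t) (g : S × A → ℝ) :
    totalCost (alg.policy t x.1 x.2) P s₀ H g
      = ∫ τ, ∑ h, g (τ h).1 ∂(rolloutKernel (alg t) P s₀ H x) := by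
  rw [rolloutKernel_eq_rollout]; rfl

lemma measurable_sum_cost_history {t : ℕ} {g : History S A H t × (S × A) → ℝ}
    (hg : Measurable g) :
    Measurable fun p : (E × History S A H t) × Episode S A H => ∑ h, g (p.1.2, (p.2 h).1) :=
  Finset.measurable_sum _ fun h _ => hg.comp
    (measurable_fst.snd.prodMk ((measurable_pi_apply h).comp measurable_snd).fst)

lemma measurable_sum_cost_interaction {T : ℕ} (t : Fin T) {g : History S A H t × (S × A) → ℝ}
    (hg : Measurable g) :
    Measurable fun x : E × History S A H T => ∑ h, g (x.2.take t, (x.2 t h).1) := by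
  refine Finset.measurable_sum _ fun h _ => ?_
  have h1 : Measurable fun x : E × History S A H T => x.2.take t :=
    (measurable_pastOf t.isLt.le).snd
  have h2 : Measurable fun x : E × History S A H T => (x.2 t h).1 :=
    ((measurable_pi_apply h).comp ((measurable_pi_apply t).comp measurable_snd)).fst
  exact hg.comp (h1.prodMk h2)

lemma measurable_totalCost_policy {t : ℕ} {g : History S A H t × (S × A) → ℝ}
    (hg : Measurable g) :
    Measurable fun x : E × History S A H t =>
      totalCost (alg.policy t x.1 x.2) P s₀ H (fun z => g (x.2, z)) := by
  simp only [totalCost_policy]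
  exact (measurable_sum_cost_history hg).stronglyMeasurable.integral_kernel_prod_right'.measurable

/-- The expected cost of the policy of iteration `t`, averaged over the past, is the expected cost
along the episode `t`. -/
lemma integral_totalCost_policy {T : ℕ} (t : Fin T) {g : History S A H t × (S × A) → ℝ}
    (hg : Measurable g) {K : ℝ} (hK : ∀ p, |g p| ≤ K) :
    ∫ x, totalCost (alg.policy t x.1 (x.2.take t)) P s₀ H (fun z => g (x.2.take t, z))
        ∂(interactionLaw ν alg P s₀ T)
      = ∫ x, ∑ h, g (x.2.take t, (x.2 t h).1) ∂(interactionLaw ν alg P s₀ T) := by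
  let G : E × History S A H (t + 1) → ℝ := fun y =>
    ∑ h, g ((fun k => y.2 k.castSucc), (y.2 (Fin.last t) h).1)
  have hG : Measurable G := Finset.measurable_sum _ fun h _ => hg.comp
    ((measurable_pi_lambda _ fun k => (measurable_pi_apply k.castSucc).comp measurable_snd).prodMk
      ((measurable_pi_apply h).comp ((measurable_pi_apply (Fin.last (t : ℕ))).comp
        measurable_snd)).fst)
  have hGK : ∀ y, |G y| ≤ H * K := fun y => by
    refine (Finset.abs_sum_le_sum_abs _ _).trans ?_
    refine (Finset.sum_le_sum fun i _ => hK _).trans ?_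
    simp
  have h1 := integral_map (μ := interactionLaw ν alg P s₀ T)
    (measurable_pastOf (E := E) (S := S) (A := A) (H := H) (Nat.succ_le_of_lt t.isLt)).aemeasurable
    hG.aestronglyMeasurable
  have h2 := integral_map (μ := interactionLaw ν alg P s₀ T)
    (measurable_pastOf (E := E) (S := S) (A := A) (H := H) t.isLt.le).aemeasurable
    (measurable_totalCost_policy alg P s₀ hg).aestronglyMeasurable
  rw [map_pastOf_interactionLaw] at h1 h2
  have h3 := integral_interactionLaw_succ ν alg P s₀ t hG hGK
  refine Eq.trans h2.symm (Eq.trans ?_ h1)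
  refine Eq.trans ?_ h3.symm
  refine integral_congr_ae (ae_of_all _ fun x => ?_)
  simp only [totalCost_policy, G]
  simp only [Fin.snoc_castSucc, Fin.snoc_last]

end InteractionCost

namespace KNR

open Matrix

variable {ds d H : ℕ} {A : Type*} [MeasurableSpace A] (M : KNR ds d A)

/-- The bonuses along any sequence of episodes, by the Cauchy-Schwarz inequality and the bound of
the information gain. -/
lemma sum_bonus_le (hds : 0 < ds) {lam δ : ℝ} (hlam : 0 < lam)
    (hW : lam * spectralNorm₂ M.W ^ 2 ≤ M.σ ^ 2) (hδ : 0 < δ) (hδ1 : δ ≤ 1) {T : ℕ}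
    (D : History (State ds) A H T) :
    ∑ t : Fin T, ∑ h : Fin H, M.bonus lam δ (D.take t) (D t h).1
      ≤ 2 * H * √(T * H * (68 * (H * (ds + Real.log (T ^ 2 / δ) + d * Real.log (1 + T * H / lam))
          * (d * Real.log (1 + T * H / lam))))) := by
  have hI := M.sum_min_sq_uncertainty_le hds hlam hW hδ hδ1 D
  set B := 68 * (H * (ds + Real.log (T ^ 2 / δ) + d * Real.log (1 + T * H / lam))
          * (d * Real.log (1 + T * H / lam)))
  let u : Fin T × Fin H → ℝ := fun p => min (M.uncertainty lam δ (D.take p.1) (D p.1 p.2).1) 1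
  have hu0 : ∀ p, 0 ≤ u p := fun p => le_min (M.uncertainty_nonneg _ _ _ _) zero_le_one
  have h1 : ∀ t h, M.bonus lam δ (D.take t) (D t h).1 ≤ 2 * H * u (t, h) := by
    intro t h
    rw [bonus, mul_comm (2 : ℝ), mul_assoc]
    refine mul_le_mul_of_nonneg_left ?_ (Nat.cast_nonneg H)
    have h0 := M.uncertainty_nonneg lam δ (D.take t) (D t h).1
    have h2 : (2 : ℝ) * u (t, h)
        = min (2 * M.uncertainty lam δ (D.take t) (D t h).1) (2 * 1) :=
      mul_min_of_nonneg _ _ (zero_le_two (α := ℝ))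
    rw [h2]
    exact min_le_min (by linarith) (by norm_num)
  have h2 : ∀ p, u p ^ 2 ≤ min (M.uncertainty lam δ (D.take p.1) (D p.1 p.2).1 ^ 2) 1 := fun p =>
    le_min (pow_le_pow_left₀ (hu0 p) (min_le_left _ _) 2)
      (pow_le_one₀ (hu0 p) (min_le_right _ _))
  have h3 : (∑ p, u p) ^ 2 ≤ T * H * B := by
    refine (sq_sum_le_card_mul_sum_sq (s := Finset.univ) (f := u)).trans ?_
    have hc : ((Finset.univ : Finset (Fin T × Fin H)).card : ℝ) = T * H := by simp
    rw [hc]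
    refine mul_le_mul_of_nonneg_left ?_ (by positivity)
    refine (Finset.sum_le_sum fun p _ => h2 p).trans ?_
    rw [Fintype.sum_prod_type]
    exact hI
  calc _ ≤ ∑ t : Fin T, ∑ h : Fin H, 2 * H * u (t, h) :=
        Finset.sum_le_sum fun t _ => Finset.sum_le_sum fun h _ => h1 t h
    _ = 2 * H * ∑ p, u p := by
        rw [Fintype.sum_prod_type]
        simp only [Finset.mul_sum]
    _ ≤ _ := by
        gcongr
        exact Real.le_sqrt_of_sq_le h3

variable {F : Finset (State ds → ℝ)} {Pol : Set (Kernel (State ds) A)} {πe : Kernel (State ds) A}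
  {c : State ds → ℝ} {N T : ℕ} {lam δ : ℝ}
  {West : (t : ℕ) → History (State ds) A H t → Matrix (Fin ds) (Fin d) ℝ}
  {alg : Algorithm (Fin N → State ds) (State ds) A H}

section

variable [∀ t, IsMarkovKernel (alg t)]

lemma value_policy_mem_Icc (h01 : ∀ s, c s ∈ Set.Icc (0 : ℝ) 1) (t : Fin T)
    (x : (Fin N → State ds) × History (State ds) A H T) :
    value (alg.policy t x.1 (x.2.take t)) M.env M.s₀ H c ∈ Set.Icc (0 : ℝ) H :=
  value_mem_Icc _ _ _ h01

lemma measurable_value_policy (hc : Measurable c) (t : Fin T) :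
    Measurable fun x : (Fin N → State ds) × History (State ds) A H T =>
      value (alg.policy t x.1 (x.2.take t)) M.env M.s₀ H c :=
  (measurable_totalCost_policy alg M.env M.s₀ (t := t) (g := fun p => c p.2.1)
    (hc.comp measurable_snd.fst)).comp (measurable_pastOf t.isLt.le)

lemma integrable_iInf_value (hT : 0 < T) (hc : Measurable c)
    (h01 : ∀ s, c s ∈ Set.Icc (0 : ℝ) 1)
    (μ : Measure ((Fin N → State ds) × History (State ds) A H T)) [IsFiniteMeasure μ] :
    Integrable (fun x => ⨅ t : Fin T, value (alg.policy t x.1 (x.2.take t)) M.env M.s₀ H c) μ := by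
  have : Nonempty (Fin T) := ⟨⟨0, hT⟩⟩
  refine integrable_of_forall_abs_le (Measurable.iInf fun t => M.measurable_value_policy hc t)
    (K := H) fun x => ?_
  have h0 : 0 ≤ ⨅ t : Fin T, value (alg.policy t x.1 (x.2.take t)) M.env M.s₀ H c :=
    le_ciInf fun t => (M.value_policy_mem_Icc h01 t x).1
  rw [abs_of_nonneg h0]
  exact (ciInf_le (Set.finite_range _).bddBelow ⟨0, hT⟩).trans (M.value_policy_mem_Icc h01 _ x).2

end

/-- The expected bonuses of the policies along their episodes are at most a bound that holds along
every sequence of episodes. -/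
lemma sum_integral_totalCost_bonus_le [∀ t, IsMarkovKernel (alg t)]
    (ν : Measure (Fin N → State ds)) [IsProbabilityMeasure ν] {B : ℝ}
    (hB : ∀ D : History (State ds) A H T,
      ∑ t : Fin T, ∑ h : Fin H, M.bonus lam δ (D.take t) (D t h).1 ≤ B) :
    ∑ t : Fin T, ∫ x, totalCost (alg.policy t x.1 (x.2.take t)) M.env M.s₀ H
        (M.bonus lam δ (x.2.take t)) ∂(interactionLaw ν alg M.env M.s₀ T) ≤ B := by
  have hprob := isProbabilityMeasure_interactionLaw ν alg M.env M.s₀ T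
  have hgm : ∀ t : ℕ, Measurable fun p : History (State ds) A H t × (State ds × A) =>
      M.bonus lam δ p.1 p.2 := fun t => M.measurable_bonus lam δ t
  have hbm : ∀ t : Fin T, Measurable fun x : (Fin N → State ds) × History (State ds) A H T =>
      ∑ h, M.bonus lam δ (x.2.take t) (x.2 t h).1 := fun t =>
    measurable_sum_cost_interaction t
      (g := fun p : History (State ds) A H t × (State ds × A) => M.bonus lam δ p.1 p.2) (hgm t)
  have hbi : ∀ t : Fin T, Integrable (fun x : (Fin N → State ds) × History (State ds) A H T =>
      ∑ h, M.bonus lam δ (x.2.take t) (x.2 t h).1) (interactionLaw ν alg M.env M.s₀ T) := fun t =>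
    integrable_of_forall_abs_le (hbm t) (K := H * (2 * H)) fun x =>
      abs_sum_cost_le (M.abs_bonus_le lam δ (x.2.take t)) (x.2 t)
  have h1 : ∀ t : Fin T, ∫ x, totalCost (alg.policy t x.1 (x.2.take t)) M.env M.s₀ H
      (M.bonus lam δ (x.2.take t)) ∂(interactionLaw ν alg M.env M.s₀ T)
      = ∫ x, ∑ h, M.bonus lam δ (x.2.take t) (x.2 t h).1
        ∂(interactionLaw ν alg M.env M.s₀ T) := fun t =>
    integral_totalCost_policy ν alg M.env M.s₀ t
      (g := fun p : History (State ds) A H t × (State ds × A) => M.bonus lam δ p.1 p.2)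
      (hgm t) fun p => M.abs_bonus_le lam δ p.1 p.2
  rw [Finset.sum_congr rfl fun t _ => h1 t, ← integral_finsetSum _ fun t _ => hbi t]
  have h2 := integral_mono (integrable_finsetSum _ fun t _ => hbi t) (integrable_const B)
    fun x => hB x.2
  simpa using h2

/-- The expected suboptimality, before the information gain is estimated. -/
lemma integral_iInf_value_sub_le_of_sum_bonus_le
    (hF : ∀ f ∈ F, Measurable f ∧ ∀ s, f s ∈ Set.Icc (0 : ℝ) 1) (hc : c ∈ F)
    (hPol : ∀ π ∈ Pol, IsMarkovKernel π) (hπe : πe ∈ Pol) (hH : 0 < H) (hN : 0 < N) (hT : 0 < T)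
    (hlam : 0 < lam) (hδ : 0 < δ) (hδ1 : δ ≤ 1) (hWest : M.IsRidgeRegression lam West)
    (halg : M.IsMobILE F Pol lam δ West alg) {B : ℝ}
    (hB : ∀ D : History (State ds) A H T,
      ∑ t : Fin T, ∑ h : Fin H, M.bonus lam δ (D.take t) (D t h).1 ≤ B) :
    ∫ x, ((⨅ t : Fin T, value (alg.policy t x.1 (x.2.take t)) M.env M.s₀ H c)
        - value πe M.env M.s₀ H c)
      ∂(interactionLaw (expertLaw πe M.env M.s₀ H N) alg M.env M.s₀ T)
      ≤ H * √(Real.log F.card / N) + (H + (1 + 2 * H) * B) / T + H * δ := by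
  have hMe : IsMarkovKernel πe := hPol _ hπe
  have hMa : ∀ t, IsMarkovKernel (alg t) := isMarkovKernel_of_forall_policy hPol halg.mem
  set ρ := M.expertStateLaw πe H with hρ
  have hρp : IsProbabilityMeasure ρ := M.isProbabilityMeasure_expertStateLaw hH
  have hν : expertLaw πe M.env M.s₀ H N = Measure.pi fun _ => ρ := rfl
  have hνp : IsProbabilityMeasure (expertLaw πe M.env M.s₀ H N) := by rw [hν]; infer_instance
  set ν := expertLaw πe M.env M.s₀ H N with hνdef
  set I := interactionLaw ν alg M.env M.s₀ T with hI
  have hIp : IsProbabilityMeasure I := isProbabilityMeasure_interactionLaw ν alg M.env M.s₀ T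
  obtain ⟨net, hcard, hnet1, hnet⟩ := exists_net ds
  have : Nonempty (Fin T) := ⟨⟨0, hT⟩⟩
  have hT' : (0 : ℝ) < T := by exact_mod_cast hT
  have hH' : (0 : ℝ) < H := by exact_mod_cast hH
  have hcm := (hF c hc).1
  have h01 := (hF c hc).2
  set Ve := value πe M.env M.s₀ H c with hVe
  have hVe0 : 0 ≤ Ve := (value_mem_Icc πe M.env M.s₀ h01).1
  set best : (Fin N → State ds) × History (State ds) A H T → ℝ := fun x =>
    ⨅ t : Fin T, value (alg.policy t x.1 (x.2.take t)) M.env M.s₀ H c with hbest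
  let Y : (Fin N → State ds) → ℝ := fun e =>
    maxDeviation ρ F e + ((∑ i, c (e i)) / N - ∫ s, c s ∂ρ)
  let Z : Fin T → (Fin N → State ds) × History (State ds) A H T → ℝ := fun t x =>
    totalCost (alg.policy t x.1 (x.2.take t)) M.env M.s₀ H (M.bonus lam δ (x.2.take t))
  let Bad : Set ((Fin N → State ds) × History (State ds) A H T) :=
    {x | ∃ t : Fin T, ¬ M.NoiseBounded net lam δ (x.2.take t)}
  have hBadm : MeasurableSet Bad := by
    have : Bad = ⋃ t : Fin T, pastOf t.isLt.le ⁻¹'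
        {x : (Fin N → State ds) × History (State ds) A H t | M.NoiseBounded net lam δ x.2}ᶜ := by
      ext x
      simp only [Bad, Set.mem_iUnion]
      rfl
    rw [this]
    exact MeasurableSet.iUnion fun t => measurable_pastOf _
      ((M.measurableSet_noiseBounded net lam δ).preimage measurable_snd).compl
  have hY0 : ∀ e, 0 ≤ Y e := fun e => by
    have := le_maxDeviation ρ hc e
    simp only [Y]
    linarith
  have hZ0 : ∀ t x, 0 ≤ Z t x := fun t x =>
    integral_nonneg fun _ => Finset.sum_nonneg fun _ _ => M.bonus_nonneg _ _ _ _
  -- the regret of a single iteration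
  have hiter : ∀ x, x ∉ Bad → ∀ t : Fin T,
      value (alg.policy t x.1 (x.2.take t)) M.env M.s₀ H c - Ve
        ≤ (if (t : ℕ) = 0 then (H : ℝ) else 0) + H * Y x.1 + (1 + 2 * H) * Z t x := by
    intro x hx t
    have hV := (M.value_policy_mem_Icc (alg := alg) h01 t x).2
    have hZt := mul_nonneg (show (0 : ℝ) ≤ 1 + 2 * H by positivity) (hZ0 t x)
    have hYt := mul_nonneg hH'.le (hY0 x.1)
    split_ifs with h0
    · linarith
    have hgood : M.NoiseBounded net lam δ (x.2.take t) := by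
      by_contra hcon
      exact hx ⟨t, hcon⟩
    have hcal : M.IsCalibrated lam δ (x.2.take t) (West t (x.2.take t)) := fun z =>
      M.l1Dist_model_env_le hnet hlam hδ hδ1 hgood (hWest t _) z
    have := M.value_sub_value_expert_le (alg.policy t x.1 (x.2.take t)) (πe := πe) hcal hF hc hH
      x.1 (halg.minimizes t x.1 (x.2.take t) (Nat.one_le_iff_ne_zero.2 h0) πe hπe)
    simp only [Y, Z]
    linarith
  have hpt : ∀ x, best x - Ve ≤ H * Y x.1 + (H + (1 + 2 * H) * ∑ t, Z t x) / T
      + H * Bad.indicator (fun _ => 1) x := by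
    intro x
    have hle : ∀ t : Fin T, best x ≤ value (alg.policy t x.1 (x.2.take t)) M.env M.s₀ H c :=
      fun t => ciInf_le (Set.finite_range _).bddBelow t
    have hYt := mul_nonneg hH'.le (hY0 x.1)
    have hZs : 0 ≤ ∑ t, Z t x := Finset.sum_nonneg fun t _ => hZ0 t x
    by_cases hx : x ∈ Bad
    · have h1 := hle ⟨0, hT⟩
      have h2 := (M.value_policy_mem_Icc (alg := alg) h01 ⟨0, hT⟩ x).2
      have h3 : 0 ≤ (H + (1 + 2 * H) * ∑ t, Z t x) / T := by positivity
      rw [Set.indicator_of_mem hx]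
      linarith
    · rw [Set.indicator_of_notMem hx, mul_zero, add_zero]
      have h1 := Finset.sum_le_sum fun t (_ : t ∈ (Finset.univ : Finset (Fin T))) =>
        (sub_le_sub_right (hle t) Ve).trans (hiter x hx t)
      rw [Finset.sum_const, Finset.sum_add_distrib, Finset.sum_add_distrib, Finset.sum_const,
        ← Finset.mul_sum, Finset.card_univ, Fintype.card_fin, nsmul_eq_mul, nsmul_eq_mul] at h1
      have h2 : ∑ t : Fin T, (if (t : ℕ) = 0 then (H : ℝ) else 0) = H := by
        rw [Finset.sum_eq_single (⟨0, hT⟩ : Fin T)]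
        · simp
        · intro t _ ht
          rw [if_neg]
          exact fun h => ht (Fin.ext h)
        · simp
      rw [h2] at h1
      have h3 : (H + (1 + 2 * H) * ∑ t, Z t x) / T * T = H + (1 + 2 * H) * ∑ t, Z t x := by
        field_simp
      nlinarith
  -- integrability and the expectation of each term
  have hbint : Integrable best I := M.integrable_iInf_value hT hcm h01 I
  have hdm : Measurable (maxDeviation ρ F : (Fin N → State ds) → ℝ) :=
    measurable_maxDeviation ρ fun f hf => (hF f hf).1
  have hdint : Integrable (maxDeviation ρ F : (Fin N → State ds) → ℝ) ν :=
    integrable_of_forall_abs_le hdm (abs_maxDeviation_le ρ ⟨c, hc⟩ hF hN)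
  have hcmN : Measurable fun e : Fin N → State ds => (∑ i, c (e i)) / (N : ℝ) :=
    (Finset.measurable_sum _ fun i _ => hcm.comp (measurable_pi_apply i)).div_const _
  have hcint : Integrable (fun e : Fin N → State ds => (∑ i, c (e i)) / (N : ℝ)) ν :=
    integrable_of_forall_abs_le hcmN (K := 1) fun e => abs_le.2
      ⟨by linarith [(empirical_mem_Icc h01 hN e).1], (empirical_mem_Icc h01 hN e).2⟩
  have hYint : Integrable Y ν := hdint.add (hcint.sub (integrable_const _))
  have hYval : ∫ e, Y e ∂ν ≤ √(Real.log F.card / N) := by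
    have hmean : ∫ e : Fin N → State ds, (∑ i, c (e i)) / (N : ℝ) ∂ν = ∫ s, c s ∂ρ :=
      integral_empirical ρ hcm h01 hN
    have h1 := integral_add hdint (hcint.sub (integrable_const (∫ s, c s ∂ρ)))
    have h2 := integral_sub hcint (integrable_const (∫ s, c s ∂ρ) (μ := ν))
    simp only [Pi.sub_apply] at h1
    have h3 : ∫ e, Y e ∂ν = ∫ e : Fin N → State ds, maxDeviation ρ F e ∂ν := by
      simp only [Y]
      rw [h1, h2, hmean]
      simp
    rw [h3, hν]
    exact integral_maxDeviation_le ρ ⟨c, hc⟩ hF hN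
  have hfst : I.map Prod.fst = ν := map_fst_interactionLaw ν alg M.env M.s₀ T
  have hYm : Measurable Y := hdm.add (hcmN.sub_const _)
  have hYintI : Integrable (fun x => Y x.1) I := by
    rw [← hfst] at hYint
    exact hYint.comp_measurable measurable_fst
  have hYvalI : ∫ x, Y x.1 ∂I = ∫ e, Y e ∂ν := by
    rw [← hfst, integral_map measurable_fst.aemeasurable hYm.aestronglyMeasurable]
  have hgm : ∀ t : ℕ, Measurable fun p : History (State ds) A H t × (State ds × A) =>
      M.bonus lam δ p.1 p.2 := fun t => M.measurable_bonus lam δ t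
  have hZm : ∀ t, Measurable (Z t) := fun t =>
    (measurable_totalCost_policy alg M.env M.s₀ (hgm t)).comp (measurable_pastOf t.isLt.le)
  have hZb : ∀ t x, |Z t x| ≤ H * (2 * H) := fun t x =>
    abs_integral_le_of_forall_abs_le fun τ => abs_sum_cost_le (M.abs_bonus_le lam δ _) τ
  have hZint : ∀ t, Integrable (Z t) I := fun t => integrable_of_forall_abs_le (hZm t) (hZb t)
  have hZval : ∫ x, ∑ t, Z t x ∂I ≤ B := by
    rw [integral_finsetSum _ fun t _ => hZint t]
    exact M.sum_integral_totalCost_bonus_le ν hB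
  have hBad : I.real Bad ≤ δ := by
    have h := M.interactionLaw_exists_not_noiseBounded_le ν alg hcard hnet1 hlam hδ hδ1 T
    exact ENNReal.toReal_le_of_le_ofReal hδ.le h
  have hBadint : Integrable (Bad.indicator fun _ => (1 : ℝ)) I :=
    (integrable_const 1).indicator hBadm
  have hBadval : ∫ x, Bad.indicator (fun _ => (1 : ℝ)) x ∂I = I.real Bad := by
    rw [integral_indicator_const _ hBadm]; simp
  have hZsint : Integrable (fun x => ∑ t, Z t x) I := integrable_finsetSum _ fun t _ => hZint t
  have i1 : Integrable (fun x => H * Y x.1) I := hYintI.const_mul _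
  have i2 : Integrable (fun x => (H + (1 + 2 * H) * ∑ t, Z t x) / T) I :=
    ((integrable_const _).add (hZsint.const_mul _)).div_const _
  have i3 : Integrable (fun x => H * Bad.indicator (fun _ => (1 : ℝ)) x) I := hBadint.const_mul _
  have i12 : Integrable (fun x => H * Y x.1 + (H + (1 + 2 * H) * ∑ t, Z t x) / T) I := i1.add i2
  have i123 : Integrable (fun x => H * Y x.1 + (H + (1 + 2 * H) * ∑ t, Z t x) / T
      + H * Bad.indicator (fun _ => (1 : ℝ)) x) I := i12.add i3
  calc ∫ x, (best x - Ve) ∂I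
      ≤ ∫ x, (H * Y x.1 + (H + (1 + 2 * H) * ∑ t, Z t x) / T
          + H * Bad.indicator (fun _ => (1 : ℝ)) x) ∂I :=
        integral_mono (hbint.sub (integrable_const _)) i123 hpt
    _ = H * ∫ e, Y e ∂ν + (H + (1 + 2 * H) * ∫ x, ∑ t, Z t x ∂I) / T + H * I.real Bad := by
        rw [integral_add i12 i3, integral_add i1 i2, integral_const_mul, hYvalI, integral_div,
          integral_add (integrable_const _) (hZsint.const_mul _), integral_const_mul,
          integral_const_mul, hBadval]
        simp
    _ ≤ _ := by gcongr

end KNR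

end ImitationKNR

namespace ImitationKNR

/-- The bound on the suboptimality in terms of the information gain, simplified for
`δ = 1 / (H T)`. -/
lemma suboptimality_bound_le {ds d H T : ℕ} (hds : 0 < ds) (hd : 0 < d) (hH : 0 < H) (hT : 0 < T)
    {L q : ℝ} (hL : 0 ≤ L) (hq : 0 ≤ q) :
    H * q + (H + (1 + 2 * H) * (2 * H * √(T * H * (68 * (H *
        (ds + Real.log (T ^ 2 / (1 / (H * T))) + d * L) * (d * L)))))) / T + H * (1 / (H * T))
      ≤ 100 * (1 + Real.log (T * H) + L) *
        (H ^ 3 * √(d * ds + d ^ 2) / √T + H * q) := by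
  have hds' : (1 : ℝ) ≤ ds := by exact_mod_cast hds
  have hd' : (1 : ℝ) ≤ d := by exact_mod_cast hd
  have hH' : (1 : ℝ) ≤ H := by exact_mod_cast hH
  have hT' : (1 : ℝ) ≤ T := by exact_mod_cast hT
  have hTH : (1 : ℝ) ≤ T * H := by nlinarith
  set l := Real.log (T * H) with hl
  have hl0 : 0 ≤ l := Real.log_nonneg hTH
  have hlog : Real.log (T ^ 2 / (1 / (H * T))) ≤ 3 * l := by
    have h3 : (3 : ℝ) * l = Real.log ((T * H) ^ 3) := by rw [Real.log_pow, hl]; norm_num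
    rw [h3]
    refine Real.log_le_log (by positivity) ?_
    have : (T : ℝ) ^ 2 / (1 / (H * T)) = T ^ 3 * H := by field_simp
    rw [this, mul_pow]
    gcongr
    exact le_self_pow₀ hH' (by norm_num)
  set R := 1 + l + L with hR
  have hR1 : 1 ≤ R := by linarith
  set G := √((d : ℝ) * ds + d ^ 2) with hG
  have hG2 : G ^ 2 = d * ds + d ^ 2 := Real.sq_sqrt (by positivity)
  have hG1 : 1 ≤ G := Real.one_le_sqrt.2 (by nlinarith)
  set w := √(T : ℝ) with hw
  have hw2 : w ^ 2 = T := Real.sq_sqrt (by positivity)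
  have hw1 : 1 ≤ w := Real.one_le_sqrt.2 hT'
  have hinfo : (ds + Real.log (T ^ 2 / (1 / (H * T))) + d * L) * (d * L) ≤ 3 * (G * R) ^ 2 := by
    have hdL : 0 ≤ d * L := by positivity
    have hLR : L ≤ R := by linarith
    calc _ ≤ (ds + 3 * l + d * L) * (d * L) := by gcongr
      _ ≤ (ds * R + 3 * d * l + 3 * d * L) * (d * R) := by
          have h1 : (ds : ℝ) ≤ ds * R := le_mul_of_one_le_right (by positivity) hR1
          have h2 : 3 * l ≤ 3 * d * l := by nlinarith
          gcongr
          nlinarith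
      _ ≤ (3 * ds * R + 3 * d * R) * (d * R) := by
          have h1 : (0 : ℝ) ≤ ds * R := by positivity
          have h2 : 3 * d * l + 3 * d * L ≤ 3 * d * R := by rw [hR]; nlinarith
          refine mul_le_mul_of_nonneg_right ?_ (by positivity)
          linarith
      _ = _ := by rw [mul_pow, hG2]; ring
  -- `68 * 3 ≤ 15 ^ 2`
  have hsqrt : √(T * H * (68 * (H *
      (ds + Real.log (T ^ 2 / (1 / (H * T))) + d * L) * (d * L)))) ≤ 15 * (w * H * (G * R)) := by
    refine Real.sqrt_le_iff.2 ⟨by positivity, ?_⟩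
    have h0 : (0 : ℝ) ≤ 68 * (T * H ^ 2) := by positivity
    have h1 := mul_le_mul_of_nonneg_left hinfo h0
    have h2 : (15 * (w * H * (G * R))) ^ 2 = 225 * (T * H ^ 2) * (G * R) ^ 2 := by
      rw [← hw2]; ring
    rw [h2]
    have h3 : (0 : ℝ) ≤ T * H ^ 2 * (G * R) ^ 2 := by positivity
    nlinarith
  have hGR : 1 ≤ G * R := one_le_mul_of_one_le_of_one_le hG1 hR1
  have hH3 : (H : ℝ) ≤ H ^ 3 := le_self_pow₀ hH' (by norm_num)
  -- `92 = 3 * 2 * 15 + 2`, where the `2` pays for the first episode and for the failure event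
  have hmain : (H + (1 + 2 * H) * (2 * H * √(T * H * (68 * (H *
        (ds + Real.log (T ^ 2 / (1 / (H * T))) + d * L) * (d * L)))))) / T + H * (1 / (H * T))
      ≤ 92 * (H ^ 3 * (G * R) / w) := by
    have h1 : (H : ℝ) * (1 / (H * T)) = 1 / T := by field_simp
    rw [h1, ← add_div, ← mul_div_assoc, div_le_div_iff₀ (by positivity) (by positivity), ← hw2]
    have h2 : (1 + 2 * H) * (2 * H * √(w ^ 2 * H * (68 * (H *
        (ds + Real.log ((w ^ 2) ^ 2 / (1 / (H * w ^ 2))) + d * L) * (d * L)))))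
        ≤ (3 * H) * (2 * H * (15 * (w * H * (G * R)))) := by
      rw [hw2]
      gcongr
      linarith
    have h3 : (H : ℝ) ≤ H ^ 3 * (G * R) * w := by
      calc (H : ℝ) ≤ H ^ 3 := hH3
        _ ≤ H ^ 3 * (G * R) := le_mul_of_one_le_right (by positivity) hGR
        _ ≤ _ := le_mul_of_one_le_right (by positivity) hw1
    nlinarith
  have hq' : H * q ≤ 100 * R * (H * q) :=
    le_mul_of_one_le_left (by positivity) (by linarith)
  have hnn : 0 ≤ H ^ 3 * (G * R) / w := by positivity
  have hfin : 100 * R * (H ^ 3 * G / w + H * q)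
      = 100 * (H ^ 3 * (G * R) / w) + 100 * R * (H * q) := by ring
  rw [hfin]
  linarith

end ImitationKNR

theorem corollary2 :
    ∃ C : ℝ, 0 < C ∧
      ∀ (ds d H : ℕ) (A : Type*) [MeasurableSpace A] (M : KNR ds d A),
        0 < ds → 0 < d → 0 < H →
        -- calibration: with probability at least `1 - δ`, for all `t` and all `(s, a)`,
        -- in any infinite adaptive interaction
        (∀ lam δ : ℝ, 0 < lam → 0 < δ → δ < 1 →
          ∀ West : (t : ℕ) → History (State ds) A H t → Matrix (Fin ds) (Fin d) ℝ,
          M.IsRidgeRegression lam West →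
          ∀ (E : Type*) [MeasurableSpace E] (ν : Measure E) [IsProbabilityMeasure ν]
            (alg : Algorithm E (State ds) A H) [∀ t, IsMarkovKernel (alg t)]
            (Ω : Type*) [MeasurableSpace Ω] (μ : Measure Ω) [IsProbabilityMeasure μ]
            (e : Ω → E) (τ : ℕ → Ω → Episode (State ds) A H),
          (∀ T : ℕ, μ.map (fun ω => (e ω, fun k : Fin T => τ k ω))
            = interactionLaw ν alg M.env M.s₀ T) →
          μ {ω | ¬ ∀ (t : ℕ) (z : State ds × A),
              l1Dist (M.model (West t fun k => τ k ω) z) (M.env z)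
                ≤ min (M.uncertainty lam δ (fun k : Fin t => τ k ω) z) 2}
            ≤ ENNReal.ofReal δ) ∧
        -- information gain
        (∀ (E : Type*) [MeasurableSpace E] (ν : Measure E) [IsProbabilityMeasure ν]
          (Pol : Set (Kernel (State ds) A)), (∀ π ∈ Pol, IsMarkovKernel π) →
          ∀ lam δ : ℝ, 0 < lam → lam * spectralNorm₂ M.W ^ 2 ≤ M.σ ^ 2 → 0 < δ → δ < 1 →
          ∀ T : ℕ, 0 < T →
          M.infoGain ν Pol H lam δ T ≤ ENNReal.ofReal
            (C * (H * (d * Real.log (T ^ 2 / δ) + d * ds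
                + d ^ 2 * Real.log (1 + T * H / lam)) * Real.log (1 + T * H / lam)))) ∧
        -- expected suboptimality, with `δ = 1 / (H T)`
        (∀ (F : Finset (State ds → ℝ)) (Pol : Set (Kernel (State ds) A))
          (πe : Kernel (State ds) A) (c : State ds → ℝ),
          (∀ f ∈ F, Measurable f ∧ ∀ s, f s ∈ Set.Icc (0 : ℝ) 1) → c ∈ F →
          (∀ π ∈ Pol, IsMarkovKernel π) → πe ∈ Pol →
          ∀ (N T : ℕ) (lam : ℝ), 0 < N → 0 < T → 0 < lam →
          lam * spectralNorm₂ M.W ^ 2 ≤ M.σ ^ 2 →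
          ∀ West : (t : ℕ) → History (State ds) A H t → Matrix (Fin ds) (Fin d) ℝ,
          M.IsRidgeRegression lam West →
          ∀ alg : Algorithm (Fin N → State ds) (State ds) A H,
          M.IsMobILE F Pol lam (1 / (H * T)) West alg →
          Integrable (fun x : (Fin N → State ds) × History (State ds) A H T =>
              ⨅ t : Fin T, value (alg.policy t x.1 (x.2.take t)) M.env M.s₀ H c)
            (interactionLaw (expertLaw πe M.env M.s₀ H N) alg M.env M.s₀ T) ∧
          ∫ x, ((⨅ t : Fin T, value (alg.policy t x.1 (x.2.take t)) M.env M.s₀ H c)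
              - value πe M.env M.s₀ H c)
            ∂(interactionLaw (expertLaw πe M.env M.s₀ H N) alg M.env M.s₀ T)
            ≤ C * (1 + Real.log (T * H) + Real.log (1 + T * H / lam)) *
              (H ^ 3 * Real.sqrt (d * ds + d ^ 2) / Real.sqrt T
                + H * Real.sqrt (Real.log F.card / N))) := by

  refine ⟨100, by norm_num, fun ds d H A _ M hds hd hH => ⟨?_, ?_, ?_⟩⟩
  · intro lam δ hlam hδ hδ1 West hW E _ ν _ alg _ Ω _ μ _ e τ hlaw
    exact M.measure_not_calibrated_le ν alg hlam hδ hδ1.le hW μ e τ hlaw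
  · intro E _ ν _ Pol hPol lam δ hlam hW hδ hδ1 T hT
    have hT1 : (1 : ℝ) ≤ T := by exact_mod_cast hT
    refine (M.infoGain_le hds ν hPol hlam hW hδ hδ1.le T).trans (ENNReal.ofReal_le_ofReal ?_)
    have hL : 0 ≤ Real.log (1 + T * H / lam) :=
      Real.log_nonneg (le_add_of_nonneg_right (by positivity))
    have hl : 0 ≤ Real.log (T ^ 2 / δ) :=
      Real.log_nonneg ((one_le_div hδ).2 (hδ1.le.trans (one_le_pow₀ hT1)))
    have h0 : 0 ≤ H * (d * Real.log (T ^ 2 / δ) + d * ds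
        + d ^ 2 * Real.log (1 + T * H / lam)) * Real.log (1 + T * H / lam) := by positivity
    linarith
  · intro F Pol πe c hF hc hPol hπe N T lam hN hT hlam hW West hWest alg halg
    have hMe : IsMarkovKernel πe := hPol _ hπe
    have hMa : ∀ t, IsMarkovKernel (alg t) := KNR.isMarkovKernel_of_forall_policy hPol halg.mem
    have hρ : IsProbabilityMeasure (M.expertStateLaw πe H) :=
      M.isProbabilityMeasure_expertStateLaw hH
    have hν : IsProbabilityMeasure (expertLaw πe M.env M.s₀ H N) :=
      inferInstanceAs (IsProbabilityMeasure (Measure.pi fun _ : Fin N => M.expertStateLaw πe H))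
    have hI := isProbabilityMeasure_interactionLaw (expertLaw πe M.env M.s₀ H N) alg M.env M.s₀ T
    have hTH : (1 : ℝ) ≤ H * T := by exact_mod_cast Nat.mul_pos hH hT
    have hδ : (0 : ℝ) < 1 / (H * T) := by positivity
    have hδ1 : (1 : ℝ) / (H * T) ≤ 1 := (div_le_one (by positivity)).2 hTH
    refine ⟨M.integrable_iInf_value hT (hF c hc).1 (hF c hc).2 _, ?_⟩
    refine (M.integral_iInf_value_sub_le_of_sum_bonus_le hF hc hPol hπe hH hN hT hlam hδ hδ1 hWest
      halg fun D => M.sum_bonus_le hds hlam hW hδ hδ1 D).trans ?_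
    exact suboptimality_bound_le hds hd hH hT
      (Real.log_nonneg (le_add_of_nonneg_right (by positivity))) (Real.sqrt_nonneg _)
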